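/- **Setting.** Let $\mathcal X,\mathcal Y$ be metric spaces with their Borel $\sigma$-algebras, $\mu$ a probability measure on $\mathcal X$, and $\nu=\sum_{j=1}^J\nu_j\delta_{y_j}$ with distinct $y_1,\dots,y_J\in\mathcal Y$, $\nu_j>0$ and $\sum_j\nu_j=1$. Let $c:\mathcal X\times\mathcal Y\to\mathbb R$ be lower semi-continuous with $0\le c(x,y)\le c_{\mathcal X}(x)+c_{\mathcal Y}(y)$, where $c_{\mathcal X}\in L^1(\mu)$ and $c_{\mathcal Y}\in L^1(\nu)$. Let $\varepsilon>0$ satisfy $\varepsilon\,(\max_j\nu_j-\min_j\nu_j)\le\min_j\nu_j$. The regularized optimal transport cost is $$W_\varepsilon=\min_{\pi\in\Pi(\mu,\nu)}\int c\,d\pi+\varepsilon\int\Bigl(\log\frac{d\pi}{d(\mu\otimes\nu)}-1\Bigr)d\pi ,$$ where $\Pi(\mu,\nu)$ is the set of probability measures on $\mathcal X\times\mathcal Y$ with marginals $\mu$ and $\nu$, and the last integral is $+\infty$ if $\pi\not\ll\mu\otimes\nu$ or if $\log\frac{d\pi}{d(\mu\otimes\nu)}$ is not $\pi$-integrable. For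 $x\in\mathcal X$ and $v\in\mathbb R^J$ put $$h_\varepsilon(x,v)=\varepsilon+\varepsilon\log\Bigl(\sum_{j=1}^J e^{(v_j-c(x,y_j))/\varepsilon}\nu_j\Bigr)-\sum_{j=1}^J v_j\nu_j,\qquad H_\varepsilon(v)=\int h_\varepsilon(x,v)\,d\mu(x),$$ $$G_\varepsilon(v)=\int \nabla_vh_\varepsilon(x,v)\,\nabla_vh_\varepsilon(x,v)^T\,d\mu(x).$$ Let $\mathbf v_J=J^{-1/2}(1,\dots,1)^T$ and $P_J=I_J-\mathbf v_J\mathbf v_J^T$. Assume that $H_\varepsilon$ has a minimizer over $\mathbb R^J$; let $v^*$ be the minimizer orthogonal to $\mathbf v_J$. Assume that $\min\{v^TG_\varepsilon(v^*)v/\|v\|^2 : v\perp\mathbf v_J,\ v\ne0\}>0$ (a void condition if $J=1$). **Algorithm.** Let $X_1,X_2,\dots$ be i.i.d. random variables of law $\mu$, and let $\widehat V_0$ be a random vector orthogonal to $\mathbf v_J$ almost surely, independent of $(X_n)_{n\ge1}$, with $\mathbb E[e^{t\|\widehat V_0\|}]<\infty$ for some $t>0$ (for instance, $\widehat V_0$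 deterministic). Let $\gamma>0$, $0<\beta<1/2$, $S_0=I_J$ and, for $n\ge0$, $$\widehat V_{n+1}=P_J\bigl(\widehat V_n-n^\alpha S_n^{-1}\nabla_vh_\varepsilon(X_{n+1},\widehat V_n)\bigr),$$ $$S_{n+1}=S_n+\nabla_vh_\varepsilon(X_{n+1},\widehat V_n)\nabla_vh_\varepsilon(X_{n+1},\widehat V_n)^T+\gamma\Bigl(1+\Bigl\lfloor\frac{n+1}{J}\Bigr\rfloor\Bigr)^{-\beta}Z_{n+1}Z_{n+1}^T,$$ where $Z_k=\sqrt{\nu_{\ell_k}}\,e_{\ell_k}$, $\ell_k=1+\bigl((k-1)\bmod J\bigr)$ and $(e_1,\dots,e_J)$ is the canonical basis of $\mathbb R^J$. For $n\ge1$ put $\overline S_n=\frac1nS_n$ and $\widehat W_n=-\frac1n\sum_{k=1}^nh_\varepsilon(X_k,\widehat V_{k-1})$. **Theorem.** Assume that $0<\alpha<1/2$ and $4\beta<1-2\alpha$. Then there is a constant $c_\varepsilon>0$, independent of $n$, such that for all $n\ge1$ the expectations below are well defined and finite, and $$\mathbb E\bigl[\|\widehat V_n-v^*\|^2\bigr]\le\frac{c_\varepsilon}{n^{1-\alpha}},\qquad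 \mathbb E\bigl[\|\overline S_n-G_\varepsilon(v^*)\|_F^2\bigr]\le\frac{c_\varepsilon}{n^{2\beta}},\qquad \bigl|\mathbb E[\widehat W_n]-W_\varepsilon\bigr|\le\frac{c_\varepsilon}{n^{1-\alpha}} .$$ If, moreover, $\int c(x,y_j)^2\,d\mu(x)<\infty$ for every $1\le j\le J$, then also $\mathbb E\bigl[|\widehat W_n-W_\varepsilon|\bigr]\le c_\varepsilon/\sqrt n$ for all $n\ge1$. -/

import Mathlib

open MeasureTheory ProbabilityTheory
open scoped Matrix

noncomputable section

namespace SemiDiscreteOT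

/-! ### The regularized optimal transport problem -/

/-- The set `Π(μ, ν)` of probability measures on the product with marginals `μ` and `ν`. -/
def couplings {X Y : Type*} [MeasurableSpace X] [MeasurableSpace Y]
    (μ : Measure X) (ν : Measure Y) : Set (Measure (X × Y)) :=
  {π | IsProbabilityMeasure π ∧ π.map Prod.fst = μ ∧ π.map Prod.snd = ν}

open Classical in
/-- The divergence `KL(π | ξ) = ∫ (log (dπ/dξ) - 1) dπ`, equal to `+∞` if `π` is not absolutely
continuous with respect to `ξ` or if `log (dπ/dξ)` is not `π`-integrable. -/
def kl {Z : Type*} [MeasurableSpace Z] (π ξ : Measure Z) : EReal :=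
  if π ≪ ξ ∧ Integrable (llr π ξ) π then ((∫ z, (llr π ξ z - 1) ∂π : ℝ) : EReal) else ⊤

/-- The objective `∫ c dπ + ε KL(π | μ ⊗ ν)` for a non-negative cost `c`. -/
def primalObjective {X Y : Type*} [MeasurableSpace X] [MeasurableSpace Y]
    (ε : ℝ) (c : X → Y → ℝ) (μ : Measure X) (ν : Measure Y) (π : Measure (X × Y)) : EReal :=
  ((∫⁻ z, ENNReal.ofReal (c z.1 z.2) ∂π : ENNReal) : EReal) + (ε : EReal) * kl π (μ.prod ν)

/-- The regularized optimal transport cost `W_ε(μ, ν)`, in its primal (Kantorovich) form. -/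
def regularizedCost {X Y : Type*} [MeasurableSpace X] [MeasurableSpace Y]
    (ε : ℝ) (c : X → Y → ℝ) (μ : Measure X) (ν : Measure Y) : ℝ :=
  (⨅ π ∈ couplings μ ν, primalObjective ε c μ ν π).toReal

/-- The discrete measure `∑ j, w j • δ_{y j}`. -/
def discreteMeasure {Y : Type*} [MeasurableSpace Y] {J : ℕ} (y : Fin J → Y) (w : Fin J → ℝ) :
    Measure Y :=
  ∑ j, ENNReal.ofReal (w j) • Measure.dirac (y j)

/-! ### The semi-dual objective -/

/-- The function `h_ε(x, v)`. -/
def h {X Y : Type*} {J : ℕ} (ε : ℝ) (c : X → Y → ℝ) (y : Fin J → Y) (w : Fin J → ℝ)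
    (x : X) (v : EuclideanSpace ℝ (Fin J)) : ℝ :=
  ε + ε * Real.log (∑ j, Real.exp ((v j - c x (y j)) / ε) * w j) - ∑ j, v j * w j

/-- The gradient `∇_v h_ε(x, v)`. -/
def gradh {X Y : Type*} {J : ℕ} (ε : ℝ) (c : X → Y → ℝ) (y : Fin J → Y) (w : Fin J → ℝ)
    (x : X) (v : EuclideanSpace ℝ (Fin J)) : EuclideanSpace ℝ (Fin J) :=
  gradient (fun u => h ε c y w x u) v

/-- The function `H_ε(v) = ∫ h_ε(x, v) dμ(x)`. -/
def H {X Y : Type*} [MeasurableSpace X] {J : ℕ} (ε : ℝ) (c : X → Y → ℝ) (μ : Measure X)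
    (y : Fin J → Y) (w : Fin J → ℝ) (v : EuclideanSpace ℝ (Fin J)) : ℝ :=
  ∫ x, h ε c y w x v ∂μ

/-- The matrix `G_ε(v) = E[∇_v h_ε(X, v) ∇_v h_ε(X, v)ᵀ]`, with `X` of law `μ`. -/
def G {X Y : Type*} [MeasurableSpace X] {J : ℕ} (ε : ℝ) (c : X → Y → ℝ) (μ : Measure X)
    (y : Fin J → Y) (w : Fin J → ℝ) (v : EuclideanSpace ℝ (Fin J)) :
    Matrix (Fin J) (Fin J) ℝ :=
  Matrix.of fun i j => ∫ x, gradh ε c y w x v i * gradh ε c y w x v j ∂μ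

/-! ### The orthogonal complement of the constants -/

/-- The unit vector `v_J = J^{-1/2} (1, …, 1)`. -/
def vJ (J : ℕ) : EuclideanSpace ℝ (Fin J) :=
  WithLp.toLp 2 fun _ => 1 / Real.sqrt J

/-- The orthogonal complement of the line spanned by `v_J`. -/
def vJPerp (J : ℕ) : Submodule ℝ (EuclideanSpace ℝ (Fin J)) :=
  (Submodule.span ℝ {vJ J})ᗮ

/-- The projection matrix `P_J = I_J - v_J v_Jᵀ`. -/
def PJ (J : ℕ) : Matrix (Fin J) (Fin J) ℝ :=
  1 - Matrix.vecMulVec (vJ J).ofLp (vJ J).ofLp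

/-! ### The stochastic Gauss-Newton algorithm -/

/-- The vector `Z_k = √(w_{ℓ_k}) e_{ℓ_k}`, `ℓ_k = 1 + (k - 1) mod J`, for `k ≥ 1`
(the coordinate `ℓ_k` is the element `(k - 1) % J` of `Fin J`). -/
def Z {J : ℕ} (w : Fin J → ℝ) (k : ℕ) : Fin J → ℝ :=
  fun j => if (j : ℕ) = (k - 1) % J then Real.sqrt (w j) else 0

/-- The pair `(V̂_n, S_n)` computed from the initial value `v₀` and the data `x`,
where `x n` is the `(n + 1)`-st data point `X_{n+1}`. -/
def sgn {X Y : Type*} {J : ℕ} (ε : ℝ) (c : X → Y → ℝ) (y : Fin J → Y) (w : Fin J → ℝ)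
    (α β γ : ℝ) (v₀ : EuclideanSpace ℝ (Fin J)) (x : ℕ → X) :
    ℕ → EuclideanSpace ℝ (Fin J) × Matrix (Fin J) (Fin J) ℝ
  | 0 => (v₀, 1)
  | n + 1 =>
    let V := (sgn ε c y w α β γ v₀ x n).1
    let S := (sgn ε c y w α β γ v₀ x n).2
    let g := gradh ε c y w (x n) V
    (WithLp.toLp 2 (PJ J *ᵥ (V.ofLp - (n : ℝ) ^ α • (S⁻¹ *ᵥ g.ofLp))),
      S + Matrix.vecMulVec g.ofLp g.ofLp
        + (γ * (1 + (((n + 1) / J : ℕ) : ℝ)) ^ (-β)) •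
            Matrix.vecMulVec (Z w (n + 1)) (Z w (n + 1)))

/-- The iterate `V̂_n`. -/
def Vhat {X Y : Type*} {J : ℕ} (ε : ℝ) (c : X → Y → ℝ) (y : Fin J → Y) (w : Fin J → ℝ)
    (α β γ : ℝ) (v₀ : EuclideanSpace ℝ (Fin J)) (x : ℕ → X) (n : ℕ) :
    EuclideanSpace ℝ (Fin J) :=
  (sgn ε c y w α β γ v₀ x n).1

/-- The matrix `S̄_n = S_n / n`. -/
def Sbar {X Y : Type*} {J : ℕ} (ε : ℝ) (c : X → Y → ℝ) (y : Fin J → Y) (w : Fin J → ℝ)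
    (α β γ : ℝ) (v₀ : EuclideanSpace ℝ (Fin J)) (x : ℕ → X) (n : ℕ) :
    Matrix (Fin J) (Fin J) ℝ :=
  (n : ℝ)⁻¹ • (sgn ε c y w α β γ v₀ x n).2

/-- The recursive estimator `Ŵ_n = -(1/n) ∑_{k=1}^n h_ε(X_k, V̂_{k-1})`. -/
def What {X Y : Type*} {J : ℕ} (ε : ℝ) (c : X → Y → ℝ) (y : Fin J → Y) (w : Fin J → ℝ)
    (α β γ : ℝ) (v₀ : EuclideanSpace ℝ (Fin J)) (x : ℕ → X) (n : ℕ) : ℝ :=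
  -((n : ℝ)⁻¹ * ∑ k ∈ Finset.range n, h ε c y w (x k) (Vhat ε c y w α β γ v₀ x k))

/-- The squared Frobenius norm. -/
def frobSq {J : ℕ} (A : Matrix (Fin J) (Fin J) ℝ) : ℝ :=
  ∑ i, ∑ j, A i j ^ 2

end SemiDiscreteOT

end

noncomputable section

namespace SemiDiscreteOT

/-! ### Exponential tilting of a probability vector -/

/-! Duality. Along a coupling, the cost plus `ε` times the log-density of the Gibbs kernel at `v`
integrates to `ε - H v`, because everything else depends on the marginals alone. Hence the primal
objective is `-H vs` plus `ε` times a relative entropy with respect to the Gibbs coupling at `vs`.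
That coupling has second marginal `ν` exactly because the gradient of `H` vanishes at `vs`, so the
optimal cost is `-H vs` (`regularizedCost_eq`).

Geometry. Moving the dual variable tilts the Gibbs weights exponentially. A covariance identity for
tilting makes the gradient of `H` grow on zero-sum vectors (`exists_gradH_growth`). Thus the excess
`s = H v - H vs` grows quadratically near `vs` and linearly far away, and the squared gradient
dominates `min s 1` (`exists_lojasiewicz`). Since this saturates, the Lyapunov function is `exp (t *
s)` rather than `s`: for `0 < t ≤ 1` one has `exp (t * s) * min s 1 ≥ exp (t * s) - 1`, which turns
the weak drift at infinity into a genuine contraction.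

One step. Deterministically, `S_n` is at most a multiple of `n` and at least a multiple of `n ^ (1 -
β)`, the latter thanks to the regularizing matrices. The upper bound gives a drift of order `n ^ (α
- 1)`, the lower one squared steps of order `n ^ (2 * α + 2 * β - 2)`. Conditioning on the past
replaces the sample gradient by that of `H` (`lyapunov_step`), and a scalar recursion converts drift
against noise into a rate (`exists_le_rpow_of_recursion`).

Two passes (`exists_rates`). The worst-case step length gives the suboptimal rate `n ^ (-(1 - α - 2
* β))` for the iterates. This makes the empirical Gram matrix converge to `G vs` in mean square at
least as fast as `n ^ (-2 * β)`, by orthogonality of martingale increments and Lipschitz continuity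
of `G`. Where the Gram matrix is close to `G vs`, the step is as short as if `S_n` were of order
`n`; elsewhere the worst case is paid, and its loss of `n ^ (2 * β)` is compensated by the rate of
the Gram matrix. The mean squared step is then of order `n ^ (2 * α - 2)`, and a second pass through
the recursion gives `n ^ (-(1 - α))`.

Cost estimator. Its bias is minus the average expected excess at the iterates, hence of order `n ^
(-(1 - α))`. Its fluctuation is a normalized sum of martingale increments, of order `n ^ (-1/2)` in
mean once the cost is square integrable. -/

/-- Used twice: for the smoothness of log-sum-exp and for the exponential Lyapunov function. In both
cases the argument is bounded because the displacement is. -/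
lemma exp_le_quadratic {z B : ℝ} (hz : |z| ≤ B) :
    Real.exp z ≤ 1 + z + Real.exp B * z ^ 2 := by
  have hB : 1 ≤ Real.exp B := Real.one_le_exp ((abs_nonneg z).trans hz)
  rcases le_or_gt |z| 1 with h1 | h1
  · have := (abs_le.1 (Real.abs_exp_sub_one_sub_id_le h1)).2
    nlinarith [sq_nonneg z]
  · rcases lt_abs.1 h1 with h | h
    · have h2 : Real.exp z ≤ Real.exp B := Real.exp_le_exp.2 ((le_abs_self z).trans hz)
      nlinarith [mul_le_mul_of_nonneg_left (show 1 ≤ z ^ 2 by nlinarith) (Real.exp_pos B).le]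
    · have h2 : Real.exp z ≤ 1 := Real.exp_le_one_iff.2 (by linarith)
      nlinarith [sq_nonneg z]

section Tilting

variable {ι : Type*} [Fintype ι] {p : ι → ℝ}

lemma sum_mul_exp_pos (hp : ∀ j, 0 < p j) (hs : ∑ j, p j = 1) (z : ι → ℝ) :
    0 < ∑ j, p j * Real.exp (z j) := by
  have : (Finset.univ : Finset ι).Nonempty := by
    rw [Finset.nonempty_iff_ne_empty]
    intro h
    rw [h] at hs
    simp at hs
  exact Finset.sum_pos (fun j _ => mul_pos (hp j) (Real.exp_pos _)) this

/-- Jensen's inequality: subtracting `L` normalizes the tilted weights, after which `1 + u ≤ exp u`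
suffices. -/
lemma sum_mul_le_log_sum_exp (hp : ∀ j, 0 < p j) (hs : ∑ j, p j = 1) (z : ι → ℝ) :
    ∑ j, p j * z j ≤ Real.log (∑ j, p j * Real.exp (z j)) := by
  set L := Real.log (∑ j, p j * Real.exp (z j)) with hL
  have h1 : ∑ j, p j * Real.exp (z j - L) = 1 := by
    simp_rw [Real.exp_sub, hL, Real.exp_log (sum_mul_exp_pos hp hs z), mul_div_assoc']
    rw [← Finset.sum_div, div_self (sum_mul_exp_pos hp hs z).ne']
  have h2 : ∑ j, p j * (z j - L + 1) ≤ ∑ j, p j * Real.exp (z j - L) :=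
    Finset.sum_le_sum fun j _ => mul_le_mul_of_nonneg_left (Real.add_one_le_exp _) (hp j).le
  have h3 : ∑ j, p j * (z j - L + 1) = ∑ j, p j * z j - L + 1 := by
    simp_rw [mul_add, mul_sub, Finset.sum_add_distrib, Finset.sum_sub_distrib, ← Finset.sum_mul, hs]
    ring
  linarith

lemma log_sum_exp_le (hp : ∀ j, 0 < p j) (hs : ∑ j, p j = 1) {z : ι → ℝ} {B : ℝ}
    (hz : ∀ j, |z j| ≤ B) :
    Real.log (∑ j, p j * Real.exp (z j)) ≤ ∑ j, p j * z j + Real.exp B * ∑ j, z j ^ 2 := by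
  have hp1 : ∀ j, p j ≤ 1 := fun j => hs ▸ Finset.single_le_sum (f := p)
    (fun i _ => (hp i).le) (Finset.mem_univ j)
  have h1 := Real.log_le_sub_one_of_pos (sum_mul_exp_pos hp hs z)
  have h2 : ∑ j, p j * Real.exp (z j) ≤
      ∑ j, (p j + p j * z j + Real.exp B * z j ^ 2) := by
    refine Finset.sum_le_sum fun j _ => ?_
    have h3 := mul_le_mul_of_nonneg_left (exp_le_quadratic (hz j)) (hp j).le
    have h4 : p j * (Real.exp B * z j ^ 2) ≤ 1 * (Real.exp B * z j ^ 2) :=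
      mul_le_mul_of_nonneg_right (hp1 j) (by positivity)
    linarith
  simp_rw [Finset.sum_add_distrib, hs, ← Finset.mul_sum] at h2
  linarith

/-- Weights and normalization each change by a factor in `[exp (-b), exp b]`, so the old and new
weights have ratio at least `exp (-2b) ≥ 1 - 2b` in either order. As both are at most one, no
smallness of `b` is needed. -/
lemma abs_tilt_sub_le (hp : ∀ j, 0 < p j) (hs : ∑ j, p j = 1) {z : ι → ℝ} {b : ℝ}
    (hz : ∀ j, |z j| ≤ b) (j : ι) :
    |p j * Real.exp (z j) / (∑ k, p k * Real.exp (z k)) - p j| ≤ 2 * b := by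
  set T := ∑ k, p k * Real.exp (z k) with hT
  have hT0 : 0 < T := sum_mul_exp_pos hp hs z
  have hpj : p j ≤ 1 := hs ▸ Finset.single_le_sum (f := p)
    (fun i _ => (hp i).le) (Finset.mem_univ j)
  have hb : 0 ≤ b := (abs_nonneg _).trans (hz j)
  have hTu : T ≤ Real.exp b := by
    calc T ≤ ∑ k, p k * Real.exp b := Finset.sum_le_sum fun k _ =>
          mul_le_mul_of_nonneg_left (Real.exp_le_exp.2 (abs_le.1 (hz k)).2) (hp k).le
      _ = _ := by rw [← Finset.sum_mul, hs, one_mul]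
  have hTl : Real.exp (-b) ≤ T := by
    calc Real.exp (-b) = ∑ k, p k * Real.exp (-b) := by rw [← Finset.sum_mul, hs, one_mul]
      _ ≤ T := Finset.sum_le_sum fun k _ =>
          mul_le_mul_of_nonneg_left (Real.exp_le_exp.2 (abs_le.1 (hz k)).1) (hp k).le
  set q := p j * Real.exp (z j) / T with hq
  have hq0 : 0 ≤ q := by have := hp j; positivity
  have hq1 : q ≤ 1 := by
    rw [hq, div_le_one hT0]
    exact Finset.single_le_sum (f := fun k => p k * Real.exp (z k))
      (fun i _ => mul_nonneg (hp i).le (Real.exp_pos _).le) (Finset.mem_univ j)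
  have e1 : 1 - 2 * b ≤ Real.exp (-(2 * b)) := by linarith [Real.add_one_le_exp (-(2 * b))]
  have hqT : q * T = p j * Real.exp (z j) := by rw [hq]; field_simp
  have e2 : Real.exp (-(2 * b)) = Real.exp (-b) * Real.exp (-b) := by
    rw [← Real.exp_add]; ring_nf
  have e3 : Real.exp b * Real.exp (-b) = 1 := by rw [← Real.exp_add]; simp
  have hzj := abs_le.1 (hz j)
  have a1 : p j * Real.exp (-(2 * b)) ≤ q := by
    have h1 : p j * Real.exp (-b) ≤ q * Real.exp b :=
      calc p j * Real.exp (-b) ≤ p j * Real.exp (z j) :=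
            mul_le_mul_of_nonneg_left (Real.exp_le_exp.2 hzj.1) (hp j).le
        _ = q * T := hqT.symm
        _ ≤ _ := mul_le_mul_of_nonneg_left hTu hq0
    have h2 := mul_le_mul_of_nonneg_right h1 (Real.exp_pos (-b)).le
    rw [mul_assoc q, e3, mul_assoc, ← e2, mul_one] at h2
    exact h2
  have a2 : q * Real.exp (-(2 * b)) ≤ p j := by
    have h1 : q * Real.exp (-b) ≤ p j * Real.exp b :=
      calc q * Real.exp (-b) ≤ q * T := mul_le_mul_of_nonneg_left hTl hq0
        _ = p j * Real.exp (z j) := hqT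
        _ ≤ _ := mul_le_mul_of_nonneg_left (Real.exp_le_exp.2 hzj.2) (hp j).le
    have h2 := mul_le_mul_of_nonneg_right h1 (Real.exp_pos (-b)).le
    rw [mul_assoc (p j), e3, mul_assoc, ← e2, mul_one] at h2
    exact h2
  rw [abs_le]
  constructor
  · nlinarith [mul_le_mul_of_nonneg_left e1 (hp j).le]
  · nlinarith [mul_le_mul_of_nonneg_left e1 hq0]

/-- Symmetrizing, `2T` times the right side is the double sum of `p i * p j * (exp (z i) - exp (z
j)) * (z i - z j)`, all of whose terms are nonnegative. Only the pair `(a, b)` is kept, and the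
normalization is at most `exp (z a)` because `z a` is maximal. -/
lemma tilt_monotone (hp : ∀ j, 0 < p j) (hs : ∑ j, p j = 1) {z : ι → ℝ} {a b : ι}
    (ha : ∀ j, z j ≤ z a) :
    p a * p b * ((z a - z b) ^ 2 / (1 + (z a - z b))) / 2 ≤
      ∑ j, (p j * Real.exp (z j) / (∑ k, p k * Real.exp (z k)) - p j) * z j := by
  set T := ∑ k, p k * Real.exp (z k) with hT
  have hT0 : 0 < T := sum_mul_exp_pos hp hs z
  have hTu : T ≤ Real.exp (z a) := by
    calc T ≤ ∑ k, p k * Real.exp (z a) := Finset.sum_le_sum fun k _ =>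
          mul_le_mul_of_nonneg_left (Real.exp_le_exp.2 (ha k)) (hp k).le
      _ = _ := by rw [← Finset.sum_mul, hs, one_mul]
  let f : ι → ι → ℝ := fun i j =>
    p i * p j * ((Real.exp (z i) - Real.exp (z j)) * (z i - z j))
  have hf : ∀ i j, 0 ≤ f i j := fun i j => by
    refine mul_nonneg (mul_pos (hp i) (hp j)).le ?_
    rcases le_total (z i) (z j) with h | h
    · exact mul_nonneg_of_nonpos_of_nonpos (sub_nonpos.2 (Real.exp_le_exp.2 h)) (sub_nonpos.2 h)
    · exact mul_nonneg (sub_nonneg.2 (Real.exp_le_exp.2 h)) (sub_nonneg.2 h)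
  have hsum : ∑ i, ∑ j, f i j = 2 * (∑ i, p i * Real.exp (z i) * z i - T * ∑ i, p i * z i) := by
    have h1 : ∀ i j, f i j =
      (p i * Real.exp (z i) * z i) * p j - (p i * Real.exp (z i)) * (p j * z j)
        - (p i * z i) * (p j * Real.exp (z j)) + p i * (p j * Real.exp (z j) * z j) := by
      intro i j; simp only [f]; ring
    simp_rw [h1, Finset.sum_add_distrib, Finset.sum_sub_distrib, ← Finset.mul_sum,
      ← Finset.sum_mul, hs, ← hT]
    ring
  have hab : f a b ≤ ∑ i, ∑ j, f i j :=
    (Finset.single_le_sum (f := f a) (fun j _ => hf a j) (Finset.mem_univ b)).trans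
      (Finset.single_le_sum (f := fun i => ∑ j, f i j)
        (fun i _ => Finset.sum_nonneg fun j _ => hf i j) (Finset.mem_univ a))
  have hR : ∑ j, (p j * Real.exp (z j) / T - p j) * z j =
      (∑ i, p i * Real.exp (z i) * z i - T * ∑ i, p i * z i) / T := by
    rw [sub_div, mul_div_cancel_left₀ _ hT0.ne', Finset.sum_div, ← Finset.sum_sub_distrib]
    exact Finset.sum_congr rfl fun j _ => by ring
  rw [hR, le_div_iff₀ hT0]
  set r := z a - z b with hr
  have hr0 : 0 ≤ r := sub_nonneg.2 (ha b)
  -- The factor `1 - exp (-r) ≥ r / (1 + r)` is what makes the growth quadratic for small gaps and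
  -- linear for large ones.
  have hexp : Real.exp (z a) * (r / (1 + r)) ≤ Real.exp (z a) - Real.exp (z b) := by
    have h1 : Real.exp (z b) = Real.exp (z a) * Real.exp (-r) := by
      rw [← Real.exp_add, hr]; ring_nf
    have h2 : Real.exp (-r) ≤ 1 / (1 + r) := by
      rw [Real.exp_neg, ← one_div]
      exact one_div_le_one_div_of_le (by linarith) (by linarith [Real.add_one_le_exp r])
    have h3 : r / (1 + r) = 1 - 1 / (1 + r) := by field_simp; ring
    rw [h1, h3]
    nlinarith [Real.exp_pos (z a)]
  have hk : p a * p b * (r ^ 2 / (1 + r)) * T ≤ f a b := by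
    have h0 : 0 ≤ r ^ 2 / (1 + r) := by positivity
    calc p a * p b * (r ^ 2 / (1 + r)) * T ≤ p a * p b * (r ^ 2 / (1 + r)) * Real.exp (z a) :=
          mul_le_mul_of_nonneg_left hTu (mul_nonneg (mul_pos (hp a) (hp b)).le h0)
      _ = p a * p b * ((Real.exp (z a) * (r / (1 + r))) * r) := by ring
      _ ≤ f a b := mul_le_mul_of_nonneg_left (mul_le_mul_of_nonneg_right hexp hr0)
          (mul_pos (hp a) (hp b)).le
  linarith

end Tilting

/-! ### The semi-dual integrand -/

section Pointwise

variable {X Y : Type*} {J : ℕ} {ε : ℝ} {c : X → Y → ℝ} {y : Fin J → Y} {w : Fin J → ℝ}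

/-- The normalising constant of the Gibbs weights. -/
def part (ε : ℝ) (c : X → Y → ℝ) (y : Fin J → Y) (w : Fin J → ℝ) (x : X)
    (v : EuclideanSpace ℝ (Fin J)) : ℝ :=
  ∑ j, Real.exp ((v j - c x (y j)) / ε) * w j

/-- The Gibbs weights, that is `∇_v h_ε(x, v) + w`. -/
def gibbs (ε : ℝ) (c : X → Y → ℝ) (y : Fin J → Y) (w : Fin J → ℝ) (x : X)
    (v : EuclideanSpace ℝ (Fin J)) (j : Fin J) : ℝ :=
  Real.exp ((v j - c x (y j)) / ε) * w j / part ε c y w x v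

lemma exists_index (hs : ∑ j, w j = 1) : Nonempty (Fin J) := by
  by_contra h
  rw [not_nonempty_iff] at h
  simp at hs

variable (hw : ∀ j, 0 < w j) (hs : ∑ j, w j = 1)

lemma abs_apply_le_norm (v : EuclideanSpace ℝ (Fin J)) (j : Fin J) : |v j| ≤ ‖v‖ := by
  simpa using PiLp.norm_apply_le v j

include hw hs

lemma part_pos (x : X) (v : EuclideanSpace ℝ (Fin J)) : 0 < part ε c y w x v := by
  have := exists_index hs
  exact Finset.sum_pos (fun j _ => mul_pos (Real.exp_pos _) (hw j)) Finset.univ_nonempty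

lemma gibbs_pos (x : X) (v : EuclideanSpace ℝ (Fin J)) (j : Fin J) :
    0 < gibbs ε c y w x v j :=
  div_pos (mul_pos (Real.exp_pos _) (hw j)) (part_pos hw hs x v)

lemma sum_gibbs (x : X) (v : EuclideanSpace ℝ (Fin J)) : ∑ j, gibbs ε c y w x v j = 1 := by
  simp_rw [gibbs, ← Finset.sum_div]
  exact div_self (part_pos hw hs x v).ne'

lemma gibbs_le_one (x : X) (v : EuclideanSpace ℝ (Fin J)) (j : Fin J) :
    gibbs ε c y w x v j ≤ 1 :=
  sum_gibbs (ε := ε) (c := c) (y := y) hw hs x v ▸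
    Finset.single_le_sum (f := gibbs ε c y w x v) (fun i _ => (gibbs_pos hw hs x v i).le)
      (Finset.mem_univ j)

/-- Moving the dual variable by `d` tilts the Gibbs weights by `d / ε`, which reduces the estimates
on `h` to the lemmas on tilting. -/
lemma part_add (x : X) (v d : EuclideanSpace ℝ (Fin J)) :
    part ε c y w x (v + d) =
      part ε c y w x v * ∑ j, gibbs ε c y w x v j * Real.exp (d j / ε) := by
  rw [Finset.mul_sum, part]
  refine Finset.sum_congr rfl fun j _ => ?_
  have := (part_pos (ε := ε) (c := c) (y := y) hw hs x v).ne'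
  rw [gibbs]
  field_simp
  rw [mul_assoc, ← Real.exp_add, PiLp.add_apply, mul_comm]
  congr 2
  ring

lemma gibbs_add (x : X) (v d : EuclideanSpace ℝ (Fin J)) (j : Fin J) :
    gibbs ε c y w x (v + d) j = gibbs ε c y w x v j * Real.exp (d j / ε) /
      ∑ k, gibbs ε c y w x v k * Real.exp (d k / ε) := by
  have h0 := (part_pos (ε := ε) (c := c) (y := y) hw hs x v).ne'
  have h1 := (sum_mul_exp_pos (gibbs_pos (ε := ε) (c := c) (y := y) hw hs x v)
    (sum_gibbs hw hs x v) (fun j => d j / ε)).ne'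
  rw [gibbs, part_add hw hs, div_eq_div_iff (mul_ne_zero h0 h1) h1, gibbs]
  have : Real.exp (((v + d) j - c x (y j)) / ε) =
      Real.exp ((v j - c x (y j)) / ε) * Real.exp (d j / ε) := by
    rw [← Real.exp_add, PiLp.add_apply]; congr 1; ring
  rw [this]
  field_simp

lemma h_add_sub (x : X) (v d : EuclideanSpace ℝ (Fin J)) :
    h ε c y w x (v + d) - h ε c y w x v =
      ε * Real.log (∑ j, gibbs ε c y w x v j * Real.exp (d j / ε)) - ∑ j, d j * w j := by
  have h0 := part_pos (ε := ε) (c := c) (y := y) hw hs x v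
  have h1 := sum_mul_exp_pos (gibbs_pos (ε := ε) (c := c) (y := y) hw hs x v)
    (sum_gibbs hw hs x v) (fun j => d j / ε)
  have h2 := part_add (ε := ε) (c := c) (y := y) hw hs x v d
  rw [part] at h2
  simp only [h, h2, Real.log_mul h0.ne' h1.ne']
  rw [← part]
  simp_rw [PiLp.add_apply, add_mul, Finset.sum_add_distrib]
  ring

lemma h_add_ge (hε : 0 < ε) (x : X) (v d : EuclideanSpace ℝ (Fin J)) :
    h ε c y w x v + ∑ j, (gibbs ε c y w x v j - w j) * d j ≤ h ε c y w x (v + d) := by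
  have h1 := sum_mul_le_log_sum_exp (gibbs_pos (ε := ε) (c := c) (y := y) hw hs x v)
    (sum_gibbs hw hs x v) (fun j => d j / ε)
  have h2 := h_add_sub (ε := ε) (c := c) (y := y) hw hs x v d
  have h3 : ∑ j, gibbs ε c y w x v j * d j = ε * ∑ j, gibbs ε c y w x v j * (d j / ε) := by
    rw [Finset.mul_sum]
    exact Finset.sum_congr rfl fun j _ => by field_simp
  have h4 := mul_le_mul_of_nonneg_left h1 hε.le
  simp_rw [sub_mul, Finset.sum_sub_distrib, h3, mul_comm (w _)]
  linarith

/-- A crude smoothness bound, valid for bounded displacements; this is enough because the steps of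
the algorithm are deterministically bounded. -/
lemma h_add_le (hε : 0 < ε) (x : X) (v d : EuclideanSpace ℝ (Fin J)) {B : ℝ} (hB : ‖d‖ ≤ B) :
    h ε c y w x (v + d) ≤ h ε c y w x v + ∑ j, (gibbs ε c y w x v j - w j) * d j
      + Real.exp (B / ε) / ε * ‖d‖ ^ 2 := by
  have h1 := log_sum_exp_le (gibbs_pos (ε := ε) (c := c) (y := y) hw hs x v)
    (sum_gibbs hw hs x v) (z := fun j => d j / ε) (B := B / ε) (fun j => by
      rw [abs_div, abs_of_pos hε]
      exact div_le_div_of_nonneg_right ((abs_apply_le_norm d j).trans hB) hε.le)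
  have h2 := h_add_sub (ε := ε) (c := c) (y := y) hw hs x v d
  have h3 : ∑ j, gibbs ε c y w x v j * d j = ε * ∑ j, gibbs ε c y w x v j * (d j / ε) := by
    rw [Finset.mul_sum]
    exact Finset.sum_congr rfl fun j _ => by field_simp
  have h5 : ε * (Real.exp (B / ε) * ∑ j, (d j / ε) ^ 2) = Real.exp (B / ε) / ε * ‖d‖ ^ 2 := by
    rw [EuclideanSpace.real_norm_sq_eq]
    simp_rw [div_pow, ← Finset.sum_div]
    field_simp
  have h4 := mul_le_mul_of_nonneg_left h1 hε.le
  simp_rw [sub_mul, Finset.sum_sub_distrib, h3, mul_comm (w _)]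
  linarith

lemma abs_gibbs_add_sub_le (hε : 0 < ε) (x : X) (v d : EuclideanSpace ℝ (Fin J)) (j : Fin J) :
    |gibbs ε c y w x (v + d) j - gibbs ε c y w x v j| ≤ 2 * (‖d‖ / ε) := by
  rw [gibbs_add hw hs]
  refine abs_tilt_sub_le (gibbs_pos (ε := ε) (c := c) (y := y) hw hs x v)
    (sum_gibbs hw hs x v) (z := fun j => d j / ε) (fun j => ?_) j
  rw [abs_div, abs_of_pos hε]
  exact div_le_div_of_nonneg_right (abs_apply_le_norm d j) hε.le

lemma gibbs_monotone (hε : 0 < ε) (x : X) (v d : EuclideanSpace ℝ (Fin J)) {a b : Fin J}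
    (ha : ∀ j, d j ≤ d a) :
    gibbs ε c y w x v a * gibbs ε c y w x v b * ((d a - d b) ^ 2 / (ε + (d a - d b))) / 2 ≤
      ∑ j, (gibbs ε c y w x (v + d) j - gibbs ε c y w x v j) * d j := by
  have h1 := tilt_monotone (gibbs_pos (ε := ε) (c := c) (y := y) hw hs x v)
    (sum_gibbs hw hs x v) (z := fun j => d j / ε) (a := a) (b := b)
    (fun j => div_le_div_of_nonneg_right (ha j) hε.le)
  simp_rw [← gibbs_add hw hs] at h1
  have h2 := mul_le_mul_of_nonneg_left h1 hε.le
  have h3 : ε * ∑ j, (gibbs ε c y w x (v + d) j - gibbs ε c y w x v j) * (d j / ε) =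
      ∑ j, (gibbs ε c y w x (v + d) j - gibbs ε c y w x v j) * d j := by
    rw [Finset.mul_sum]
    exact Finset.sum_congr rfl fun j _ => by field_simp
  rw [h3] at h2
  refine le_trans (le_of_eq ?_) h2
  have : 0 < ε + (d a - d b) := by linarith [ha b]
  have h4 : 1 + (d a / ε - d b / ε) = (ε + (d a - d b)) / ε := by field_simp
  rw [h4]
  field_simp

/-- The convexity and smoothness bounds sandwich the first-order remainder between zero and a
multiple of `‖d‖ ^ 2`, so nothing has to be differentiated. -/
lemma hasGradientAt_h (hε : 0 < ε) (x : X) (v : EuclideanSpace ℝ (Fin J)) :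
    HasGradientAt (fun u => h ε c y w x u)
      (WithLp.toLp 2 fun j => gibbs ε c y w x v j - w j) v := by
  rw [hasGradientAt_iff_isLittleO_nhds_zero]
  have hO : (fun d : EuclideanSpace ℝ (Fin J) => h ε c y w x (v + d) - h ε c y w x v -
      inner ℝ (WithLp.toLp 2 fun j => gibbs ε c y w x v j - w j) d)
      =O[nhds 0] fun d => ‖d‖ ^ 2 := by
    refine Asymptotics.IsBigO.of_bound (Real.exp (1 / ε) / ε) ?_
    filter_upwards [Metric.closedBall_mem_nhds (0 : EuclideanSpace ℝ (Fin J)) one_pos] with d hd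
    have hd1 : ‖d‖ ≤ 1 := by simpa using hd
    have h1 := h_add_ge (c := c) (y := y) hw hs hε x v d
    have h2 := h_add_le (c := c) (y := y) hw hs hε x v d hd1
    have h3 : inner ℝ (WithLp.toLp 2 fun j => gibbs ε c y w x v j - w j) d =
        ∑ j, (gibbs ε c y w x v j - w j) * d j := by
      simp [PiLp.inner_apply, mul_comm]
    rw [h3, Real.norm_eq_abs, abs_of_nonneg (by linarith), norm_pow, norm_norm]
    linarith
  refine hO.trans_isLittleO ?_
  simpa using Asymptotics.isLittleO_norm_pow_id (E' := EuclideanSpace ℝ (Fin J)) one_lt_two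

lemma gradh_eq (hε : 0 < ε) (x : X) (v : EuclideanSpace ℝ (Fin J)) :
    gradh ε c y w x v = WithLp.toLp 2 fun j => gibbs ε c y w x v j - w j :=
  (hasGradientAt_h hw hs hε x v).gradient

lemma gradh_apply (hε : 0 < ε) (x : X) (v : EuclideanSpace ℝ (Fin J)) (j : Fin J) :
    gradh ε c y w x v j = gibbs ε c y w x v j - w j := by
  rw [gradh_eq hw hs hε]

lemma weight_le_one (j : Fin J) : w j ≤ 1 :=
  hs ▸ Finset.single_le_sum (f := w) (fun i _ => (hw i).le) (Finset.mem_univ j)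

lemma abs_gradh_apply_le (hε : 0 < ε) (x : X) (v : EuclideanSpace ℝ (Fin J)) (j : Fin J) :
    |gradh ε c y w x v j| ≤ 1 := by
  rw [gradh_apply hw hs hε, abs_le]
  have h1 := gibbs_pos (ε := ε) (c := c) (y := y) hw hs x v j
  have h2 := gibbs_le_one (ε := ε) (c := c) (y := y) hw hs x v j
  have h3 := hw j
  have h4 := weight_le_one hw hs j
  constructor <;> linarith

lemma sum_gradh (hε : 0 < ε) (x : X) (v : EuclideanSpace ℝ (Fin J)) :
    ∑ j, gradh ε c y w x v j = 0 := by
  simp_rw [gradh_apply hw hs hε, Finset.sum_sub_distrib, sum_gibbs hw hs, hs, sub_self]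

lemma sum_gradh_sq_le (hε : 0 < ε) (x : X) (v : EuclideanSpace ℝ (Fin J)) :
    ∑ j, gradh ε c y w x v j ^ 2 ≤ 2 := by
  have h0 : ∀ j, gradh ε c y w x v j ^ 2 ≤ gibbs ε c y w x v j + w j := fun j => by
    rw [gradh_apply hw hs hε]
    nlinarith [gibbs_pos (ε := ε) (c := c) (y := y) hw hs x v j,
      gibbs_le_one (ε := ε) (c := c) (y := y) hw hs x v j, hw j, weight_le_one hw hs j]
  calc ∑ j, gradh ε c y w x v j ^ 2 ≤ ∑ j, (gibbs ε c y w x v j + w j) :=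
        Finset.sum_le_sum fun j _ => h0 j
    _ = 2 := by rw [Finset.sum_add_distrib, sum_gibbs hw hs, hs]; norm_num

lemma norm_gradh_le (hε : 0 < ε) (x : X) (v : EuclideanSpace ℝ (Fin J)) :
    ‖gradh ε c y w x v‖ ≤ 2 := by
  have h1 := sum_gradh_sq_le (c := c) (y := y) hw hs hε x v
  have h2 := EuclideanSpace.real_norm_sq_eq (gradh ε c y w x v)
  nlinarith [norm_nonneg (gradh ε c y w x v)]

end Pointwise

/-! ### The semi-dual objective -/

lemma mem_vJPerp {J : ℕ} [NeZero J] (v : EuclideanSpace ℝ (Fin J)) :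
    v ∈ vJPerp J ↔ ∑ j, v j = 0 := by
  rw [vJPerp, Submodule.mem_orthogonal_singleton_iff_inner_right, vJ]
  have : (0 : ℝ) < Real.sqrt J := Real.sqrt_pos.2 (by exact_mod_cast NeZero.pos J)
  simp only [PiLp.inner_apply, RCLike.inner_apply, conj_trivial]
  rw [← Finset.sum_mul]
  simp [this.ne']

/-- Standing assumptions on the cost, the weights and the regularization parameter. -/
structure IsSemiDual {X Y : Type*} [MeasurableSpace X] {J : ℕ} (ε : ℝ) (c : X → Y → ℝ)
    (μ : Measure X) (y : Fin J → Y) (w : Fin J → ℝ) : Prop where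
  eps_pos : 0 < ε
  weight_pos : ∀ j, 0 < w j
  weight_sum : ∑ j, w j = 1
  cost_nonneg : ∀ x j, 0 ≤ c x (y j)
  cost_meas : ∀ j, Measurable fun x => c x (y j)
  cost_int : ∀ j, Integrable (fun x => c x (y j)) μ

/-- The gradient of `H_ε`. -/
def gradH {X Y : Type*} [MeasurableSpace X] {J : ℕ} (ε : ℝ) (c : X → Y → ℝ) (μ : Measure X)
    (y : Fin J → Y) (w : Fin J → ℝ) (v : EuclideanSpace ℝ (Fin J)) :
    EuclideanSpace ℝ (Fin J) :=
  WithLp.toLp 2 fun j => ∫ x, gradh ε c y w x v j ∂μ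

namespace IsSemiDual

variable {X Y : Type*} [MeasurableSpace X] {J : ℕ} {ε : ℝ} {c : X → Y → ℝ} {μ : Measure X}
  {y : Fin J → Y} {w : Fin J → ℝ} (D : IsSemiDual ε c μ y w)

include D

lemma neZero : NeZero J := by
  obtain ⟨j⟩ := exists_index D.weight_sum
  exact ⟨fun h => (h ▸ j).elim0⟩

lemma measurable_exp_mul (j : Fin J) : Measurable fun q : X × EuclideanSpace ℝ (Fin J) =>
    Real.exp ((q.2 j - c q.1 (y j)) / ε) * w j := by
  have h1 : Measurable fun q : X × EuclideanSpace ℝ (Fin J) => c q.1 (y j) :=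
    (D.cost_meas j).comp measurable_fst
  have h2 : Measurable fun q : X × EuclideanSpace ℝ (Fin J) => q.2 j := by fun_prop
  exact (((h2.sub h1).div_const ε).exp).mul_const _

lemma measurable_gibbs (j : Fin J) :
    Measurable fun q : X × EuclideanSpace ℝ (Fin J) => gibbs ε c y w q.1 q.2 j := by
  exact (D.measurable_exp_mul j).div (Finset.measurable_sum _ fun j _ => D.measurable_exp_mul j)

lemma measurable_h : Measurable fun q : X × EuclideanSpace ℝ (Fin J) => h ε c y w q.1 q.2 := by
  have hlin : Measurable fun q : X × EuclideanSpace ℝ (Fin J) => ∑ j, q.2 j * w j := by fun_prop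
  exact (((Finset.measurable_sum _ fun j _ =>
    D.measurable_exp_mul j).log.const_mul ε).const_add ε).sub hlin

lemma measurable_gradh (j : Fin J) :
    Measurable fun q : X × EuclideanSpace ℝ (Fin J) => gradh ε c y w q.1 q.2 j := by
  simp_rw [gradh_apply D.weight_pos D.weight_sum D.eps_pos]
  exact (D.measurable_gibbs j).sub_const _

lemma abs_sum_gradh_mul_le (x : X) (v d : EuclideanSpace ℝ (Fin J)) :
    |∑ j, gradh ε c y w x v j * d j| ≤ 2 * ‖d‖ := by
  have h1 : ∑ j, gradh ε c y w x v j * d j = inner ℝ (gradh ε c y w x v) d := by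
    simp [PiLp.inner_apply, mul_comm]
  rw [h1]
  exact (abs_real_inner_le_norm _ _).trans (mul_le_mul_of_nonneg_right
    (norm_gradh_le D.weight_pos D.weight_sum D.eps_pos x v) (norm_nonneg d))

lemma h_add_ge' (x : X) (v d : EuclideanSpace ℝ (Fin J)) :
    h ε c y w x v + ∑ j, gradh ε c y w x v j * d j ≤ h ε c y w x (v + d) := by
  simp_rw [gradh_apply D.weight_pos D.weight_sum D.eps_pos]
  exact h_add_ge D.weight_pos D.weight_sum D.eps_pos x v d

lemma h_add_le' (x : X) (v d : EuclideanSpace ℝ (Fin J)) {B : ℝ} (hB : ‖d‖ ≤ B) :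
    h ε c y w x (v + d) ≤ h ε c y w x v + ∑ j, gradh ε c y w x v j * d j
      + Real.exp (B / ε) / ε * ‖d‖ ^ 2 := by
  simp_rw [gradh_apply D.weight_pos D.weight_sum D.eps_pos]
  exact h_add_le D.weight_pos D.weight_sum D.eps_pos x v d hB

lemma abs_h_sub_le (x : X) (v v' : EuclideanSpace ℝ (Fin J)) :
    |h ε c y w x v - h ε c y w x v'| ≤ 2 * ‖v - v'‖ := by
  have h1 := D.h_add_ge' x v (v' - v)
  have h2 := D.h_add_ge' x v' (v - v')
  have h3 := (abs_le.1 (D.abs_sum_gradh_mul_le x v (v' - v))).1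
  have h4 := (abs_le.1 (D.abs_sum_gradh_mul_le x v' (v - v'))).1
  rw [add_sub_cancel] at h1 h2
  rw [norm_sub_rev v' v] at h3
  rw [abs_le]
  constructor <;> linarith

/-- At `v = 0` the logarithm is nonpositive since the cost is nonnegative, and Jensen bounds it
below by the mean cost; the Lipschitz bound does the rest. -/
lemma abs_h_le (x : X) (v : EuclideanSpace ℝ (Fin J)) :
    |h ε c y w x v| ≤ ε + ∑ j, w j * c x (y j) + 2 * ‖v‖ := by
  have hε := D.eps_pos
  have h1 := D.abs_h_sub_le x v 0
  have h2 := sum_mul_le_log_sum_exp D.weight_pos D.weight_sum (fun j => (0 - c x (y j)) / ε)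
  have h3 : Real.log (∑ j, w j * Real.exp ((0 - c x (y j)) / ε)) ≤ 0 := by
    refine Real.log_nonpos (sum_mul_exp_pos D.weight_pos D.weight_sum _).le ?_
    calc ∑ j, w j * Real.exp ((0 - c x (y j)) / ε) ≤ ∑ j, w j * 1 :=
          Finset.sum_le_sum fun j _ => mul_le_mul_of_nonneg_left (Real.exp_le_one_iff.2
            (div_nonpos_of_nonpos_of_nonneg (by linarith [D.cost_nonneg x j]) hε.le))
            (D.weight_pos j).le
      _ = 1 := by simp [D.weight_sum]
  have h0 : h ε c y w x 0 =
      ε + ε * Real.log (∑ j, w j * Real.exp ((0 - c x (y j)) / ε)) := by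
    simp [h, mul_comm]
  have h4 : ∑ j, w j * c x (y j) = -(ε * ∑ j, w j * ((0 - c x (y j)) / ε)) := by
    rw [Finset.mul_sum, ← Finset.sum_neg_distrib]
    exact Finset.sum_congr rfl fun j _ => by field_simp; ring
  have h5 := mul_le_mul_of_nonneg_left h2 hε.le
  have h6 := mul_nonpos_of_nonneg_of_nonpos hε.le h3
  rw [sub_zero] at h1
  rw [abs_le] at h1 ⊢
  constructor <;> linarith

variable [IsProbabilityMeasure μ]

lemma integrable_h (v : EuclideanSpace ℝ (Fin J)) : Integrable (fun x => h ε c y w x v) μ := by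
  refine Integrable.mono' (g := fun x => ε + ∑ j, w j * c x (y j) + 2 * ‖v‖) ?_
    (D.measurable_h.comp (by fun_prop : Measurable fun x => (x, v))).aestronglyMeasurable
    (Filter.Eventually.of_forall fun x => D.abs_h_le x v)
  exact ((integrable_const _).add (integrable_finsetSum _ fun j _ =>
    (D.cost_int j).const_mul _)).add (integrable_const _)

lemma integrable_gradh (v : EuclideanSpace ℝ (Fin J)) (j : Fin J) :
    Integrable (fun x => gradh ε c y w x v j) μ :=
  Integrable.of_bound
    ((D.measurable_gradh j).comp (by fun_prop : Measurable fun x => (x, v))).aestronglyMeasurable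
    1 (Filter.Eventually.of_forall fun x =>
      abs_gradh_apply_le D.weight_pos D.weight_sum D.eps_pos x v j)

lemma integral_sum_gradh_mul (v d : EuclideanSpace ℝ (Fin J)) :
    ∫ x, ∑ j, gradh ε c y w x v j * d j ∂μ = ∑ j, gradH ε c μ y w v j * d j := by
  rw [integral_finsetSum _ fun j _ => (D.integrable_gradh v j).mul_const _]
  simp_rw [integral_mul_const]
  rfl

lemma integrable_sum_gradh_mul (v d : EuclideanSpace ℝ (Fin J)) :
    Integrable (fun x => ∑ j, gradh ε c y w x v j * d j) μ :=
  integrable_finsetSum _ fun j _ => (D.integrable_gradh v j).mul_const _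

lemma H_add_ge (v d : EuclideanSpace ℝ (Fin J)) :
    H ε c μ y w v + ∑ j, gradH ε c μ y w v j * d j ≤ H ε c μ y w (v + d) := by
  rw [← D.integral_sum_gradh_mul, H, H,
    ← integral_add (D.integrable_h v) (D.integrable_sum_gradh_mul v d)]
  exact integral_mono ((D.integrable_h v).add (D.integrable_sum_gradh_mul v d))
    (D.integrable_h _) fun x => D.h_add_ge' x v d

lemma H_add_le (v d : EuclideanSpace ℝ (Fin J)) {B : ℝ} (hB : ‖d‖ ≤ B) :
    H ε c μ y w (v + d) ≤ H ε c μ y w v + ∑ j, gradH ε c μ y w v j * d j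
      + Real.exp (B / ε) / ε * ‖d‖ ^ 2 := by
  have h1 : ∫ x, (h ε c y w x v + ∑ j, gradh ε c y w x v j * d j
      + Real.exp (B / ε) / ε * ‖d‖ ^ 2) ∂μ = H ε c μ y w v + ∑ j, gradH ε c μ y w v j * d j
      + Real.exp (B / ε) / ε * ‖d‖ ^ 2 := by
    have h2 : Integrable (fun x => h ε c y w x v + ∑ j, gradh ε c y w x v j * d j) μ :=
      (D.integrable_h v).add (D.integrable_sum_gradh_mul v d)
    rw [integral_add h2 (integrable_const _),
      integral_add (D.integrable_h v) (D.integrable_sum_gradh_mul v d),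
      D.integral_sum_gradh_mul, H]
    simp
  rw [← h1, H]
  exact integral_mono (D.integrable_h _)
    (((D.integrable_h v).add (D.integrable_sum_gradh_mul v d)).add (integrable_const _))
    fun x => D.h_add_le' x v d hB

lemma abs_H_sub_le (v v' : EuclideanSpace ℝ (Fin J)) :
    |H ε c μ y w v - H ε c μ y w v'| ≤ 2 * ‖v - v'‖ := by
  rw [H, H, ← integral_sub (D.integrable_h v) (D.integrable_h v')]
  refine (abs_integral_le_integral_abs).trans ?_
  calc ∫ x, |h ε c y w x v - h ε c y w x v'| ∂μ ≤ ∫ _, 2 * ‖v - v'‖ ∂μ :=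
        integral_mono ((D.integrable_h v).sub (D.integrable_h v')).abs (integrable_const _)
          fun x => D.abs_h_sub_le x v v'
    _ = 2 * ‖v - v'‖ := by simp

lemma continuous_H : Continuous (H ε c μ y w) := by
  refine (LipschitzWith.of_dist_le_mul (K := 2) fun v v' => ?_).continuous
  simpa [Real.dist_eq, dist_eq_norm] using D.abs_H_sub_le v v'

lemma sum_gradH (v : EuclideanSpace ℝ (Fin J)) : ∑ j, gradH ε c μ y w v j = 0 := by
  have h1 := D.integral_sum_gradh_mul v (WithLp.toLp 2 fun _ => 1)
  simpa [sum_gradh D.weight_pos D.weight_sum D.eps_pos] using h1.symm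

omit D [IsProbabilityMeasure μ] in
lemma sum_gradH_mul_eq_inner (v d : EuclideanSpace ℝ (Fin J)) :
    ∑ j, gradH ε c μ y w v j * d j = inner ℝ (gradH ε c μ y w v) d := by
  simp [PiLp.inner_apply, mul_comm]

lemma norm_gradH_le (v : EuclideanSpace ℝ (Fin J)) : ‖gradH ε c μ y w v‖ ≤ 2 := by
  have h1 : ‖gradH ε c μ y w v‖ ^ 2 ≤ 2 * ‖gradH ε c μ y w v‖ := by
    rw [← real_inner_self_eq_norm_sq, ← sum_gradH_mul_eq_inner, ← D.integral_sum_gradh_mul]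
    calc _ ≤ ∫ _, 2 * ‖gradH ε c μ y w v‖ ∂μ :=
          integral_mono (D.integrable_sum_gradh_mul _ _) (integrable_const _)
            fun x => (le_abs_self _).trans (D.abs_sum_gradh_mul_le x v _)
      _ = _ := by simp
  by_contra! hlt
  nlinarith

/-- A step `-s • g` from the minimizer would decrease `H` by `s * ‖g‖ ^ 2` up to a term of order `s
^ 2 * ‖g‖ ^ 2`. -/
lemma gradH_eq_zero {vs : EuclideanSpace ℝ (Fin J)}
    (hmin : ∀ v, H ε c μ y w vs ≤ H ε c μ y w v) : gradH ε c μ y w vs = 0 := by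
  set g := gradH ε c μ y w vs with hg
  set K := Real.exp (2 / ε) / ε with hK
  have hK0 : 0 < K := div_pos (Real.exp_pos _) D.eps_pos
  have key : ∀ s : ℝ, 0 < s → s ≤ 1 → ‖g‖ ^ 2 ≤ s * (K * ‖g‖ ^ 2) := by
    intro s hs0 hs1
    have hn : ‖-(s • g)‖ = s * ‖g‖ := by rw [norm_neg, norm_smul, Real.norm_of_nonneg hs0.le]
    have h1 := D.H_add_le vs (-(s • g)) (B := 2) (by
      rw [hn]; nlinarith [D.norm_gradH_le vs, norm_nonneg g])
    rw [sum_gradH_mul_eq_inner, ← hg, inner_neg_right, inner_smul_right,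
      real_inner_self_eq_norm_sq, hn] at h1
    have h2 := hmin (vs + -(s • g))
    have h3 : s * ‖g‖ ^ 2 ≤ s * (s * (K * ‖g‖ ^ 2)) := by nlinarith
    exact le_of_mul_le_mul_left h3 hs0
  have h1 : ‖g‖ ^ 2 ≤ 0 := by
    -- This step size is at most one and makes `s * K ≤ 1 / 2`.
    have h2 := key (1 / (2 + 2 * K)) (by positivity) (by
      rw [div_le_one (by positivity)]; linarith)
    have h3 : 1 / (2 + 2 * K) * K ≤ 1 / 2 := by
      rw [div_mul_eq_mul_div, div_le_div_iff₀ (by positivity) (by norm_num)]; linarith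
    nlinarith [sq_nonneg ‖g‖]
  have : ‖g‖ = 0 := by nlinarith [norm_nonneg g]
  exact norm_eq_zero.1 this

/-- The cost may be unbounded in `x`, so the Gibbs weights need not be bounded below pointwise. They
are everywhere positive, which makes their integrated products positive, and there are finitely many
pairs. -/
lemma exists_gibbs_mul_lower (v : EuclideanSpace ℝ (Fin J)) :
    ∃ κ > 0, ∀ a b, κ ≤ ∫ x, gibbs ε c y w x v a * gibbs ε c y w x v b ∂μ := by
  have := exists_index D.weight_sum
  have hpos : ∀ q : Fin J × Fin J,
      0 < ∫ x, gibbs ε c y w x v q.1 * gibbs ε c y w x v q.2 ∂μ := by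
    intro q
    have hm : Measurable fun x => gibbs ε c y w x v q.1 * gibbs ε c y w x v q.2 :=
      ((D.measurable_gibbs q.1).comp (by fun_prop : Measurable fun x => (x, v))).mul
        ((D.measurable_gibbs q.2).comp (by fun_prop : Measurable fun x => (x, v)))
    have hp : ∀ x, 0 < gibbs ε c y w x v q.1 * gibbs ε c y w x v q.2 := fun x =>
      mul_pos (gibbs_pos D.weight_pos D.weight_sum x v _)
        (gibbs_pos D.weight_pos D.weight_sum x v _)
    rw [integral_pos_iff_support_of_nonneg (fun x => (hp x).le)]
    · have : Function.support (fun x => gibbs ε c y w x v q.1 * gibbs ε c y w x v q.2)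
          = Set.univ := Set.eq_univ_of_forall fun x => (hp x).ne'
      rw [this]; simp
    · refine Integrable.of_bound hm.aestronglyMeasurable 1 (Filter.Eventually.of_forall fun x => ?_)
      rw [Real.norm_of_nonneg (hp x).le]
      exact mul_le_one₀ (gibbs_le_one D.weight_pos D.weight_sum x v _)
        (gibbs_pos D.weight_pos D.weight_sum x v _).le
        (gibbs_le_one D.weight_pos D.weight_sum x v _)
  obtain ⟨q, hq⟩ := Finite.exists_min
    (fun q : Fin J × Fin J => ∫ x, gibbs ε c y w x v q.1 * gibbs ε c y w x v q.2 ∂μ)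
  exact ⟨_, hpos q, fun a b => hq (a, b)⟩

/-- Apply the monotonicity of the Gibbs weights to the largest and smallest coordinates of `u`.
Since `u` has zero sum these have opposite signs, so their gap `r` is comparable to `‖u‖`. -/
lemma exists_gradH_growth {vs : EuclideanSpace ℝ (Fin J)}
    (hmin : ∀ v, H ε c μ y w vs ≤ H ε c μ y w v) :
    ∃ κ > 0, ∀ u : EuclideanSpace ℝ (Fin J), ∑ j, u j = 0 →
      κ * (‖u‖ ^ 2 / (1 + ‖u‖)) ≤ ∑ j, gradH ε c μ y w (vs + u) j * u j := by
  obtain ⟨κ, hκ, hle⟩ := D.exists_gibbs_mul_lower vs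
  have hJ0 := D.neZero
  have hJ : (0 : ℝ) < J := by exact_mod_cast NeZero.pos J
  have hε := D.eps_pos
  have := exists_index D.weight_sum
  -- The `2` is the half in `gibbs_monotone`, `J` comes from `‖u‖ ^ 2 ≤ J * r ^ 2`, and `ε + 2` from
  -- `ε + r ≤ (1 + ‖u‖) * (ε + 2)`.
  refine ⟨κ / (2 * J * (ε + 2)), by positivity, fun u hu => ?_⟩
  obtain ⟨a, ha⟩ := Finite.exists_max (fun j => u j)
  obtain ⟨b, hb⟩ := Finite.exists_min (fun j => u j)
  have hua : 0 ≤ u a := by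
    by_contra! hlt
    have : ∑ j, u j < ∑ _j : Fin J, (0 : ℝ) :=
      Finset.sum_lt_sum_of_nonempty Finset.univ_nonempty fun j _ => (ha j).trans_lt hlt
    simp [hu] at this
  have hub : u b ≤ 0 := by
    by_contra! hlt
    have : ∑ _j : Fin J, (0 : ℝ) < ∑ j, u j :=
      Finset.sum_lt_sum_of_nonempty Finset.univ_nonempty fun j _ => hlt.trans_le (hb j)
    simp [hu] at this
  set r := u a - u b with hr
  have hr0 : 0 ≤ r := by linarith
  have hur : ‖u‖ ^ 2 ≤ J * r ^ 2 := by
    rw [EuclideanSpace.real_norm_sq_eq]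
    calc ∑ j, u j ^ 2 ≤ ∑ _j : Fin J, r ^ 2 := Finset.sum_le_sum fun j _ =>
          sq_le_sq' (by linarith [hb j]) (by linarith [ha j])
      _ = J * r ^ 2 := by simp
  have hru : r ≤ 2 * ‖u‖ := by
    have h1 := (abs_le.1 (abs_apply_le_norm u a)).2
    have h2 := (abs_le.1 (abs_apply_le_norm u b)).1
    linarith
  have hscal : ‖u‖ ^ 2 / (1 + ‖u‖) / (J * (ε + 2)) ≤ r ^ 2 / (ε + r) := by
    rw [div_div, div_le_div_iff₀ (by positivity) (by nlinarith [norm_nonneg u])]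
    have h1 : ε + r ≤ (1 + ‖u‖) * (ε + 2) := by nlinarith [norm_nonneg u]
    calc ‖u‖ ^ 2 * (ε + r) ≤ (J * r ^ 2) * ((1 + ‖u‖) * (ε + 2)) :=
          mul_le_mul hur h1 (by linarith) (by positivity)
      _ = _ := by ring
  have hint : ∫ x, gibbs ε c y w x vs a * gibbs ε c y w x vs b * (r ^ 2 / (ε + r)) / 2 ∂μ ≤
      ∫ x, (∑ j, gradh ε c y w x (vs + u) j * u j - ∑ j, gradh ε c y w x vs j * u j) ∂μ := by
    refine integral_mono_of_nonneg (Filter.Eventually.of_forall fun x => ?_)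
      ((D.integrable_sum_gradh_mul _ _).sub (D.integrable_sum_gradh_mul _ _))
      (Filter.Eventually.of_forall fun x => ?_)
    · have h1 := gibbs_pos (ε := ε) (c := c) (y := y) D.weight_pos D.weight_sum x vs a
      have h2 := gibbs_pos (ε := ε) (c := c) (y := y) D.weight_pos D.weight_sum x vs b
      have : 0 < ε + r := by linarith
      simp only [Pi.zero_apply]
      positivity
    · refine (gibbs_monotone D.weight_pos D.weight_sum hε x vs u ha).trans (le_of_eq ?_)
      simp only
      rw [← Finset.sum_sub_distrib]
      refine Finset.sum_congr rfl fun j _ => ?_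
      rw [gradh_apply D.weight_pos D.weight_sum hε, gradh_apply D.weight_pos D.weight_sum hε]
      ring
  rw [integral_sub (D.integrable_sum_gradh_mul _ _) (D.integrable_sum_gradh_mul _ _),
    D.integral_sum_gradh_mul, D.integral_sum_gradh_mul, D.gradH_eq_zero hmin,
    integral_div, integral_mul_const] at hint
  simp only [PiLp.zero_apply, zero_mul, Finset.sum_const_zero, sub_zero] at hint
  refine le_trans ?_ hint
  have h1 := mul_le_mul (hle a b) hscal (by positivity) (hκ.le.trans (hle a b))
  refine le_trans (le_of_eq ?_) (div_le_div_of_nonneg_right h1 (by norm_num : (0 : ℝ) ≤ 2))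
  field_simp

/-- Consequences of the growth of the gradient around the minimizer `vs`: the excess
`H - H vs` grows quadratically then linearly, and satisfies a Łojasiewicz inequality. -/
lemma exists_lojasiewicz {vs : EuclideanSpace ℝ (Fin J)}
    (hmin : ∀ v, H ε c μ y w vs ≤ H ε c μ y w v) :
    ∃ κ > 0, ∀ u : EuclideanSpace ℝ (Fin J), ∑ j, u j = 0 →
      κ * (‖u‖ ^ 2 / (1 + ‖u‖)) ≤ H ε c μ y w (vs + u) - H ε c μ y w vs ∧
      κ * min (H ε c μ y w (vs + u) - H ε c μ y w vs) 1 ≤ ‖gradH ε c μ y w (vs + u)‖ ^ 2 := by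
  obtain ⟨κ, hκ, hle⟩ := D.exists_gradH_growth hmin
  -- The three constants serve the growth of the excess, the gradient inequality for `‖u‖ ≤ 1`, and
  -- the one for `‖u‖ ≥ 1`.
  refine ⟨min (κ / 4) (min (κ / 2) ((κ / 2) ^ 2)), by positivity, fun u hu => ⟨?_, ?_⟩⟩
  · have hu2 : ∑ j, ((2 : ℝ)⁻¹ • u) j = 0 := by
      simp only [PiLp.smul_apply, smul_eq_mul, ← Finset.mul_sum, hu, mul_zero]
    have h1 := hle _ hu2
    -- Instead of integrating the gradient along the segment, convexity is used at its midpoint,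
    -- where `H` is already at least `H vs`.
    have h2 := D.H_add_ge (vs + (2 : ℝ)⁻¹ • u) ((2 : ℝ)⁻¹ • u)
    have h3 : vs + (2 : ℝ)⁻¹ • u + (2 : ℝ)⁻¹ • u = vs + u := by
      rw [add_assoc, ← add_smul]; norm_num
    rw [h3] at h2
    have h4 := hmin (vs + (2 : ℝ)⁻¹ • u)
    have hn : ‖(2 : ℝ)⁻¹ • u‖ = ‖u‖ / 2 := by rw [norm_smul]; norm_num; ring
    rw [hn] at h1
    have hu0 := norm_nonneg u
    have h5 : κ / 4 * (‖u‖ ^ 2 / (1 + ‖u‖)) ≤ κ * ((‖u‖ / 2) ^ 2 / (1 + ‖u‖ / 2)) := by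
      have : (‖u‖ / 2) ^ 2 / (1 + ‖u‖) ≤ (‖u‖ / 2) ^ 2 / (1 + ‖u‖ / 2) :=
        div_le_div_of_nonneg_left (by positivity) (by positivity) (by linarith)
      refine le_trans (le_of_eq ?_) (mul_le_mul_of_nonneg_left this hκ.le)
      ring
    have h6 := mul_le_mul_of_nonneg_right (min_le_left (κ / 4) (min (κ / 2) ((κ / 2) ^ 2)))
      (by positivity : 0 ≤ ‖u‖ ^ 2 / (1 + ‖u‖))
    linarith
  · have h1 := hle u hu
    set s := H ε c μ y w (vs + u) - H ε c μ y w vs with hs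
    have hs0 : 0 ≤ s := sub_nonneg.2 (hmin _)
    set g := gradH ε c μ y w (vs + u) with hg
    have h2 : s ≤ ∑ j, g j * u j := by
      have := D.H_add_ge (vs + u) (-u)
      rw [add_neg_cancel_right] at this
      simp only [PiLp.neg_apply, mul_neg, Finset.sum_neg_distrib] at this
      linarith
    have h3 : ∑ j, g j * u j ≤ ‖g‖ * ‖u‖ := by
      rw [hg, sum_gradH_mul_eq_inner]
      exact real_inner_le_norm _ _
    have hg0 := norm_nonneg g
    rcases (norm_nonneg u).eq_or_lt with hu0 | hu0
    · have hs1 : s = 0 := by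
        rw [← hu0, mul_zero] at h3
        linarith
      rw [hs1]
      simp
    have h4 : κ * (‖u‖ / (1 + ‖u‖)) ≤ ‖g‖ := by
      have : κ * (‖u‖ / (1 + ‖u‖)) * ‖u‖ ≤ ‖g‖ * ‖u‖ := by
        refine le_trans (le_of_eq ?_) (h1.trans h3)
        ring
      exact le_of_mul_le_mul_right this hu0
    have hmin0 : 0 ≤ min s 1 := le_min hs0 zero_le_one
    -- Near the minimizer `s ≤ ‖g‖ * ‖u‖` combines with `‖u‖ ≤ (2 / κ) * ‖g‖`; far away the gradient
    -- is bounded below.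
    rcases le_total ‖u‖ 1 with hu1 | hu1
    · have h5 : κ / 2 * ‖u‖ ≤ ‖g‖ := by
        refine le_trans ?_ h4
        have : ‖u‖ / 2 ≤ ‖u‖ / (1 + ‖u‖) :=
          div_le_div_of_nonneg_left hu0.le (by positivity) (by linarith)
        nlinarith
      have h6 : κ / 2 * s ≤ ‖g‖ ^ 2 := by nlinarith
      calc _ ≤ κ / 2 * s := mul_le_mul ((min_le_right _ _).trans (min_le_left _ _))
            (min_le_left _ _) hmin0 (by positivity)
        _ ≤ _ := h6
    · have h5 : κ / 2 ≤ ‖g‖ := by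
        refine le_trans ?_ h4
        have : 1 / 2 ≤ ‖u‖ / (1 + ‖u‖) := by
          rw [div_le_div_iff₀ (by norm_num) (by positivity)]; linarith
        nlinarith
      calc _ ≤ (κ / 2) ^ 2 * 1 := mul_le_mul ((min_le_right _ _).trans (min_le_right _ _))
            (min_le_right _ _) hmin0 (by positivity)
        _ ≤ _ := by rw [mul_one]; exact pow_le_pow_left₀ (by positivity) h5 2

end IsSemiDual

/-! ### Duality -/

section Atomic

variable {X Y : Type*} {J : ℕ} {ε : ℝ} {c : X → Y → ℝ} {y : Fin J → Y} {w : Fin J → ℝ}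

/-- The function on `Y` with value `a j` at `y j` and zero elsewhere. -/
def atomic (y : Fin J → Y) (a : Fin J → ℝ) (z : Y) : ℝ :=
  ∑ j, Set.indicator {y j} (fun _ => a j) z

lemma atomic_apply (hy : Function.Injective y) (a : Fin J → ℝ) (k : Fin J) :
    atomic y a (y k) = a k := by
  rw [atomic, Finset.sum_eq_single k]
  · simp
  · intro j _ hj
    simp [hy.ne hj.symm]
  · simp

lemma atomic_of_notMem (a : Fin J → ℝ) {z : Y} (hz : z ∉ Set.range y) : atomic y a z = 0 :=
  Finset.sum_eq_zero fun j _ => Set.indicator_of_notMem (fun h => hz ⟨j, h.symm⟩) _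

lemma abs_atomic_le (a : Fin J → ℝ) (z : Y) : |atomic y a z| ≤ ∑ j, |a j| := by
  refine (Finset.abs_sum_le_sum_abs _ _).trans (Finset.sum_le_sum fun j _ => ?_)
  by_cases h : z ∈ ({y j} : Set Y)
  · rw [Set.indicator_of_mem h]
  · rw [Set.indicator_of_notMem h, abs_zero]; exact abs_nonneg _

/-- The log-density, with respect to the product measure, of the coupling associated with the
dual variable `v`. -/
def logDensity (ε : ℝ) (c : X → Y → ℝ) (y : Fin J → Y) (w : Fin J → ℝ)
    (v : EuclideanSpace ℝ (Fin J)) (q : X × Y) : ℝ :=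
  atomic y (fun j => (v j - c q.1 (y j)) / ε - Real.log (part ε c y w q.1 v)) q.2

lemma weight_mul_exp_logDensity (hw : ∀ j, 0 < w j) (hs : ∑ j, w j = 1)
    (hy : Function.Injective y) (v : EuclideanSpace ℝ (Fin J)) (x : X) (j : Fin J) :
    w j * Real.exp (logDensity ε c y w v (x, y j)) = gibbs ε c y w x v j := by
  rw [logDensity, atomic_apply hy, Real.exp_sub, Real.exp_log (part_pos hw hs x v), gibbs]
  ring

end Atomic

/-! ### Integration against a discrete measure. -/

section DiscreteMeasure

variable {Y : Type*} [MeasurableSpace Y] [MeasurableSingletonClass Y] {J : ℕ} {y : Fin J → Y}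
  {w : Fin J → ℝ}

lemma lintegral_discreteMeasure (f : Y → ENNReal) :
    ∫⁻ z, f z ∂(discreteMeasure y w) = ∑ j, ENNReal.ofReal (w j) * f (y j) := by
  simp [discreteMeasure, lintegral_smul_measure]

lemma integral_discreteMeasure (hw : ∀ j, 0 < w j) (f : Y → ℝ) :
    ∫ z, f z ∂(discreteMeasure y w) = ∑ j, w j * f (y j) := by
  rw [discreteMeasure, integral_finsetSum_measure]
  · refine Finset.sum_congr rfl fun j _ => ?_
    rw [integral_smul_measure, integral_dirac, ENNReal.toReal_ofReal (hw j).le, smul_eq_mul]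
  · exact fun j _ => (integrable_dirac (by simp)).smul_measure ENNReal.ofReal_ne_top

lemma isProbabilityMeasure_discreteMeasure (hw : ∀ j, 0 < w j) (hs : ∑ j, w j = 1) :
    IsProbabilityMeasure (discreteMeasure y w) := by
  refine ⟨?_⟩
  rw [← lintegral_one, lintegral_discreteMeasure]
  simp_rw [mul_one]
  rw [← ENNReal.ofReal_sum_of_nonneg fun j _ => (hw j).le, hs, ENNReal.ofReal_one]

lemma ae_mem_range_discreteMeasure : ∀ᵐ z ∂(discreteMeasure y w), z ∈ Set.range y := by
  rw [ae_iff]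
  have hm : MeasurableSet {a | a ∉ Set.range y} := (Set.finite_range y).measurableSet.compl
  rw [← lintegral_indicator_one hm, lintegral_discreteMeasure]
  simp

lemma measurable_atomic {X : Type*} [MeasurableSpace X] {a : X → Fin J → ℝ}
    (ha : ∀ j, Measurable fun x => a x j) :
    Measurable fun q : X × Y => atomic y (a q.1) q.2 := by
  refine Finset.measurable_sum _ fun j _ => ?_
  have : (fun q : X × Y => Set.indicator {y j} (fun _ => a q.1 j) q.2) =
      Set.indicator (Prod.snd ⁻¹' {y j}) fun q => a q.1 j := by
    ext q
    by_cases h : q.2 = y j <;> simp [Set.indicator, h]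
  rw [this]
  exact ((ha j).comp measurable_fst).indicator (measurable_snd (measurableSet_singleton _))

end DiscreteMeasure

/-! ### The Gibbs coupling and strong duality. -/

namespace IsSemiDual

variable {X Y : Type*} [MeasurableSpace X] [MeasurableSpace Y] [MeasurableSingletonClass Y]
  {J : ℕ} {ε : ℝ} {c : X → Y → ℝ} {μ : Measure X} [IsProbabilityMeasure μ]
  {y : Fin J → Y} {w : Fin J → ℝ} (D : IsSemiDual ε c μ y w)

include D

omit [MeasurableSpace Y] [MeasurableSingletonClass Y] [IsProbabilityMeasure μ] in
lemma measurable_log_part (v : EuclideanSpace ℝ (Fin J)) :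
    Measurable fun x => Real.log (part ε c y w x v) :=
  (Finset.measurable_sum _ fun j _ => (D.measurable_exp_mul j).comp
    (by fun_prop : Measurable fun x => (x, v))).log

omit [IsProbabilityMeasure μ] in
lemma measurable_logDensity (v : EuclideanSpace ℝ (Fin J)) :
    Measurable (logDensity ε c y w v) :=
  measurable_atomic fun j =>
    (((D.cost_meas j).const_sub _).div_const _).sub (D.measurable_log_part v)

lemma integrable_exp_logDensity (hy : Function.Injective y) (v : EuclideanSpace ℝ (Fin J)) :
    Integrable (fun q => Real.exp (logDensity ε c y w v q)) (μ.prod (discreteMeasure y w)) := by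
  have := isProbabilityMeasure_discreteMeasure (y := y) D.weight_pos D.weight_sum
  -- On an atom the density is a Gibbs weight divided by `w k`, at most `(w k)⁻¹`; off the atoms the
  -- log-density is zero, whence the summand `1`.
  refine Integrable.of_bound (D.measurable_logDensity v).exp.aestronglyMeasurable
    (1 + ∑ j, (w j)⁻¹) (Filter.Eventually.of_forall fun q => ?_)
  have hsum : 0 ≤ ∑ j, (w j)⁻¹ := Finset.sum_nonneg fun j _ => (inv_pos.2 (D.weight_pos j)).le
  rw [Real.norm_of_nonneg (Real.exp_pos _).le]
  by_cases h : q.2 ∈ Set.range y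
  · obtain ⟨k, hk⟩ := h
    have h1 := weight_mul_exp_logDensity (ε := ε) (c := c) D.weight_pos D.weight_sum hy v q.1 k
    rw [hk] at h1
    have h2 := gibbs_le_one (ε := ε) (c := c) (y := y) D.weight_pos D.weight_sum q.1 v k
    have h3 : Real.exp (logDensity ε c y w v q) ≤ (w k)⁻¹ := by
      rw [← one_div, le_div_iff₀ (D.weight_pos k), mul_comm]
      exact h1.trans_le h2
    have h4 := Finset.single_le_sum (f := fun j => (w j)⁻¹)
      (fun j _ => (inv_pos.2 (D.weight_pos j)).le) (Finset.mem_univ k)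
    linarith
  · rw [logDensity, atomic_of_notMem _ h, Real.exp_zero]
    linarith

lemma integral_exp_logDensity (hy : Function.Injective y) (v : EuclideanSpace ℝ (Fin J)) :
    ∫ q, Real.exp (logDensity ε c y w v q) ∂(μ.prod (discreteMeasure y w)) = 1 := by
  have := isProbabilityMeasure_discreteMeasure (y := y) D.weight_pos D.weight_sum
  rw [integral_prod _ (D.integrable_exp_logDensity hy v)]
  simp_rw [integral_discreteMeasure D.weight_pos,
    weight_mul_exp_logDensity D.weight_pos D.weight_sum hy, sum_gibbs D.weight_pos D.weight_sum]
  simp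

lemma tilted_logDensity_apply (hy : Function.Injective y) (v : EuclideanSpace ℝ (Fin J))
    {E : Set (X × Y)} (hE : MeasurableSet E) :
    (μ.prod (discreteMeasure y w)).tilted (logDensity ε c y w v) E =
      ∫⁻ x, ∑ j, ENNReal.ofReal (gibbs ε c y w x v j) * E.indicator 1 (x, y j) ∂μ := by
  have := isProbabilityMeasure_discreteMeasure (y := y) D.weight_pos D.weight_sum
  have hm : Measurable fun q => ENNReal.ofReal (Real.exp (logDensity ε c y w v q)) :=
    (D.measurable_logDensity v).exp.ennreal_ofReal
  rw [tilted_apply' _ _ hE, D.integral_exp_logDensity hy]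
  simp_rw [div_one]
  rw [← lintegral_indicator hE, lintegral_prod _ (hm.indicator hE).aemeasurable]
  refine lintegral_congr fun x => ?_
  rw [lintegral_discreteMeasure]
  refine Finset.sum_congr rfl fun j _ => ?_
  rw [← weight_mul_exp_logDensity D.weight_pos D.weight_sum hy,
    ENNReal.ofReal_mul (D.weight_pos j).le]
  by_cases h : (x, y j) ∈ E <;> simp [h]

omit [MeasurableSpace Y] [MeasurableSingletonClass Y] in
lemma integral_gibbs {vs : EuclideanSpace ℝ (Fin J)}
    (hmin : ∀ v, H ε c μ y w vs ≤ H ε c μ y w v) (j : Fin J) :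
    ∫ x, gibbs ε c y w x vs j ∂μ = w j := by
  have h1 : gradH ε c μ y w vs j = 0 := by rw [D.gradH_eq_zero hmin]; rfl
  have h2 : gradH ε c μ y w vs j = ∫ x, gradh ε c y w x vs j ∂μ := rfl
  have h3 := D.integrable_gradh vs j
  have h4 : ∫ x, gibbs ε c y w x vs j ∂μ = ∫ x, (gradh ε c y w x vs j + w j) ∂μ := by
    simp_rw [gradh_apply D.weight_pos D.weight_sum D.eps_pos, sub_add_cancel]
  rw [h4, integral_add h3 (integrable_const _), ← h2, h1]
  simp

/-- The first marginal is right for every dual variable because the Gibbs weights sum to one. The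
second is the first-order condition at the minimizer. -/
lemma tilted_mem_couplings (hy : Function.Injective y) {vs : EuclideanSpace ℝ (Fin J)}
    (hmin : ∀ v, H ε c μ y w vs ≤ H ε c μ y w v) :
    (μ.prod (discreteMeasure y w)).tilted (logDensity ε c y w vs) ∈
      couplings μ (discreteMeasure y w) := by
  have := isProbabilityMeasure_discreteMeasure (y := y) D.weight_pos D.weight_sum
  have hgm : ∀ j, Measurable fun x => ENNReal.ofReal (gibbs ε c y w x vs j) := fun j =>
    ((D.measurable_gibbs j).comp (by fun_prop : Measurable fun x => (x, vs))).ennreal_ofReal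
  refine ⟨isProbabilityMeasure_tilted (D.integrable_exp_logDensity hy vs), ?_, ?_⟩
  · ext s hs
    rw [Measure.map_apply measurable_fst hs, D.tilted_logDensity_apply hy _ (measurable_fst hs),
      ← lintegral_indicator_one hs]
    refine lintegral_congr fun x => ?_
    have h1 : ∀ j, (Prod.fst ⁻¹' s : Set (X × Y)).indicator (1 : X × Y → ENNReal) (x, y j) =
        s.indicator 1 x := fun j => by
      by_cases h : x ∈ s <;> simp [h]
    simp_rw [h1, ← Finset.sum_mul]
    rw [← ENNReal.ofReal_sum_of_nonneg
      fun j _ => (gibbs_pos D.weight_pos D.weight_sum x vs j).le,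
      sum_gibbs D.weight_pos D.weight_sum, ENNReal.ofReal_one, one_mul]
  · ext s hs
    rw [Measure.map_apply measurable_snd hs, D.tilted_logDensity_apply hy _ (measurable_snd hs),
      ← lintegral_indicator_one hs, lintegral_discreteMeasure]
    have h1 : ∀ x j, (Prod.snd ⁻¹' s : Set (X × Y)).indicator (1 : X × Y → ENNReal) (x, y j) =
        s.indicator 1 (y j) := fun x j => by
      by_cases h : y j ∈ s <;> simp [h]
    simp_rw [h1]
    rw [lintegral_finsetSum _ fun j _ => (hgm j).mul_const _]
    refine Finset.sum_congr rfl fun j _ => ?_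
    rw [lintegral_mul_const _ (hgm j), ← ofReal_integral_eq_lintegral_ofReal _
      (Filter.Eventually.of_forall fun x => (gibbs_pos D.weight_pos D.weight_sum x vs j).le),
      D.integral_gibbs hmin]
    have h2 := (D.integrable_gradh vs j).add (integrable_const (w j))
    refine h2.congr (Filter.Eventually.of_forall fun x => ?_)
    simp [gradh_apply D.weight_pos D.weight_sum D.eps_pos]

omit [MeasurableSpace Y] [MeasurableSingletonClass Y] in
lemma integrable_log_part (v : EuclideanSpace ℝ (Fin J)) :
    Integrable (fun x => Real.log (part ε c y w x v)) μ := by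
  have h1 := ((D.integrable_h v).add (integrable_const (∑ j, v j * w j - ε))).div_const ε
  refine h1.congr (Filter.Eventually.of_forall fun x => ?_)
  have := D.eps_pos.ne'
  simp only [Pi.add_apply, h, part]
  field_simp
  ring

omit [MeasurableSpace Y] [MeasurableSingletonClass Y] in
lemma H_eq (v : EuclideanSpace ℝ (Fin J)) :
    H ε c μ y w v = ε + ε * ∫ x, Real.log (part ε c y w x v) ∂μ - ∑ j, v j * w j := by
  have h1 : H ε c μ y w v =
      ∫ x, (ε * Real.log (part ε c y w x v) + (ε - ∑ j, v j * w j)) ∂μ := by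
    rw [H]
    refine integral_congr_ae (Filter.Eventually.of_forall fun x => ?_)
    simp only [h, part]
    ring
  rw [h1, integral_add ((D.integrable_log_part v).const_mul ε) (integrable_const _),
    integral_const_mul]
  simp
  ring

variable {π : Measure (X × Y)}

omit D [MeasurableSingletonClass Y] [IsProbabilityMeasure μ] in
lemma integral_comp_fst (hπ : π ∈ couplings μ (discreteMeasure y w)) {f : X → ℝ}
    (hf : Integrable f μ) :
    Integrable (fun q : X × Y => f q.1) π ∧ ∫ q, f q.1 ∂π = ∫ x, f x ∂μ := by
  have hf' : Integrable f (π.map Prod.fst) := by rwa [hπ.2.1]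
  refine ⟨hf'.comp_measurable measurable_fst, ?_⟩
  rw [← hπ.2.1, integral_map measurable_fst.aemeasurable hf'.aestronglyMeasurable]

omit D [IsProbabilityMeasure μ] in
lemma integral_atomic_snd (hw : ∀ j, 0 < w j) (hy : Function.Injective y)
    (hπ : π ∈ couplings μ (discreteMeasure y w)) (a : Fin J → ℝ) :
    ∫ q, atomic y a q.2 ∂π = ∑ j, w j * a j := by
  have hm : Measurable (atomic y a) :=
    (measurable_atomic (X := Unit) (a := fun _ => a) (fun _ => measurable_const)).comp
      (by fun_prop : Measurable fun z : Y => ((), z))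
  rw [← integral_map (f := atomic y a) measurable_snd.aemeasurable hm.aestronglyMeasurable,
    hπ.2.2, integral_discreteMeasure hw]
  simp_rw [atomic_apply hy]

omit D [IsProbabilityMeasure μ] in
lemma ae_snd_mem_range (hπ : π ∈ couplings μ (discreteMeasure y w)) :
    ∀ᵐ q ∂π, q.2 ∈ Set.range y := by
  have h1 := ae_mem_range_discreteMeasure (y := y) (w := w)
  rw [← hπ.2.2] at h1
  exact ae_of_ae_map measurable_snd.aemeasurable h1

/-- Almost surely the log-density is `(v - c) / ε` minus a function of `x`. After adding the cost
only functions of one variable remain, so the last expression depends on `π` through its marginals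
alone. The cost is replaced by its values on the atoms, where joint measurability is available. -/
lemma integral_logDensity (hy : Function.Injective y)
    (hπ : π ∈ couplings μ (discreteMeasure y w)) (v : EuclideanSpace ℝ (Fin J)) :
    Integrable (logDensity ε c y w v) π ∧
    ∫⁻ q, ENNReal.ofReal (c q.1 q.2) ∂π =
      ENNReal.ofReal (∫ q, atomic y (fun j => c q.1 (y j)) q.2 ∂π) ∧
    ∫ q, atomic y (fun j => c q.1 (y j)) q.2 ∂π + ε * ∫ q, logDensity ε c y w v q ∂π
      = ε - H ε c μ y w v := by
  have := hπ.1
  have hCm : Measurable fun q : X × Y => atomic y (fun j => c q.1 (y j)) q.2 :=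
    measurable_atomic D.cost_meas
  have hCi : Integrable (fun q : X × Y => atomic y (fun j => c q.1 (y j)) q.2) π := by
    have h1 := (integral_comp_fst hπ
      (integrable_finsetSum Finset.univ fun j _ => (D.cost_int j).abs)).1
    exact h1.mono' hCm.aestronglyMeasurable (Filter.Eventually.of_forall fun q =>
      abs_atomic_le _ _)
  have hvm : Measurable fun q : X × Y => atomic y v.ofLp q.2 :=
    measurable_atomic (a := fun _ => v.ofLp) fun _ => measurable_const
  have hvi : Integrable (fun q : X × Y => atomic y v.ofLp q.2) π :=
    Integrable.of_bound hvm.aestronglyMeasurable _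
      (Filter.Eventually.of_forall fun q => abs_atomic_le _ _)
  obtain ⟨hli, hl⟩ := integral_comp_fst hπ (D.integrable_log_part v)
  have hae : logDensity ε c y w v =ᵐ[π] fun q =>
      (atomic y v.ofLp q.2 - atomic y (fun j => c q.1 (y j)) q.2) / ε -
        Real.log (part ε c y w q.1 v) := by
    filter_upwards [ae_snd_mem_range hπ] with q hq
    obtain ⟨k, hk⟩ := hq
    simp only [logDensity, ← hk, atomic_apply hy]
  have hsub : Integrable (fun q : X × Y =>
      (atomic y v.ofLp q.2 - atomic y (fun j => c q.1 (y j)) q.2) / ε) π :=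
    (hvi.sub hCi).div_const ε
  have hint := hsub.sub hli
  refine ⟨hint.congr hae.symm, ?_, ?_⟩
  · rw [ofReal_integral_eq_lintegral_ofReal hCi]
    · refine lintegral_congr_ae ?_
      filter_upwards [ae_snd_mem_range hπ] with q hq
      obtain ⟨k, hk⟩ := hq
      simp only [← hk, atomic_apply hy]
    · filter_upwards [ae_snd_mem_range hπ] with q hq
      obtain ⟨k, hk⟩ := hq
      simp only [← hk, atomic_apply hy, Pi.zero_apply]
      exact D.cost_nonneg _ _
  · rw [integral_congr_ae hae, integral_sub hsub hli, integral_div,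
      integral_sub hvi hCi, integral_atomic_snd D.weight_pos hy hπ, hl, D.H_eq]
    have := D.eps_pos.ne'
    simp_rw [mul_comm (w _)]
    field_simp
    ring

/-- The `-1` inside the divergence cancels the `ε` of `integral_logDensity`. The remaining bracket
is the relative entropy of `π` with respect to the tilted measure. -/
lemma primalObjective_eq (hy : Function.Injective y)
    (hπ : π ∈ couplings μ (discreteMeasure y w)) (v : EuclideanSpace ℝ (Fin J))
    (hac : π ≪ μ.prod (discreteMeasure y w))
    (hint : Integrable (llr π (μ.prod (discreteMeasure y w))) π) :
    primalObjective ε c μ (discreteMeasure y w) π =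
      ((-H ε c μ y w v + ε * (∫ q, llr π (μ.prod (discreteMeasure y w)) q ∂π -
        ∫ q, logDensity ε c y w v q ∂π) : ℝ) : EReal) := by
  have := hπ.1
  obtain ⟨_, h1, h2⟩ := D.integral_logDensity hy hπ v
  have hC : 0 ≤ ∫ q, atomic y (fun j => c q.1 (y j)) q.2 ∂π := by
    refine integral_nonneg_of_ae ?_
    filter_upwards [ae_snd_mem_range hπ] with q hq
    obtain ⟨k, hk⟩ := hq
    simp only [← hk, atomic_apply hy, Pi.zero_apply]
    exact D.cost_nonneg _ _
  rw [primalObjective, kl, if_pos ⟨hac, hint⟩, h1, EReal.coe_ennreal_ofReal, max_eq_left hC,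
    ← EReal.coe_mul, ← EReal.coe_add, integral_sub hint (integrable_const _)]
  congr 1
  simp only [integral_const, probReal_univ, smul_eq_mul, mul_one]
  linarith

theorem regularizedCost_eq (hy : Function.Injective y) {vs : EuclideanSpace ℝ (Fin J)}
    (hmin : ∀ v, H ε c μ y w vs ≤ H ε c μ y w v) :
    regularizedCost ε c μ (discreteMeasure y w) = -H ε c μ y w vs := by
  have := isProbabilityMeasure_discreteMeasure (y := y) D.weight_pos D.weight_sum
  set ξ := μ.prod (discreteMeasure y w) with hξ
  have hexp := D.integrable_exp_logDensity hy vs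
  have hint1 := D.integral_exp_logDensity hy vs
  suffices hinf : ⨅ π ∈ couplings μ (discreteMeasure y w),
      primalObjective ε c μ (discreteMeasure y w) π = ((-H ε c μ y w vs : ℝ) : EReal) by
    rw [regularizedCost, hinf, EReal.toReal_coe]
  refine le_antisymm ?_ (le_iInf₂ fun π hπ => ?_)
  · have hπ := D.tilted_mem_couplings hy hmin
    refine iInf₂_le_of_le _ hπ (le_of_eq ?_)
    have hac := tilted_absolutelyContinuous ξ (logDensity ε c y w vs)
    have hllr : llr (ξ.tilted (logDensity ε c y w vs)) ξ
        =ᵐ[ξ.tilted (logDensity ε c y w vs)] logDensity ε c y w vs := by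
      have h1 := hac.ae_le (log_rnDeriv_tilted_left_self hexp)
      filter_upwards [h1] with q hq
      rw [llr, hq, hint1, Real.log_one, sub_zero]
    rw [D.primalObjective_eq hy hπ vs hac
      ((D.integral_logDensity hy hπ vs).1.congr hllr.symm), integral_congr_ae hllr, hξ,
      sub_self, mul_zero, add_zero]
  · by_cases hcase : π ≪ ξ ∧ Integrable (llr π ξ) π
    · obtain ⟨hac, hint⟩ := hcase
      have := hπ.1
      rw [D.primalObjective_eq hy hπ vs hac hint, EReal.coe_le_coe_iff]
      have hf := (D.integral_logDensity hy hπ vs).1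
      have := isProbabilityMeasure_tilted hexp
      -- Nonnegativity of the relative entropy with respect to the Gibbs probability measure,
      -- rewritten relative to `ξ`.
      have h1 := InformationTheory.integral_llr_add_sub_measure_univ_nonneg
        (hac.trans (absolutelyContinuous_tilted hexp))
        (integrable_llr_tilted_right hac hf hint hexp)
      rw [integral_llr_tilted_right hac hf hexp hint, hint1] at h1
      simp only [Real.log_one, add_zero, probReal_univ] at h1
      have h2 := mul_nonneg D.eps_pos.le (by linarith :
        0 ≤ ∫ q, llr π ξ q ∂π - ∫ q, logDensity ε c y w vs q ∂π)
      linarith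
    · rw [primalObjective, kl, if_neg hcase, EReal.coe_mul_top_of_pos D.eps_pos,
        EReal.add_top_of_ne_bot]
      · exact le_top
      · simp

end IsSemiDual

/-! ### Real powers of integers -/

/-- Bernoulli's inequality bounds each term by an increment of `n ^ (1 - s) / (1 - s)`, and the sum
telescopes. -/
lemma sum_rpow_neg_le {s : ℝ} (hs0 : 0 ≤ s) (hs1 : s < 1) (n : ℕ) :
    ∑ k ∈ Finset.range n, ((k : ℝ) + 1) ^ (-s) ≤ (n : ℝ) ^ (1 - s) / (1 - s) := by
  have h1s : 0 < 1 - s := by linarith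
  induction n with
  | zero => simp [Real.zero_rpow h1s.ne']
  | succ n ih =>
    rw [Finset.sum_range_succ]
    have hn : (0 : ℝ) < (n : ℝ) + 1 := by positivity
    have hb : (1 + (-1 / ((n : ℝ) + 1))) ^ (1 - s) ≤ 1 + (1 - s) * (-1 / ((n : ℝ) + 1)) :=
      rpow_one_add_le_one_add_mul_self (by
        rw [le_div_iff₀ hn]; linarith [Nat.cast_nonneg (α := ℝ) n]) h1s.le (by linarith)
    have he : (1 + (-1 / ((n : ℝ) + 1))) = n / ((n : ℝ) + 1) := by field_simp; ring
    rw [he, Real.div_rpow (Nat.cast_nonneg n) hn.le, div_le_iff₀ (by positivity)] at hb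
    have hp : ((n : ℝ) + 1) ^ (1 - s) = ((n : ℝ) + 1) * ((n : ℝ) + 1) ^ (-s) := by
      rw [sub_eq_add_neg, Real.rpow_add hn, Real.rpow_one]
    have hm : ((n : ℝ) + 1) ^ (-s) * (1 - s) ≤ ((n : ℝ) + 1) ^ (1 - s) - (n : ℝ) ^ (1 - s) := by
      have : (1 + (1 - s) * (-1 / ((n : ℝ) + 1))) * ((n : ℝ) + 1) ^ (1 - s) =
          ((n : ℝ) + 1) ^ (1 - s) - ((n : ℝ) + 1) ^ (-s) * (1 - s) := by
        rw [hp]; field_simp; ring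
      linarith
    have hm' := div_le_div_of_nonneg_right hm h1s.le
    rw [mul_div_cancel_right₀ _ h1s.ne', sub_div] at hm'
    push_cast
    linarith

lemma sum_mod_ge {J : ℕ} [NeZero J] (a : ℕ → ℝ) (ha : ∀ k, 0 ≤ a k) (n : ℕ) :
    ((n / J : ℕ) : ℝ) * ∑ j ∈ Finset.range J, a j ≤ ∑ k ∈ Finset.range n, a (k % J) := by
  have h1 : ∀ m : ℕ, ∑ k ∈ Finset.range (J * m), a (k % J) =
      m * ∑ j ∈ Finset.range J, a j := by
    intro m
    induction m with
    | zero => simp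
    | succ m ih =>
      rw [Nat.mul_succ, Finset.sum_range_add, ih]
      have : ∑ i ∈ Finset.range J, a ((J * m + i) % J) = ∑ j ∈ Finset.range J, a j :=
        Finset.sum_congr rfl fun i hi => by
          rw [Nat.mul_add_mod, Nat.mod_eq_of_lt (Finset.mem_range.1 hi)]
      rw [this]
      push_cast
      ring
  rw [← h1]
  exact Finset.sum_le_sum_of_subset_of_nonneg
    (Finset.range_mono (Nat.mul_div_le n J)) fun k _ _ => ha _

/-! ### Quadratic forms -/

section QuadraticForms

variable {J : ℕ}

lemma norm_sq_eq_dot (v : EuclideanSpace ℝ (Fin J)) : ‖v‖ ^ 2 = v.ofLp ⬝ᵥ v.ofLp := by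
  rw [EuclideanSpace.real_norm_sq_eq, dotProduct]
  exact Finset.sum_congr rfl fun j _ => sq _

lemma dot_self_nonneg (x : Fin J → ℝ) : 0 ≤ x ⬝ᵥ x :=
  Finset.sum_nonneg fun _ _ => mul_self_nonneg _

lemma dot_sq_le (x z : Fin J → ℝ) : (x ⬝ᵥ z) ^ 2 ≤ (x ⬝ᵥ x) * (z ⬝ᵥ z) := by
  simp_rw [dotProduct, ← sq]
  exact Finset.sum_mul_sq_le_sq_mul_sq _ _ _

lemma quad_vecMulVec (a x : Fin J → ℝ) : x ⬝ᵥ (Matrix.vecMulVec a a *ᵥ x) = (a ⬝ᵥ x) ^ 2 := by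
  rw [Matrix.vecMulVec_mulVec, dotProduct_smul, dotProduct_comm x a]
  simp [sq]

lemma quad_sq_le_frobSq (A : Matrix (Fin J) (Fin J) ℝ) (x : Fin J → ℝ) :
    (x ⬝ᵥ (A *ᵥ x)) ^ 2 ≤ frobSq A * (x ⬝ᵥ x) ^ 2 := by
  have h1 : x ⬝ᵥ (A *ᵥ x) = ∑ q : Fin J × Fin J, A q.1 q.2 * (x q.1 * x q.2) := by
    rw [Fintype.sum_prod_type]
    simp_rw [dotProduct, Matrix.mulVec, dotProduct, Finset.mul_sum]
    exact Finset.sum_congr rfl fun i _ => Finset.sum_congr rfl fun j _ => by ring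
  have h2 : frobSq A = ∑ q : Fin J × Fin J, A q.1 q.2 ^ 2 := by
    rw [Fintype.sum_prod_type, frobSq]
  have h3 : (x ⬝ᵥ x) ^ 2 = ∑ q : Fin J × Fin J, (x q.1 * x q.2) ^ 2 := by
    rw [Fintype.sum_prod_type, sq, dotProduct, Finset.sum_mul_sum]
    exact Finset.sum_congr rfl fun i _ => Finset.sum_congr rfl fun j _ => by ring
  rw [h1, h2, h3]
  exact Finset.sum_mul_sq_le_sq_mul_sq _ _ _

lemma frobSq_nonneg (A : Matrix (Fin J) (Fin J) ℝ) : 0 ≤ frobSq A :=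
  Finset.sum_nonneg fun _ _ => Finset.sum_nonneg fun _ _ => sq_nonneg _

lemma PJ_mulVec [NeZero J] (x : Fin J → ℝ) (i : Fin J) :
    (PJ J *ᵥ x) i = x i - (∑ j, x j) / J := by
  have hJ : (0 : ℝ) < J := by exact_mod_cast NeZero.pos J
  rw [PJ, Matrix.sub_mulVec, Matrix.one_mulVec, Pi.sub_apply]
  congr 1
  simp only [Matrix.mulVec, dotProduct, Matrix.vecMulVec_apply, vJ]
  rw [← Finset.mul_sum]
  have : (1 / Real.sqrt J) * (1 / Real.sqrt J) = 1 / (J : ℝ) := by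
    rw [div_mul_div_comm, Real.mul_self_sqrt hJ.le, one_mul]
  rw [this]
  ring

lemma sum_PJ_mulVec [NeZero J] (x : Fin J → ℝ) : ∑ i, (PJ J *ᵥ x) i = 0 := by
  have hJ : (J : ℝ) ≠ 0 := by exact_mod_cast NeZero.ne J
  simp_rw [PJ_mulVec, Finset.sum_sub_distrib]
  simp
  field_simp
  ring

lemma PJ_mulVec_of_sum_eq_zero [NeZero J] {x : Fin J → ℝ} (hx : ∑ j, x j = 0) :
    PJ J *ᵥ x = x := by
  ext i
  rw [PJ_mulVec, hx, zero_div, sub_zero]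

lemma dot_PJ_mulVec [NeZero J] {g : Fin J → ℝ} (hg : ∑ j, g j = 0) (x : Fin J → ℝ) :
    g ⬝ᵥ (PJ J *ᵥ x) = g ⬝ᵥ x := by
  simp_rw [dotProduct, PJ_mulVec, mul_sub, Finset.sum_sub_distrib, ← Finset.sum_mul, hg, zero_mul,
    sub_zero]

lemma dot_PJ_mulVec_self_le [NeZero J] (x : Fin J → ℝ) :
    (PJ J *ᵥ x) ⬝ᵥ (PJ J *ᵥ x) ≤ x ⬝ᵥ x := by
  have h1 := dot_PJ_mulVec (sum_PJ_mulVec x) x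
  have h2 := dot_sq_le (PJ J *ᵥ x) x
  rw [← h1] at h2
  have h3 := dot_self_nonneg (PJ J *ᵥ x)
  have h4 := dot_self_nonneg x
  by_contra! hlt
  nlinarith

variable {S : Matrix (Fin J) (Fin J) ℝ}

lemma isUnit_det_of_quad_pos (hpos : ∀ x : Fin J → ℝ, x ≠ 0 → 0 < x ⬝ᵥ (S *ᵥ x)) :
    IsUnit S.det := by
  rw [isUnit_iff_ne_zero]
  intro h0
  obtain ⟨x, hx, hSx⟩ := Matrix.exists_mulVec_eq_zero_iff.2 h0
  have := hpos x hx
  simp [hSx] at this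

/-- With `x = S⁻¹ g`, one has `lam * ‖P x‖ ^ 2 ≤ x · S x = g · P x ≤ ‖g‖ * ‖P x‖`. Coercivity on
projected vectors is enough, which matters because the Gram matrix vanishes on constants. -/
lemma dot_PJ_inv_mulVec_le [NeZero J] (hdet : IsUnit S.det) {lam : ℝ} (hlam : 0 < lam)
    (hS : ∀ x : Fin J → ℝ, lam * ((PJ J *ᵥ x) ⬝ᵥ (PJ J *ᵥ x)) ≤ x ⬝ᵥ (S *ᵥ x))
    {g : Fin J → ℝ} (hg : ∑ j, g j = 0) :
    (PJ J *ᵥ (S⁻¹ *ᵥ g)) ⬝ᵥ (PJ J *ᵥ (S⁻¹ *ᵥ g)) ≤ (g ⬝ᵥ g) / lam ^ 2 := by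
  set x := S⁻¹ *ᵥ g with hx
  have hSx : S *ᵥ x = g := by
    rw [hx, Matrix.mulVec_mulVec, Matrix.mul_nonsing_inv _ hdet, Matrix.one_mulVec]
  have h1 := hS x
  rw [hSx, dotProduct_comm x g, ← dot_PJ_mulVec hg] at h1
  have h2 := dot_sq_le g (PJ J *ᵥ x)
  have h3 := dot_self_nonneg (PJ J *ᵥ x)
  set t := (PJ J *ᵥ x) ⬝ᵥ (PJ J *ᵥ x) with ht
  rw [le_div_iff₀ (by positivity)]
  have h4 : (lam * t) ^ 2 ≤ (g ⬝ᵥ g) * t := (pow_le_pow_left₀ (by positivity) h1 2).trans h2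
  rcases h3.eq_or_lt with h0 | h0
  · rw [← h0, zero_mul]; exact dot_self_nonneg g
  · exact le_of_mul_le_mul_right (by nlinarith : t * lam ^ 2 * t ≤ (g ⬝ᵥ g) * t) h0

/-- Evaluate the nonnegative form of `S` at `S⁻¹ x - Lam⁻¹ x`; no spectral decomposition is needed.
-/
lemma dot_inv_mulVec_ge (hdet : IsUnit S.det) (hsymm : Sᵀ = S)
    (hnonneg : ∀ x : Fin J → ℝ, 0 ≤ x ⬝ᵥ (S *ᵥ x)) {Lam : ℝ} (hLam : 0 < Lam)
    (hS : ∀ x : Fin J → ℝ, x ⬝ᵥ (S *ᵥ x) ≤ Lam * (x ⬝ᵥ x)) (x : Fin J → ℝ) :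
    (x ⬝ᵥ x) / Lam ≤ x ⬝ᵥ (S⁻¹ *ᵥ x) := by
  set z := S⁻¹ *ᵥ x with hz
  have hSz : S *ᵥ z = x := by
    rw [hz, Matrix.mulVec_mulVec, Matrix.mul_nonsing_inv _ hdet, Matrix.one_mulVec]
  have h1 := hnonneg (z - Lam⁻¹ • x)
  have h2 : z ⬝ᵥ (S *ᵥ x) = x ⬝ᵥ x := by
    rw [Matrix.dotProduct_mulVec, ← Matrix.mulVec_transpose, hsymm, hSz]
  simp only [Matrix.mulVec_sub, Matrix.mulVec_smul, dotProduct_sub, sub_dotProduct,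
    smul_dotProduct, dotProduct_smul, hSz, h2, smul_eq_mul] at h1
  rw [dotProduct_comm z x] at h1
  have h3 : Lam⁻¹ * (Lam⁻¹ * (x ⬝ᵥ (S *ᵥ x))) ≤ Lam⁻¹ * (x ⬝ᵥ x) := by
    refine mul_le_mul_of_nonneg_left ?_ (inv_pos.2 hLam).le
    rw [inv_mul_le_iff₀ hLam]
    exact hS x
  rw [div_eq_inv_mul]
  linarith

end QuadraticForms

/-! ### Deterministic bounds on the algorithm -/

section Recursion

variable {X Y : Type*} {J : ℕ} (ε : ℝ) (c : X → Y → ℝ) (y : Fin J → Y) (w : Fin J → ℝ)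
  (α β γ : ℝ) (v₀ : EuclideanSpace ℝ (Fin J)) (x : ℕ → X)

/-- The matrix `S_n`. -/
def Smat (n : ℕ) : Matrix (Fin J) (Fin J) ℝ := (sgn ε c y w α β γ v₀ x n).2

/-- The sum of the first `n` outer products of gradients. -/
def gramSum (n : ℕ) : Matrix (Fin J) (Fin J) ℝ :=
  ∑ k ∈ Finset.range n,
    Matrix.vecMulVec (gradh ε c y w (x k) (Vhat ε c y w α β γ v₀ x k)).ofLp
      (gradh ε c y w (x k) (Vhat ε c y w α β γ v₀ x k)).ofLp

/-- The weight of the `n`-th regularizing rank one matrix. -/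
def regWeight (J : ℕ) (β γ : ℝ) (n : ℕ) : ℝ := γ * (1 + (((n + 1) / J : ℕ) : ℝ)) ^ (-β)

/-- The deterministic part of `S_n`. -/
def regSum {J : ℕ} (w : Fin J → ℝ) (β γ : ℝ) (n : ℕ) : Matrix (Fin J) (Fin J) ℝ :=
  1 + ∑ k ∈ Finset.range n, regWeight J β γ k • Matrix.vecMulVec (Z w (k + 1)) (Z w (k + 1))

/-- The direction `P_J S_n⁻¹ g` of a Gauss-Newton step. -/
def direction (n : ℕ) (g : Fin J → ℝ) : Fin J → ℝ :=
  PJ J *ᵥ ((Smat ε c y w α β γ v₀ x n)⁻¹ *ᵥ g)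

lemma Smat_eq (n : ℕ) :
    Smat ε c y w α β γ v₀ x n = gramSum ε c y w α β γ v₀ x n + regSum w β γ n := by
  induction n with
  | zero => simp [Smat, sgn, gramSum, regSum]
  | succ n ih =>
    have h1 : Smat ε c y w α β γ v₀ x (n + 1) = Smat ε c y w α β γ v₀ x n +
        Matrix.vecMulVec (gradh ε c y w (x n) (Vhat ε c y w α β γ v₀ x n)).ofLp
          (gradh ε c y w (x n) (Vhat ε c y w α β γ v₀ x n)).ofLp +
        regWeight J β γ n • Matrix.vecMulVec (Z w (n + 1)) (Z w (n + 1)) := rfl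
    rw [h1, ih, gramSum, gramSum, regSum, regSum, Finset.sum_range_succ, Finset.sum_range_succ]
    abel

lemma Vhat_succ [NeZero J] {n : ℕ} (hV : ∑ j, Vhat ε c y w α β γ v₀ x n j = 0) :
    Vhat ε c y w α β γ v₀ x (n + 1) = Vhat ε c y w α β γ v₀ x n +
      WithLp.toLp 2 (-((n : ℝ) ^ α • direction ε c y w α β γ v₀ x n
        (gradh ε c y w (x n) (Vhat ε c y w α β γ v₀ x n)).ofLp)) := by
  have h1 : Vhat ε c y w α β γ v₀ x (n + 1) =
      WithLp.toLp 2 (PJ J *ᵥ ((Vhat ε c y w α β γ v₀ x n).ofLp - (n : ℝ) ^ α •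
        ((Smat ε c y w α β γ v₀ x n)⁻¹ *ᵥ
          (gradh ε c y w (x n) (Vhat ε c y w α β γ v₀ x n)).ofLp))) := rfl
  rw [h1, Matrix.mulVec_sub, Matrix.mulVec_smul, PJ_mulVec_of_sum_eq_zero hV, direction,
    sub_eq_add_neg, WithLp.toLp_add]

lemma sum_Vhat_succ [NeZero J] (n : ℕ) : ∑ j, Vhat ε c y w α β γ v₀ x (n + 1) j = 0 :=
  sum_PJ_mulVec _

lemma sum_Vhat [NeZero J] {n : ℕ} (hn : 1 ≤ n) : ∑ j, Vhat ε c y w α β γ v₀ x n j = 0 := by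
  obtain ⟨m, rfl⟩ := Nat.exists_eq_add_of_le' hn
  exact sum_Vhat_succ ..

/-- The step of index `0` has length `0 ^ α = 0`, so it only projects the initial value. -/
lemma Vhat_one [NeZero J] (hα : 0 < α) :
    Vhat ε c y w α β γ v₀ x 1 = WithLp.toLp 2 (PJ J *ᵥ v₀.ofLp) := by
  have h1 : Vhat ε c y w α β γ v₀ x 1 =
      WithLp.toLp 2 (PJ J *ᵥ (v₀.ofLp - ((0 : ℕ) : ℝ) ^ α •
        ((1 : Matrix (Fin J) (Fin J) ℝ)⁻¹ *ᵥ (gradh ε c y w (x 0) v₀).ofLp))) := rfl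
  rw [h1, Nat.cast_zero, Real.zero_rpow hα.ne', zero_smul, sub_zero]

lemma quad_gramSum (n : ℕ) (u : Fin J → ℝ) :
    u ⬝ᵥ (gramSum ε c y w α β γ v₀ x n *ᵥ u) = ∑ k ∈ Finset.range n,
      ((gradh ε c y w (x k) (Vhat ε c y w α β γ v₀ x k)).ofLp ⬝ᵥ u) ^ 2 := by
  rw [gramSum, Matrix.sum_mulVec, dotProduct_sum]
  exact Finset.sum_congr rfl fun k _ => quad_vecMulVec _ _

lemma quad_regSum (n : ℕ) (u : Fin J → ℝ) :
    u ⬝ᵥ (regSum w β γ n *ᵥ u) = u ⬝ᵥ u + ∑ k ∈ Finset.range n,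
      regWeight J β γ k * (Z w (k + 1) ⬝ᵥ u) ^ 2 := by
  rw [regSum, Matrix.add_mulVec, Matrix.sum_mulVec, Matrix.one_mulVec, dotProduct_add,
    dotProduct_sum]
  congr 1
  refine Finset.sum_congr rfl fun k _ => ?_
  rw [Matrix.smul_mulVec, dotProduct_smul, quad_vecMulVec, smul_eq_mul]

lemma transpose_Smat (n : ℕ) : (Smat ε c y w α β γ v₀ x n)ᵀ = Smat ε c y w α β γ v₀ x n := by
  simp [Smat_eq, gramSum, regSum, Matrix.transpose_add, Matrix.transpose_sum,
    Matrix.transpose_smul, Matrix.transpose_vecMulVec]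

end Recursion

/-! ### Size of the regularizing matrices. -/

section Regularization

variable {J : ℕ} {w : Fin J → ℝ} {β γ : ℝ}

lemma Z_dot_sq (hw : ∀ j, 0 < w j) [NeZero J] (k : ℕ) (u : Fin J → ℝ) :
    (Z w (k + 1) ⬝ᵥ u) ^ 2 = w (Fin.ofNat J k) * u (Fin.ofNat J k) ^ 2 := by
  have h1 : Z w (k + 1) ⬝ᵥ u = Real.sqrt (w (Fin.ofNat J k)) * u (Fin.ofNat J k) := by
    rw [dotProduct, Finset.sum_eq_single (Fin.ofNat J k)]
    · simp [Z]
    · intro j _ hj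
      have : (j : ℕ) ≠ k % J := fun h => hj (Fin.ext (by simpa using h))
      simp [Z, this]
    · simp
  rw [h1, mul_pow, Real.sq_sqrt (hw _).le]

lemma regWeight_nonneg (hγ : 0 < γ) (k : ℕ) : 0 ≤ regWeight J β γ k := by
  unfold regWeight; positivity

lemma regWeight_le (hβ : 0 < β) (hγ : 0 < γ) (k : ℕ) : regWeight J β γ k ≤ γ := by
  unfold regWeight
  have h1 : (1 + (((k + 1) / J : ℕ) : ℝ)) ^ (-β) ≤ 1 :=
    Real.rpow_le_one_of_one_le_of_nonpos (by linarith [Nat.cast_nonneg (α := ℝ) ((k + 1) / J)])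
      (by linarith)
  nlinarith

lemma exists_regWeight_le (J : ℕ) [NeZero J] (hβ : 0 < β) (hγ : 0 < γ) :
    ∃ C > 0, ∀ k : ℕ, regWeight J β γ k ≤ C * ((k : ℝ) + 1) ^ (-β) := by
  have hJ : (0 : ℝ) < J := by exact_mod_cast NeZero.pos J
  refine ⟨γ * (J : ℝ) ^ β, by positivity, fun k => ?_⟩
  have h1 : ((k : ℝ) + 1) / J ≤ 1 + (((k + 1) / J : ℕ) : ℝ) := by
    rw [div_le_iff₀ hJ]
    have := Nat.lt_mul_div_succ (k + 1) (NeZero.pos J)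
    have h2 : ((k + 1 : ℕ) : ℝ) ≤ (J * ((k + 1) / J + 1) : ℕ) := by exact_mod_cast this.le
    push_cast at h2
    linarith
  have h2 : (1 + (((k + 1) / J : ℕ) : ℝ)) ^ (-β) ≤ (((k : ℝ) + 1) / J) ^ (-β) :=
    Real.rpow_le_rpow_of_nonpos (by positivity) h1 (by linarith)
  have h3 : (((k : ℝ) + 1) / J) ^ (-β) = (J : ℝ) ^ β * ((k : ℝ) + 1) ^ (-β) := by
    rw [Real.div_rpow (by positivity) hJ.le, Real.rpow_neg hJ.le, div_inv_eq_mul, mul_comm]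
  rw [h3] at h2
  unfold regWeight
  nlinarith

/-- Each complete cycle of `J` indices visits every coordinate, hence contributes at least `γ * w i
* (1 + n) ^ (-β)` times the squared norm, and there are about `n / J` cycles. -/
lemma exists_quad_regSum_ge (hw : ∀ j, 0 < w j) [NeZero J] (hβ : 0 < β)
    (hγ : 0 < γ) :
    ∃ κ > 0, ∀ n : ℕ, 1 ≤ n → ∀ u : Fin J → ℝ,
      κ * (n : ℝ) ^ (1 - β) * (u ⬝ᵥ u) ≤ u ⬝ᵥ (regSum w β γ n *ᵥ u) := by
  have hJ : (0 : ℝ) < J := by exact_mod_cast NeZero.pos J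
  have : Nonempty (Fin J) := ⟨0⟩
  obtain ⟨i, hi⟩ := Finite.exists_min w
  -- Capping by `1` lets the identity matrix `S_0` pay for the incomplete cycle, in particular when
  -- `n < J`.
  set κ₀ := min 1 (γ * w i) with hκ
  have hκ0 : 0 < κ₀ := lt_min one_pos (mul_pos hγ (hw i))
  refine ⟨κ₀ * ((2 : ℝ) ^ (-β) / J), by positivity, fun n hn u => ?_⟩
  have hn0 : (0 : ℝ) < n := by exact_mod_cast hn
  have hn1 : (1 : ℝ) ≤ n := by exact_mod_cast hn
  set r : ℝ := (1 + (n : ℝ)) ^ (-β) with hr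
  have hr0 : 0 < r := by positivity
  have hr1 : r ≤ 1 := Real.rpow_le_one_of_one_le_of_nonpos (by linarith) (by linarith)
  have hu := dot_self_nonneg u
  have hterm : ∀ k ∈ Finset.range n, γ * w i * r * u (Fin.ofNat J k) ^ 2 ≤
      regWeight J β γ k * (Z w (k + 1) ⬝ᵥ u) ^ 2 := by
    intro k hk
    rw [Z_dot_sq hw]
    have h1 : r ≤ (1 + (((k + 1) / J : ℕ) : ℝ)) ^ (-β) := by
      refine Real.rpow_le_rpow_of_nonpos (by positivity) ?_ (by linarith)
      have h2 : (k + 1) / J ≤ n := (Nat.div_le_self _ _).trans (Finset.mem_range.1 hk)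
      have h3 : (((k + 1) / J : ℕ) : ℝ) ≤ n := by exact_mod_cast h2
      linarith
    have h2 : w i * r ≤ w (Fin.ofNat J k) * (1 + (((k + 1) / J : ℕ) : ℝ)) ^ (-β) :=
      mul_le_mul (hi _) h1 hr0.le (hw _).le
    have h3 := mul_le_mul_of_nonneg_right (mul_le_mul_of_nonneg_left h2 hγ.le)
      (sq_nonneg (u (Fin.ofNat J k)))
    unfold regWeight
    linarith
  have hsum := Finset.sum_le_sum hterm
  rw [← Finset.mul_sum] at hsum
  have hmod := sum_mod_ge (J := J) (fun k => u (Fin.ofNat J k) ^ 2) (fun k => sq_nonneg _) n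
  have e1 : ∑ j ∈ Finset.range J, u (Fin.ofNat J j) ^ 2 = u ⬝ᵥ u := by
    rw [← Fin.sum_univ_eq_sum_range (fun j => u (Fin.ofNat J j) ^ 2), dotProduct]
    refine Finset.sum_congr rfl fun j _ => ?_
    have : Fin.ofNat J (j : ℕ) = j := Fin.ext (by simp)
    rw [this, sq]
  have e2 : ∀ k, u (Fin.ofNat J (k % J)) = u (Fin.ofNat J k) := fun k => by
    congr 1
    exact Fin.ext (by simp)
  simp_rw [e2] at hmod
  rw [e1] at hmod
  rw [quad_regSum]
  set m : ℝ := ((n / J : ℕ) : ℝ) with hm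
  have hm0 : 0 ≤ m := Nat.cast_nonneg _
  have hnJ : (n : ℝ) / J ≤ 1 + m := by
    rw [div_le_iff₀ hJ]
    have := Nat.lt_mul_div_succ n (NeZero.pos J)
    have h2 : ((n : ℕ) : ℝ) ≤ (J * (n / J + 1) : ℕ) := by exact_mod_cast this.le
    push_cast at h2
    linarith
  have h2r : (2 : ℝ) ^ (-β) * (n : ℝ) ^ (-β) ≤ r := by
    rw [← Real.mul_rpow (by norm_num) hn0.le]
    exact Real.rpow_le_rpow_of_nonpos (by positivity) (by linarith) (by linarith)
  have hfin : κ₀ * ((2 : ℝ) ^ (-β) / J) * (n : ℝ) ^ (1 - β) ≤ 1 + γ * w i * r * m := by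
    have e3 : (n : ℝ) ^ (1 - β) = n * (n : ℝ) ^ (-β) := by
      rw [sub_eq_add_neg, Real.rpow_add hn0, Real.rpow_one]
    calc κ₀ * ((2 : ℝ) ^ (-β) / J) * (n : ℝ) ^ (1 - β)
        = κ₀ * (((2 : ℝ) ^ (-β) * (n : ℝ) ^ (-β)) * (n / J)) := by rw [e3]; ring
      _ ≤ κ₀ * (r * (1 + m)) := by gcongr
      _ = κ₀ * r + κ₀ * (r * m) := by ring
      _ ≤ 1 + (γ * w i) * (r * m) := by
          have h1 : κ₀ * r ≤ 1 := mul_le_one₀ (min_le_left _ _) hr0.le hr1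
          have h2 : κ₀ * (r * m) ≤ (γ * w i) * (r * m) :=
            mul_le_mul_of_nonneg_right (min_le_right _ _) (by positivity)
          linarith
      _ = _ := by ring
  have h5 := mul_le_mul_of_nonneg_right hfin hu
  have h6 := mul_le_mul_of_nonneg_left hmod
    (mul_nonneg (mul_pos hγ (hw i)).le hr0.le : 0 ≤ γ * w i * r)
  linarith

lemma quad_regSum_le (hw : ∀ j, 0 < w j) (hs : ∑ j, w j = 1) [NeZero J] (hβ : 0 < β)
    (hγ : 0 < γ) (n : ℕ) (u : Fin J → ℝ) :
    u ⬝ᵥ (regSum w β γ n *ᵥ u) ≤ (1 + γ * n) * (u ⬝ᵥ u) := by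
  rw [quad_regSum]
  have hterm : ∀ k ∈ Finset.range n, regWeight J β γ k * (Z w (k + 1) ⬝ᵥ u) ^ 2 ≤
      γ * (u ⬝ᵥ u) := by
    intro k _
    refine mul_le_mul (regWeight_le hβ hγ k) ?_ (sq_nonneg _) hγ.le
    rw [Z_dot_sq hw]
    have h1 : u (Fin.ofNat J k) ^ 2 ≤ u ⬝ᵥ u := by
      simp_rw [dotProduct, ← sq]
      exact Finset.single_le_sum (f := fun j => u j ^ 2) (fun j _ => sq_nonneg _)
        (Finset.mem_univ _)
    have h2 := weight_le_one hw hs (Fin.ofNat J k)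
    have h3 := hw (Fin.ofNat J k)
    nlinarith [sq_nonneg (u (Fin.ofNat J k))]
  have := Finset.sum_le_sum hterm
  rw [Finset.sum_const, Finset.card_range, nsmul_eq_mul] at this
  linarith

/-- The weights decay like `k ^ (-β)`, so their average is of order `n ^ (-β)`; this deterministic
bias contributes the `n ^ (-2 * β)` term in the rate for `Sbar`. -/
lemma exists_frobSq_regSum_le (hw : ∀ j, 0 < w j) (hs : ∑ j, w j = 1) [NeZero J] (hβ : 0 < β)
    (hβ1 : β < 1) (hγ : 0 < γ) :
    ∃ C > 0, ∀ n : ℕ, 1 ≤ n → frobSq ((n : ℝ)⁻¹ • regSum w β γ n) ≤ C * (n : ℝ) ^ (-(2 * β)) := by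
  have hJ : (0 : ℝ) < J := by exact_mod_cast NeZero.pos J
  obtain ⟨C, hC, hCle⟩ := exists_regWeight_le J hβ hγ
  have h1β : 0 < 1 - β := by linarith
  set K := 1 + C / (1 - β) with hK
  have hK0 : 0 < K := by positivity
  refine ⟨J * (J * K ^ 2), by positivity, fun n hn => ?_⟩
  have hn0 : (0 : ℝ) < n := by exact_mod_cast hn
  have hn1 : (1 : ℝ) ≤ n := by exact_mod_cast hn
  have hZ : ∀ k j, |Z w k j| ≤ 1 := by
    intro k j
    unfold Z
    split_ifs
    · rw [abs_of_nonneg (Real.sqrt_nonneg _)]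
      exact Real.sqrt_le_one.2 (weight_le_one hw hs j)
    · simp
  have hent : ∀ i j, |regSum w β γ n i j| ≤ K * (n : ℝ) ^ (1 - β) := by
    intro i j
    have h1 : regSum w β γ n i j = (1 : Matrix (Fin J) (Fin J) ℝ) i j +
        ∑ k ∈ Finset.range n, regWeight J β γ k * (Z w (k + 1) i * Z w (k + 1) j) := by
      simp [regSum, Matrix.sum_apply, Matrix.vecMulVec_apply]
    have h2 : |(1 : Matrix (Fin J) (Fin J) ℝ) i j| ≤ 1 := by
      rw [Matrix.one_apply]; split_ifs <;> simp
    have h3 : |∑ k ∈ Finset.range n, regWeight J β γ k * (Z w (k + 1) i * Z w (k + 1) j)| ≤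
        ∑ k ∈ Finset.range n, C * ((k : ℝ) + 1) ^ (-β) := by
      refine (Finset.abs_sum_le_sum_abs _ _).trans (Finset.sum_le_sum fun k _ => ?_)
      rw [abs_mul, abs_of_nonneg (regWeight_nonneg hγ k), abs_mul]
      have h4 : |Z w (k + 1) i| * |Z w (k + 1) j| ≤ 1 :=
        mul_le_one₀ (hZ _ _) (abs_nonneg _) (hZ _ _)
      calc _ ≤ regWeight J β γ k * 1 := mul_le_mul_of_nonneg_left h4 (regWeight_nonneg hγ k)
        _ ≤ _ := by rw [mul_one]; exact hCle k
    rw [← Finset.mul_sum] at h3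
    have h5 := mul_le_mul_of_nonneg_left (sum_rpow_neg_le hβ.le hβ1 n) hC.le
    have h6 : (1 : ℝ) ≤ (n : ℝ) ^ (1 - β) := Real.one_le_rpow hn1 h1β.le
    rw [h1]
    refine (abs_add_le _ _).trans ?_
    have h7 : K * (n : ℝ) ^ (1 - β) = (n : ℝ) ^ (1 - β) + C * ((n : ℝ) ^ (1 - β) / (1 - β)) := by
      rw [hK]; ring
    linarith
  have hsq : ∀ i j, (((n : ℝ)⁻¹ • regSum w β γ n) i j) ^ 2 ≤ K ^ 2 * (n : ℝ) ^ (-(2 * β)) := by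
    intro i j
    have h1 : |((n : ℝ)⁻¹ • regSum w β γ n) i j| ≤ K * (n : ℝ) ^ (-β) := by
      rw [Matrix.smul_apply, smul_eq_mul, abs_mul, abs_of_nonneg (inv_nonneg.2 hn0.le),
        inv_mul_le_iff₀ hn0]
      refine (hent i j).trans (le_of_eq ?_)
      rw [sub_eq_add_neg, Real.rpow_add hn0, Real.rpow_one]
      ring
    have h2 : (n : ℝ) ^ (-(2 * β)) = ((n : ℝ) ^ (-β)) ^ 2 := by
      rw [← Real.rpow_natCast, ← Real.rpow_mul hn0.le]
      congr 1
      push_cast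
      ring
    rw [h2, ← mul_pow, ← sq_abs]
    exact pow_le_pow_left₀ (abs_nonneg _) h1 2
  calc frobSq ((n : ℝ)⁻¹ • regSum w β γ n)
      ≤ ∑ _i : Fin J, ∑ _j : Fin J, K ^ 2 * (n : ℝ) ^ (-(2 * β)) :=
        Finset.sum_le_sum fun i _ => Finset.sum_le_sum fun j _ => hsq i j
    _ = _ := by simp; ring

lemma frobSq_add_le (A B : Matrix (Fin J) (Fin J) ℝ) :
    frobSq (A + B) ≤ 2 * frobSq A + 2 * frobSq B := by
  simp_rw [frobSq, Finset.mul_sum, ← Finset.sum_add_distrib]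
  refine Finset.sum_le_sum fun i _ => Finset.sum_le_sum fun j _ => ?_
  rw [Matrix.add_apply]
  nlinarith [sq_nonneg (A i j - B i j)]

end Regularization

/-! ### Spectral bounds on `S_n` and lengths of steps. -/

namespace IsSemiDual

variable {X Y : Type*} [MeasurableSpace X] {J : ℕ} {ε : ℝ} {c : X → Y → ℝ} {μ : Measure X}
  {y : Fin J → Y} {w : Fin J → ℝ} (D : IsSemiDual ε c μ y w) {α β γ : ℝ}

include D

lemma gradh_dot_self_le (x : X) (v : EuclideanSpace ℝ (Fin J)) :
    (gradh ε c y w x v).ofLp ⬝ᵥ (gradh ε c y w x v).ofLp ≤ 2 := by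
  simp_rw [dotProduct, ← sq]
  exact sum_gradh_sq_le D.weight_pos D.weight_sum D.eps_pos x v

lemma quad_gramSum_le (v₀ : EuclideanSpace ℝ (Fin J)) (x : ℕ → X) (n : ℕ) (u : Fin J → ℝ) :
    u ⬝ᵥ (gramSum ε c y w α β γ v₀ x n *ᵥ u) ≤ 2 * n * (u ⬝ᵥ u) := by
  rw [quad_gramSum]
  have h1 : ∀ k ∈ Finset.range n,
      ((gradh ε c y w (x k) (Vhat ε c y w α β γ v₀ x k)).ofLp ⬝ᵥ u) ^ 2 ≤ 2 * (u ⬝ᵥ u) :=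
    fun k _ => (dot_sq_le _ _).trans
      (mul_le_mul_of_nonneg_right (D.gradh_dot_self_le _ _) (dot_self_nonneg u))
  have := Finset.sum_le_sum h1
  rw [Finset.sum_const, Finset.card_range, nsmul_eq_mul] at this
  linarith

lemma quad_gramSum_PJ (v₀ : EuclideanSpace ℝ (Fin J)) (x : ℕ → X) (n : ℕ) (u : Fin J → ℝ) :
    (PJ J *ᵥ u) ⬝ᵥ (gramSum ε c y w α β γ v₀ x n *ᵥ (PJ J *ᵥ u)) =
      u ⬝ᵥ (gramSum ε c y w α β γ v₀ x n *ᵥ u) := by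
  have := D.neZero
  simp_rw [quad_gramSum, dot_PJ_mulVec (sum_gradh D.weight_pos D.weight_sum D.eps_pos _ _)]

lemma exists_quad_Smat (hβ : 0 < β) (hγ : 0 < γ) :
    ∃ κ > 0, ∀ v₀ x, ∀ n : ℕ, 1 ≤ n → ∀ u : Fin J → ℝ,
      κ * (n : ℝ) ^ (1 - β) * (u ⬝ᵥ u) ≤ u ⬝ᵥ (Smat ε c y w α β γ v₀ x n *ᵥ u) ∧
      u ⬝ᵥ (Smat ε c y w α β γ v₀ x n *ᵥ u) ≤ (3 + γ) * n * (u ⬝ᵥ u) := by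
  have := D.neZero
  obtain ⟨κ, hκ, hle⟩ := exists_quad_regSum_ge D.weight_pos hβ hγ
  refine ⟨κ, hκ, fun v₀ x n hn u => ?_⟩
  rw [Smat_eq, Matrix.add_mulVec, dotProduct_add]
  constructor
  · have h1 := hle n hn u
    have h2 : 0 ≤ u ⬝ᵥ (gramSum ε c y w α β γ v₀ x n *ᵥ u) := by
      rw [quad_gramSum]; exact Finset.sum_nonneg fun _ _ => sq_nonneg _
    linarith
  · have h1 := D.quad_gramSum_le (α := α) (β := β) (γ := γ) v₀ x n u
    have h2 := quad_regSum_le D.weight_pos D.weight_sum hβ hγ n u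
    have hn1 : (1 : ℝ) ≤ n := by exact_mod_cast hn
    nlinarith [dot_self_nonneg u]

omit [MeasurableSpace X] D in
lemma isUnit_det_Smat [NeZero J] (hγ : 0 < γ) (v₀ : EuclideanSpace ℝ (Fin J)) (x : ℕ → X) (n : ℕ) :
    IsUnit (Smat ε c y w α β γ v₀ x n).det := by
  refine isUnit_det_of_quad_pos fun u hu => ?_
  rw [Smat_eq, Matrix.add_mulVec, dotProduct_add, quad_gramSum, quad_regSum]
  have h0 : 0 < u ⬝ᵥ u := (dot_self_nonneg u).lt_of_ne fun h =>
    hu (dotProduct_self_eq_zero.1 h.symm)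
  have h1 := Finset.sum_nonneg (s := Finset.range n) fun k _ =>
    sq_nonneg ((gradh ε c y w (x k) (Vhat ε c y w α β γ v₀ x k)).ofLp ⬝ᵥ u)
  have h2 := Finset.sum_nonneg (s := Finset.range n) fun k _ =>
    mul_nonneg (regWeight_nonneg (J := J) (β := β) hγ k) (sq_nonneg (Z w (k + 1) ⬝ᵥ u))
  linarith

/-- A preconditioned gradient step decreases at least like a step of size `1 / n`. -/
lemma dot_inv_Smat_ge (hβ : 0 < β) (hγ : 0 < γ) (v₀ : EuclideanSpace ℝ (Fin J)) (x : ℕ → X)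
    {n : ℕ} (hn : 1 ≤ n) (u : Fin J → ℝ) :
    (u ⬝ᵥ u) / ((3 + γ) * n) ≤ u ⬝ᵥ ((Smat ε c y w α β γ v₀ x n)⁻¹ *ᵥ u) := by
  have := D.neZero
  obtain ⟨κ, hκ, hle⟩ := D.exists_quad_Smat (α := α) hβ hγ
  have hn0 : (0 : ℝ) < n := by exact_mod_cast hn
  exact dot_inv_mulVec_ge (isUnit_det_Smat hγ v₀ x n) (transpose_Smat ..)
    (fun u => le_trans (mul_nonneg (by positivity) (dot_self_nonneg u)) (hle v₀ x n hn u).1)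
    (by positivity) (fun u => (hle v₀ x n hn u).2) u

/-- Deterministic bound on the length of a step. -/
lemma exists_direction_le (hβ : 0 < β) (hγ : 0 < γ) :
    ∃ C > 0, ∀ v₀ x, ∀ n : ℕ, 1 ≤ n → ∀ g : Fin J → ℝ, ∑ j, g j = 0 → g ⬝ᵥ g ≤ 4 →
      direction ε c y w α β γ v₀ x n g ⬝ᵥ direction ε c y w α β γ v₀ x n g ≤
        C * (n : ℝ) ^ (2 * β - 2) := by
  have := D.neZero
  obtain ⟨κ, hκ, hle⟩ := D.exists_quad_Smat (α := α) hβ hγ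
  -- The bound `4` on `g ⬝ᵥ g` covers both the sample gradients and the gradient of `H`, whose norms
  -- are at most two.
  refine ⟨4 / κ ^ 2, by positivity, fun v₀ x n hn g hg hg4 => ?_⟩
  have hn0 : (0 : ℝ) < n := by exact_mod_cast hn
  have h1 := dot_PJ_inv_mulVec_le (isUnit_det_Smat (ε := ε) (c := c) (y := y) (w := w) (α := α)
      (β := β) hγ v₀ x n)
    (lam := κ * (n : ℝ) ^ (1 - β)) (by positivity)
    (fun u => (mul_le_mul_of_nonneg_left (dot_PJ_mulVec_self_le u) (by positivity)).trans
      (hle v₀ x n hn u).1) hg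
  refine h1.trans ((div_le_div_of_nonneg_right hg4 (by positivity)).trans (le_of_eq ?_))
  have h2 : (n : ℝ) ^ (2 * β - 2) = (((n : ℝ) ^ (1 - β)) ^ 2)⁻¹ := by
    rw [← Real.rpow_natCast, ← Real.rpow_mul hn0.le, ← Real.rpow_neg hn0.le]
    congr 1
    push_cast
    ring
  rw [h2, mul_pow]
  field_simp

/-- Bound on the length of a step when the empirical Gram matrix is close to `G`. -/
lemma exists_direction_le_of_gram (hβ : 0 < β) (hγ : 0 < γ) {vs : EuclideanSpace ℝ (Fin J)}
    (hG : ∃ lam > 0, ∀ u ∈ vJPerp J, lam * ‖u‖ ^ 2 ≤ u.ofLp ⬝ᵥ (G ε c μ y w vs *ᵥ u.ofLp)) :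
    ∃ C > 0, ∀ v₀ x, ∀ n : ℕ, 1 ≤ n → ∀ x' v,
      direction ε c y w α β γ v₀ x n (gradh ε c y w x' v).ofLp ⬝ᵥ
        direction ε c y w α β γ v₀ x n (gradh ε c y w x' v).ofLp ≤
      C * ((n : ℝ) ^ (-2 : ℝ) + (n : ℝ) ^ (2 * β - 2) *
        frobSq ((n : ℝ)⁻¹ • gramSum ε c y w α β γ v₀ x n - G ε c μ y w vs)) := by
  have := D.neZero
  obtain ⟨lam, hlam, hGle⟩ := hG
  obtain ⟨C, hC, hCle⟩ := D.exists_direction_le (α := α) hβ hγ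
  refine ⟨8 / lam ^ 2 + C * (4 / lam ^ 2), by positivity, fun v₀ x n hn x' v => ?_⟩
  have hn0 : (0 : ℝ) < n := by exact_mod_cast hn
  set A := (n : ℝ)⁻¹ • gramSum ε c y w α β γ v₀ x n - G ε c μ y w vs with hA
  have hA0 := frobSq_nonneg A
  have hp1 : 0 < (n : ℝ) ^ (-2 : ℝ) := by positivity
  have hp2 : 0 < (n : ℝ) ^ (2 * β - 2) := by positivity
  -- Close to `G`, the Gram matrix keeps coercivity `lam / 2` on zero-sum vectors and the step is of
  -- order `1 / n`. Otherwise `1 ≤ 4 / lam ^ 2 * frobSq A` is inserted in the worst-case bound, a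
  -- pointwise form of Markov's inequality.
  by_cases hcase : frobSq A ≤ (lam / 2) ^ 2
  · have h1 : ∀ u : Fin J → ℝ, lam / 2 * n * ((PJ J *ᵥ u) ⬝ᵥ (PJ J *ᵥ u)) ≤
        u ⬝ᵥ (Smat ε c y w α β γ v₀ x n *ᵥ u) := by
      intro u
      set z := PJ J *ᵥ u with hz
      have h2 := hGle (WithLp.toLp 2 z) ((mem_vJPerp _).2 (sum_PJ_mulVec u))
      rw [norm_sq_eq_dot] at h2
      simp only at h2
      have h3 := quad_sq_le_frobSq A z
      have hz0 := dot_self_nonneg z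
      have h4 : -(lam / 2 * (z ⬝ᵥ z)) ≤ z ⬝ᵥ (A *ᵥ z) := by
        have : (z ⬝ᵥ (A *ᵥ z)) ^ 2 ≤ (lam / 2 * (z ⬝ᵥ z)) ^ 2 := by
          rw [mul_pow]
          exact h3.trans (mul_le_mul_of_nonneg_right hcase (sq_nonneg _))
        exact (abs_le.1 (abs_le_of_sq_le_sq this (by positivity))).1
      rw [hA, Matrix.sub_mulVec, dotProduct_sub, Matrix.smul_mulVec, dotProduct_smul,
        smul_eq_mul] at h4
      have h5 : lam / 2 * (z ⬝ᵥ z) ≤ (n : ℝ)⁻¹ * (z ⬝ᵥ (gramSum ε c y w α β γ v₀ x n *ᵥ z)) := by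
        linarith
      rw [le_inv_mul_iff₀ hn0, hz, D.quad_gramSum_PJ] at h5
      have h6 : 0 ≤ u ⬝ᵥ (regSum w β γ n *ᵥ u) := by
        rw [quad_regSum]
        exact add_nonneg (dot_self_nonneg u) (Finset.sum_nonneg fun k _ =>
          mul_nonneg (regWeight_nonneg hγ k) (sq_nonneg _))
      rw [Smat_eq, Matrix.add_mulVec, dotProduct_add]
      linarith
    have h2 := dot_PJ_inv_mulVec_le (isUnit_det_Smat (ε := ε) (c := c) (y := y) (w := w)
        (α := α) (β := β) hγ v₀ x n) (lam := lam / 2 * n) (by positivity) h1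
      (sum_gradh (c := c) (y := y) D.weight_pos D.weight_sum D.eps_pos x' v)
    have h3 : (n : ℝ) ^ (-2 : ℝ) = ((n : ℝ) ^ 2)⁻¹ := by
      rw [Real.rpow_neg hn0.le]; norm_cast
    refine h2.trans ((div_le_div_of_nonneg_right (D.gradh_dot_self_le x' v)
      (by positivity)).trans ?_)
    have h4 : 2 / (lam / 2 * n) ^ 2 = 8 / lam ^ 2 * (n : ℝ) ^ (-2 : ℝ) := by
      rw [h3]; field_simp; norm_num
    rw [h4]
    have h5 : 0 ≤ 8 / lam ^ 2 := by positivity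
    have h6 : 0 ≤ C * (4 / lam ^ 2) := by positivity
    have h7 : 0 ≤ (n : ℝ) ^ (2 * β - 2) * frobSq A := by positivity
    nlinarith [mul_nonneg h6 (add_nonneg hp1.le h7), mul_nonneg h5 h7]
  · push Not at hcase
    refine (hCle v₀ x n hn _ (sum_gradh D.weight_pos D.weight_sum D.eps_pos x' v)
      ((D.gradh_dot_self_le x' v).trans (by norm_num))).trans ?_
    have h1 : 1 ≤ 4 / lam ^ 2 * frobSq A := by
      rw [div_mul_eq_mul_div, le_div_iff₀ (by positivity)]
      nlinarith
    have h2 : C * (n : ℝ) ^ (2 * β - 2) ≤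
        C * (4 / lam ^ 2) * ((n : ℝ) ^ (2 * β - 2) * frobSq A) := by
      have := mul_le_mul_of_nonneg_left h1 (mul_pos hC hp2).le
      linarith
    have h5 : 0 ≤ 8 / lam ^ 2 := by positivity
    have h6 : 0 ≤ C * (4 / lam ^ 2) := by positivity
    have h7 : 0 ≤ (n : ℝ) ^ (2 * β - 2) * frobSq A := by positivity
    nlinarith [mul_nonneg h5 (add_nonneg hp1.le h7), mul_nonneg h6 hp1.le]

end IsSemiDual

/-! ### Measurability of the algorithm -/

section Measurability

variable {Ω X Y : Type*} {mΩ : MeasurableSpace Ω} [MeasurableSpace X] {J : ℕ} {ε : ℝ}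
  {c : X → Y → ℝ} {μ : Measure X} {y : Fin J → Y} {w : Fin J → ℝ} {α β γ : ℝ}

lemma measurable_det {S : Ω → Matrix (Fin J) (Fin J) ℝ}
    (hS : ∀ i j, Measurable fun ω => S ω i j) : Measurable fun ω => (S ω).det := by
  simp_rw [Matrix.det_apply]
  refine Finset.measurable_sum _ fun σ _ => ?_
  simp_rw [Units.smul_def, zsmul_eq_mul]
  exact (Finset.measurable_prod _ fun i _ => hS _ _).const_mul _

lemma measurable_inv_apply {S : Ω → Matrix (Fin J) (Fin J) ℝ}
    (hS : ∀ i j, Measurable fun ω => S ω i j) (i j : Fin J) :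
    Measurable fun ω => (S ω)⁻¹ i j := by
  simp_rw [Matrix.inv_def, Ring.inverse_eq_inv', Matrix.smul_apply, smul_eq_mul,
    Matrix.adjugate_apply]
  refine (measurable_det hS).inv.mul (measurable_det fun k l => ?_)
  simp_rw [Matrix.updateRow_apply]
  by_cases h : k = j
  · simp [h]
  · simpa [h] using hS k l

lemma measurable_mulVec {S : Ω → Matrix (Fin J) (Fin J) ℝ} {g : Ω → Fin J → ℝ}
    (hS : ∀ i j, Measurable fun ω => S ω i j) (hg : ∀ j, Measurable fun ω => g ω j) (i : Fin J) :
    Measurable fun ω => (S ω *ᵥ g ω) i := by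
  simp only [Matrix.mulVec, dotProduct]
  exact Finset.measurable_sum _ fun j _ => (hS i j).mul (hg j)

lemma measurable_toLp {g : Ω → Fin J → ℝ} (hg : ∀ j, Measurable fun ω => g ω j) :
    Measurable fun ω => WithLp.toLp 2 (g ω) :=
  (PiLp.continuous_toLp 2 _).measurable.comp (measurable_pi_iff.2 hg)

lemma IsSemiDual.measurable_gradh_comp (D : IsSemiDual ε c μ y w) {ξ : Ω → X}
    {V : Ω → EuclideanSpace ℝ (Fin J)} (hξ : Measurable ξ) (hV : Measurable V) (j : Fin J) :
    Measurable fun ω => gradh ε c y w (ξ ω) (V ω) j :=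
  Measurable.comp (g := fun q : X × EuclideanSpace ℝ (Fin J) => gradh ε c y w q.1 q.2 j)
    (f := fun ω => (ξ ω, V ω)) (D.measurable_gradh j) (hξ.prodMk hV)

/-- The σ-algebra is arbitrary and only the observations before `n` are involved, so this applies
both to the ambient σ-algebra and to `past x V₀ n`. -/
lemma IsSemiDual.measurable_sgn (D : IsSemiDual ε c μ y w)
    {V₀ : Ω → EuclideanSpace ℝ (Fin J)} {x : ℕ → Ω → X} (hV₀ : Measurable V₀) (n : ℕ)
    (hx : ∀ k < n, Measurable (x k)) :
    (Measurable fun ω => Vhat ε c y w α β γ (V₀ ω) (fun k => x k ω) n) ∧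
      ∀ i j, Measurable fun ω => Smat ε c y w α β γ (V₀ ω) (fun k => x k ω) n i j := by
  induction n with
  | zero => exact ⟨hV₀, fun i j => measurable_const⟩
  | succ n ih =>
    obtain ⟨ihV, ihS⟩ := ih fun k hk => hx k (hk.trans n.lt_succ_self)
    have hg := D.measurable_gradh_comp (hx n n.lt_succ_self) ihV
    constructor
    · refine measurable_toLp (measurable_mulVec (fun _ _ => measurable_const) fun j => ?_)
      have hVj : Measurable fun ω => Vhat ε c y w α β γ (V₀ ω) (fun k => x k ω) n j := by fun_prop
      exact hVj.sub ((measurable_mulVec (measurable_inv_apply ihS) hg j).const_smul ((n : ℝ) ^ α))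
    · intro i j
      exact ((ihS i j).add ((hg i).mul (hg j))).add measurable_const

end Measurability

/-! ### Sampling -/

/-- The random inputs of the algorithm: an independent sample of law `μ` and an independent
initial value. -/
structure IsSampling {Ω X : Type*} [MeasurableSpace Ω] [MeasurableSpace X] {J : ℕ}
    (P : Measure Ω) (μ : Measure X) (x : ℕ → Ω → X) (V₀ : Ω → EuclideanSpace ℝ (Fin J)) :
    Prop where
  meas : ∀ n, Measurable (x n)
  law : ∀ n, P.map (x n) = μ
  indep : iIndepFun x P
  meas_init : Measurable V₀
  indep_init : IndepFun V₀ (fun ω n => x n ω) P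

/-- The σ-algebra generated by the initial value and the first `n` observations. -/
@[reducible] def past {Ω X : Type*} [MeasurableSpace X] {J : ℕ} (x : ℕ → Ω → X)
    (V₀ : Ω → EuclideanSpace ℝ (Fin J)) (n : ℕ) : MeasurableSpace Ω :=
  MeasurableSpace.comap (fun ω => (V₀ ω, fun i : Finset.range n => x i ω)) inferInstance

section Past

variable {Ω X : Type*} [MeasurableSpace X] {J : ℕ} (x : ℕ → Ω → X)
    (V₀ : Ω → EuclideanSpace ℝ (Fin J))

lemma measurable_past_init (n : ℕ) : Measurable[past x V₀ n] V₀ :=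
  measurable_fst.comp (comap_measurable _)

lemma measurable_past_sample {n k : ℕ} (hk : k < n) : Measurable[past x V₀ n] (x k) :=
  Measurable.comp
    (g := fun q : EuclideanSpace ℝ (Fin J) × (Finset.range n → X) =>
      q.2 ⟨k, Finset.mem_range.2 hk⟩)
    ((measurable_pi_apply _).comp measurable_snd) (comap_measurable _)

end Past

namespace IsSampling

variable {Ω X : Type*} [MeasurableSpace Ω] [MeasurableSpace X] {J : ℕ}
  {P : Measure Ω} [IsProbabilityMeasure P] {μ : Measure X} {x : ℕ → Ω → X}
  {V₀ : Ω → EuclideanSpace ℝ (Fin J)} (A : IsSampling P μ x V₀)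

include A

omit [IsProbabilityMeasure P] in
lemma past_le (n : ℕ) : past x V₀ n ≤ ‹MeasurableSpace Ω› :=
  (A.meas_init.prodMk (measurable_pi_iff.2 fun _ => A.meas _)).comap_le

/-- Independence of `V₀` from the sample, and of `x n` from the earlier observations, factorizes the
law of the triple; reassociating the product measure groups the first two components. -/
lemma indepFun_past (n : ℕ) :
    IndepFun (fun ω => (V₀ ω, fun i : Finset.range n => x i ω)) (x n) P := by
  have hB : Measurable fun ω => fun i : Finset.range n => x i ω :=
    measurable_pi_iff.2 fun i => A.meas _
  have hBC : IndepFun (fun ω => fun i : Finset.range n => x i ω) (x n) P := by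
    have h1 := A.indep.indepFun_finset (Finset.range n) {n} (by simp) A.meas
    exact h1.comp measurable_id
      (measurable_pi_apply (⟨n, Finset.mem_singleton_self n⟩ : ({n} : Finset ℕ)))
  have hA_BC : IndepFun V₀ (fun ω => ((fun i : Finset.range n => x i ω), x n ω)) P :=
    A.indep_init.comp (φ := id)
      (ψ := fun z : ℕ → X => ((fun i : Finset.range n => z i), z n)) measurable_id
      ((measurable_pi_iff.2 fun i => measurable_pi_apply _).prodMk (measurable_pi_apply n))
  have hA_B : IndepFun V₀ (fun ω => fun i : Finset.range n => x i ω) P :=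
    hA_BC.comp measurable_id measurable_fst
  have := fun k => Measure.isProbabilityMeasure_map (μ := P) (A.meas k).aemeasurable
  have := Measure.isProbabilityMeasure_map (μ := P) hB.aemeasurable
  have := Measure.isProbabilityMeasure_map (μ := P) A.meas_init.aemeasurable
  rw [indepFun_iff_map_prod_eq_prod_map_map (A.meas_init.prodMk hB).aemeasurable
    (A.meas n).aemeasurable]
  rw [indepFun_iff_map_prod_eq_prod_map_map A.meas_init.aemeasurable
    (hB.prodMk (A.meas n)).aemeasurable] at hA_BC
  rw [indepFun_iff_map_prod_eq_prod_map_map hB.aemeasurable (A.meas n).aemeasurable] at hBC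
  rw [indepFun_iff_map_prod_eq_prod_map_map A.meas_init.aemeasurable hB.aemeasurable] at hA_B
  rw [hA_B]
  rw [hBC, ← Measure.prodAssoc_prod] at hA_BC
  have h2 := congrArg (Measure.map MeasurableEquiv.prodAssoc.symm) hA_BC
  rw [Measure.map_map MeasurableEquiv.prodAssoc.symm.measurable
      (A.meas_init.prodMk (hB.prodMk (A.meas n))),
    Measure.map_map MeasurableEquiv.prodAssoc.symm.measurable
      MeasurableEquiv.prodAssoc.measurable, MeasurableEquiv.symm_comp_self, Measure.map_id] at h2
  exact h2

lemma indepFun_of_measurable_past {E : Type*} [MeasurableSpace E] {n : ℕ} {U : Ω → E}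
    (hU : Measurable[past x V₀ n] U) : IndepFun U (x n) P := by
  have h1 := A.indepFun_past n
  rw [IndepFun_iff_Indep] at h1 ⊢
  exact indep_of_indep_of_le_left h1 hU.comap_le

/-- Integrating out the last observation. -/
lemma integral_mul_eq {n : ℕ} {a : Ω → ℝ} {V : Ω → EuclideanSpace ℝ (Fin J)}
    (ha : Measurable[past x V₀ n] a) (hV : Measurable[past x V₀ n] V)
    {f : X → EuclideanSpace ℝ (Fin J) → ℝ} (hf : Measurable fun q : X × _ => f q.1 q.2)
    (hint : Integrable (fun ω => a ω * f (x n ω) (V ω)) P) :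
    ∫ ω, a ω * f (x n ω) (V ω) ∂P = ∫ ω, a ω * ∫ z, f z (V ω) ∂μ ∂P := by
  have ha' : Measurable a := ha.mono (A.past_le n) le_rfl
  have hV' : Measurable V := hV.mono (A.past_le n) le_rfl
  have haV : Measurable fun ω => (a ω, V ω) := ha'.prodMk hV'
  have hind := A.indepFun_of_measurable_past (ha.prodMk hV)
  rw [indepFun_iff_map_prod_eq_prod_map_map haV.aemeasurable (A.meas n).aemeasurable,
    A.law n] at hind
  have : IsProbabilityMeasure μ := A.law n ▸
    Measure.isProbabilityMeasure_map (A.meas n).aemeasurable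
  have := Measure.isProbabilityMeasure_map (μ := P) haV.aemeasurable
  let F : (ℝ × EuclideanSpace ℝ (Fin J)) × X → ℝ := fun q => q.1.1 * f q.2 q.1.2
  have hF : Measurable F :=
    (measurable_fst.comp measurable_fst).mul
      (hf.comp (measurable_snd.prodMk (measurable_snd.comp measurable_fst)))
  have hmeas : Measurable fun ω => ((a ω, V ω), x n ω) := haV.prodMk (A.meas n)
  have hFint : Integrable F ((P.map fun ω => (a ω, V ω)).prod μ) := by
    rw [← hind, integrable_map_measure hF.aestronglyMeasurable hmeas.aemeasurable]
    exact hint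
  calc ∫ ω, a ω * f (x n ω) (V ω) ∂P
      = ∫ q, F q ∂(P.map fun ω => ((a ω, V ω), x n ω)) :=
        (integral_map hmeas.aemeasurable hF.aestronglyMeasurable).symm
    _ = ∫ p, ∫ z, F (p, z) ∂μ ∂(P.map fun ω => (a ω, V ω)) := by
        rw [hind, integral_prod _ hFint]
    _ = ∫ ω, ∫ z, F ((a ω, V ω), z) ∂μ ∂P :=
        integral_map haV.aemeasurable hFint.integral_prod_left.aestronglyMeasurable
    _ = _ := by simp only [F, integral_const_mul]

/-- Orthogonality of martingale increments. -/
lemma integral_sum_sq_le {V : ℕ → Ω → EuclideanSpace ℝ (Fin J)}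
    (hV : ∀ n, ∀ k ≤ n, Measurable[past x V₀ n] (V k))
    {f : X → EuclideanSpace ℝ (Fin J) → ℝ} (hf : Measurable fun q : X × _ => f q.1 q.2)
    (hcenter : ∀ v, ∫ z, f z v ∂μ = 0) (hL2 : ∀ n, MemLp (fun ω => f (x n ω) (V n ω)) 2 P)
    (n : ℕ) :
    MemLp (fun ω => ∑ k ∈ Finset.range n, f (x k ω) (V k ω)) 2 P ∧
    ∫ ω, (∑ k ∈ Finset.range n, f (x k ω) (V k ω)) ^ 2 ∂P =
      ∑ k ∈ Finset.range n, ∫ ω, f (x k ω) (V k ω) ^ 2 ∂P := by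
  have hmem : ∀ n, MemLp (fun ω => ∑ k ∈ Finset.range n, f (x k ω) (V k ω)) 2 P := fun n =>
    memLp_finsetSum _ fun k _ => hL2 k
  refine ⟨hmem n, ?_⟩
  induction n with
  | zero => simp
  | succ n ih =>
    have hcross : Integrable (fun ω => (∑ k ∈ Finset.range n, f (x k ω) (V k ω)) *
        f (x n ω) (V n ω)) P := (hmem n).integrable_mul (hL2 n)
    have hzero : ∫ ω, (∑ k ∈ Finset.range n, f (x k ω) (V k ω)) * f (x n ω) (V n ω) ∂P = 0 := by
      rw [A.integral_mul_eq (n := n) _ (hV n n le_rfl) hf hcross]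
      · simp [hcenter]
      · refine Finset.measurable_sum _ fun k hk => ?_
        have hk' := Finset.mem_range.1 hk
        exact hf.comp ((measurable_past_sample x V₀ hk').prodMk (hV n k hk'.le))
    simp_rw [Finset.sum_range_succ]
    rw [← ih]
    have hexp : ∀ ω, (∑ k ∈ Finset.range n, f (x k ω) (V k ω) + f (x n ω) (V n ω)) ^ 2 =
        (∑ k ∈ Finset.range n, f (x k ω) (V k ω)) ^ 2 +
        2 * ((∑ k ∈ Finset.range n, f (x k ω) (V k ω)) * f (x n ω) (V n ω)) +
        f (x n ω) (V n ω) ^ 2 := fun ω => by ring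
    simp_rw [hexp]
    have h1 : Integrable (fun ω => (∑ k ∈ Finset.range n, f (x k ω) (V k ω)) ^ 2 +
        2 * ((∑ k ∈ Finset.range n, f (x k ω) (V k ω)) * f (x n ω) (V n ω))) P :=
      (hmem n).integrable_sq.add (hcross.const_mul 2)
    rw [integral_add h1 (hL2 n).integrable_sq, integral_add (hmem n).integrable_sq
      (hcross.const_mul 2), integral_const_mul, hzero]
    ring

end IsSampling

/-! ### A deterministic recursion -/

lemma rpow_neg_succ_ge {δ : ℝ} (hδ : 0 ≤ δ) {n : ℕ} (hn : 1 ≤ n) :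
    (n : ℝ) ^ (-δ) * (1 - δ / n) ≤ ((n : ℝ) + 1) ^ (-δ) := by
  have hn0 : (0 : ℝ) < n := by exact_mod_cast hn
  have h1 : (n : ℝ) + 1 = n * (1 + 1 / n) := by field_simp
  have h2 : (0 : ℝ) < 1 + 1 / n := by positivity
  rw [h1, Real.mul_rpow hn0.le h2.le]
  refine mul_le_mul_of_nonneg_left ?_ (by positivity)
  rw [Real.rpow_def_of_pos h2]
  have h3 := Real.log_le_sub_one_of_pos h2
  have h4 := Real.add_one_le_exp (Real.log (1 + 1 / (n : ℝ)) * -δ)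
  have h5 : Real.log (1 + 1 / (n : ℝ)) * δ ≤ 1 / n * δ :=
    mul_le_mul_of_nonneg_right (by linarith) hδ
  have h6 : δ / n = 1 / n * δ := by ring
  linarith

/-- A contraction by `1 - c n^(α-1)`, perturbed by negligible terms, forces polynomial decay. -/
lemma exists_le_rpow_of_recursion {x : ℕ → ℝ} (hx : ∀ n, 1 ≤ n → 0 ≤ x n) {c C α δ₁ δ : ℝ}
    (hc : 0 < c) (hC : 0 ≤ C) (hα : 0 < α) (hα1 : α < 1) (hδ₁ : 0 < δ₁) (hδ : 0 < δ)
    (hrec : ∀ n : ℕ, 1 ≤ n → x (n + 1) ≤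
      (1 - c * (n : ℝ) ^ (α - 1) + C * (n : ℝ) ^ (α - 1 - δ₁)) * x n
        + C * (n : ℝ) ^ (α - 1 - δ)) :
    ∃ K > 0, ∀ n : ℕ, 1 ≤ n → x n ≤ K * (n : ℝ) ^ (-δ) := by
  have hlim : ∀ (a s : ℝ), 0 < s → Filter.Tendsto (fun n : ℕ => a * (n : ℝ) ^ (-s))
      Filter.atTop (nhds 0) := fun a s hs => by
    simpa using ((tendsto_rpow_neg_atTop hs).comp tendsto_natCast_atTop_atTop).const_mul a
  -- Eventually the multiplicative perturbation and the one-step decay of `n ^ (-δ)` each use at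
  -- most a quarter of the contraction `c * n ^ (α - 1)`.
  have hev : ∀ᶠ n : ℕ in Filter.atTop, C * (n : ℝ) ^ (-δ₁) ≤ c / 4 ∧ δ * (n : ℝ) ^ (-α) ≤ c / 4 ∧
      c * (n : ℝ) ^ (-(1 - α)) ≤ 1 :=
    ((hlim C δ₁ hδ₁).eventually_le_const (by positivity)).and
      (((hlim δ α hα).eventually_le_const (by positivity)).and
        ((hlim c (1 - α) (by linarith)).eventually_le_const one_pos))
  obtain ⟨N₀, hN₀⟩ := Filter.eventually_atTop.1 hev
  set N := max N₀ 1 with hN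
  -- The first term makes the additive perturbation cost at most another quarter of the contraction,
  -- the sum covers the indices up to `N`, and `1` ensures positivity.
  set K := 4 * C / c + 1 + ∑ k ∈ Finset.range (N + 1), |x k| * (k : ℝ) ^ δ with hK
  have hsum : 0 ≤ ∑ k ∈ Finset.range (N + 1), |x k| * (k : ℝ) ^ δ :=
    Finset.sum_nonneg fun k _ => by positivity
  have h4C : 0 ≤ 4 * C / c := by positivity
  have hK0 : 0 < K := by linarith
  have hsmall : ∀ n : ℕ, 1 ≤ n → n ≤ N → x n ≤ K * (n : ℝ) ^ (-δ) := by
    intro n hn hnN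
    have hn0 : (0 : ℝ) < n := by exact_mod_cast hn
    have h1 := Finset.single_le_sum (f := fun k : ℕ => |x k| * (k : ℝ) ^ δ)
      (fun k _ => by positivity) (Finset.mem_range.2 (Nat.lt_succ_of_le hnN))
    have h2 : |x n| * (n : ℝ) ^ δ ≤ K := by linarith
    rw [Real.rpow_neg hn0.le, ← div_eq_mul_inv, le_div_iff₀ (by positivity)]
    exact (mul_le_mul_of_nonneg_right (le_abs_self _) (by positivity)).trans h2
  refine ⟨K, hK0, fun n hn => ?_⟩
  rcases le_total n N with hnN | hnN
  · exact hsmall n hn hnN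
  induction n, hnN using Nat.le_induction with
  | base => exact hsmall N hn le_rfl
  | succ n hnN ih =>
    have hn1 : 1 ≤ n := (le_max_right _ _).trans hnN
    have hn0 : (0 : ℝ) < n := by exact_mod_cast hn1
    obtain ⟨e1, e2, e3⟩ := hN₀ n ((le_max_left _ _).trans hnN)
    have ihn := ih hn1
    set a := (n : ℝ) ^ (α - 1) with ha
    set p := (n : ℝ) ^ (-δ) with hp
    have ha0 : 0 < a := by positivity
    have hp0 : 0 < p := by positivity
    have f1 : (n : ℝ) ^ (α - 1 - δ₁) = a * (n : ℝ) ^ (-δ₁) := by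
      rw [sub_eq_add_neg, Real.rpow_add hn0]
    have f2 : (n : ℝ) ^ (α - 1 - δ) = a * p := by
      rw [sub_eq_add_neg, Real.rpow_add hn0]
    have f3 : δ / n = a * (δ * (n : ℝ) ^ (-α)) := by
      rw [ha, mul_left_comm, ← Real.rpow_add hn0]
      have : α - 1 + -α = -1 := by ring
      rw [this, Real.rpow_neg_one, div_eq_mul_inv]
    have f4 : c * a ≤ 1 := by
      rw [ha, show α - 1 = -(1 - α) by ring]; exact e3
    have g1 : C * (n : ℝ) ^ (α - 1 - δ₁) ≤ c / 4 * a := by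
      rw [f1]; nlinarith
    have g3 : δ / n ≤ c / 4 * a := by
      rw [f3]; nlinarith
    have h1 := hrec n hn1
    have h2 : (1 - c * a + C * (n : ℝ) ^ (α - 1 - δ₁)) * x n ≤ (1 - 3 / 4 * (c * a)) * (K * p) := by
      have : (1 - c * a + C * (n : ℝ) ^ (α - 1 - δ₁)) * x n ≤ (1 - 3 / 4 * (c * a)) * x n :=
        mul_le_mul_of_nonneg_right (by linarith) (hx n hn1)
      exact this.trans (mul_le_mul_of_nonneg_left ihn (by linarith))
    have h3 := rpow_neg_succ_ge hδ.le hn1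
    have h4 : p * (1 - c / 4 * a) ≤ ((n : ℝ) + 1) ^ (-δ) :=
      le_trans (mul_le_mul_of_nonneg_left (by linarith) hp0.le) h3
    have h5 : 4 * C ≤ K * c := by
      have : 4 * C / c ≤ K := by linarith
      rwa [div_le_iff₀ hc] at this
    rw [f2] at h1
    push_cast
    have h6 := mul_le_mul_of_nonneg_left h4 hK0.le
    have h7 : C * (a * p) ≤ K * c / 4 * (a * p) :=
      mul_le_mul_of_nonneg_right (by linarith) (mul_pos ha0 hp0).le
    nlinarith [mul_pos (mul_pos hK0 hc) (mul_pos ha0 hp0)]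

/-! ### The exponential Lyapunov function -/

/-- The excess `H_ε(v) - H_ε(vs)`. -/
def excess {X Y : Type*} [MeasurableSpace X] {J : ℕ} (ε : ℝ) (c : X → Y → ℝ) (μ : Measure X)
    (y : Fin J → Y) (w : Fin J → ℝ) (vs v : EuclideanSpace ℝ (Fin J)) : ℝ :=
  H ε c μ y w v - H ε c μ y w vs

namespace IsSemiDual

section Lyapunov

variable {X Y : Type*} [MeasurableSpace X] {J : ℕ} {ε : ℝ} {c : X → Y → ℝ} {μ : Measure X}
  [IsProbabilityMeasure μ] {y : Fin J → Y} {w : Fin J → ℝ} (D : IsSemiDual ε c μ y w)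
  {vs : EuclideanSpace ℝ (Fin J)}

include D

lemma measurable_H : Measurable (H ε c μ y w) := D.continuous_H.measurable

lemma measurable_excess : Measurable (excess ε c μ y w vs) := D.measurable_H.sub_const _

lemma measurable_gradH (j : Fin J) : Measurable fun v => gradH ε c μ y w v j := by
  have h1 : Measurable fun q : EuclideanSpace ℝ (Fin J) × X => gradh ε c y w q.2 q.1 j :=
    Measurable.comp (g := fun q : X × EuclideanSpace ℝ (Fin J) => gradh ε c y w q.1 q.2 j)
      (f := Prod.swap) (D.measurable_gradh j) measurable_swap
  exact (h1.stronglyMeasurable.integral_prod_right' (ν := μ)).measurable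

lemma excess_add_le (v d : EuclideanSpace ℝ (Fin J)) :
    excess ε c μ y w vs (v + d) ≤ excess ε c μ y w vs v + 2 * ‖d‖ := by
  have := (abs_le.1 (D.abs_H_sub_le (v + d) v)).2
  rw [add_sub_cancel_left] at this
  unfold excess
  linarith

lemma excess_le (v : EuclideanSpace ℝ (Fin J)) :
    excess ε c μ y w vs v ≤ 2 * ‖v - vs‖ := (abs_le.1 (D.abs_H_sub_le v vs)).2

/-- Smoothness of `H` makes the increment of the excess at most a linear term plus `O(‖d‖ ^ 2)`; for
bounded `d` the exponential of this is expanded to second order. -/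
lemma exists_exp_excess_add_le (vs : EuclideanSpace ℝ (Fin J)) {t : ℝ} (ht : 0 < t) {B : ℝ}
    (hB : 0 < B) :
    ∃ C > 0, ∀ v d : EuclideanSpace ℝ (Fin J), ‖d‖ ≤ B →
      Real.exp (t * excess ε c μ y w vs (v + d)) ≤ Real.exp (t * excess ε c μ y w vs v) *
        (1 + t * ∑ j, gradH ε c μ y w v j * d j + C * ‖d‖ ^ 2) := by
  set K := Real.exp (B / ε) / ε with hK
  have hK0 : 0 < K := div_pos (Real.exp_pos _) D.eps_pos
  set L := t * (2 + K * B) with hL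
  have hL0 : 0 < L := by positivity
  refine ⟨t * K + Real.exp (L * B) * L ^ 2, by positivity, fun v d hd => ?_⟩
  set i := ∑ j, gradH ε c μ y w v j * d j with hi
  have hd0 := norm_nonneg d
  have h1 : excess ε c μ y w vs (v + d) ≤ excess ε c μ y w vs v + (i + K * ‖d‖ ^ 2) := by
    have := D.H_add_le v d hd
    unfold excess
    linarith
  have hi2 : |i| ≤ 2 * ‖d‖ := by
    rw [hi, sum_gradH_mul_eq_inner]
    exact (abs_real_inner_le_norm _ _).trans
      (mul_le_mul_of_nonneg_right (D.norm_gradH_le v) hd0)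
  have hz : |t * (i + K * ‖d‖ ^ 2)| ≤ L * ‖d‖ := by
    rw [abs_mul, abs_of_pos ht, hL, mul_assoc]
    refine mul_le_mul_of_nonneg_left ((abs_add_le _ _).trans ?_) ht.le
    rw [abs_of_nonneg (by positivity : 0 ≤ K * ‖d‖ ^ 2)]
    nlinarith [mul_le_mul_of_nonneg_left hd (mul_nonneg hK0.le hd0)]
  have h2 := exp_le_quadratic (hz.trans (mul_le_mul_of_nonneg_left hd hL0.le))
  have h3 : (t * (i + K * ‖d‖ ^ 2)) ^ 2 ≤ L ^ 2 * ‖d‖ ^ 2 := by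
    rw [← sq_abs, ← mul_pow]
    exact pow_le_pow_left₀ (abs_nonneg _) hz 2
  have h4 := mul_le_mul_of_nonneg_left h3 (Real.exp_pos (L * B)).le
  calc Real.exp (t * excess ε c μ y w vs (v + d))
      ≤ Real.exp (t * excess ε c μ y w vs v + t * (i + K * ‖d‖ ^ 2)) :=
        Real.exp_le_exp.2 (by nlinarith)
    _ = Real.exp (t * excess ε c μ y w vs v) * Real.exp (t * (i + K * ‖d‖ ^ 2)) :=
        Real.exp_add _ _
    _ ≤ _ := mul_le_mul_of_nonneg_left (by linarith) (Real.exp_pos _).le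

variable (hmin : ∀ v, H ε c μ y w vs ≤ H ε c μ y w v)

include hmin

omit [IsProbabilityMeasure μ] D in
lemma excess_nonneg (v : EuclideanSpace ℝ (Fin J)) : 0 ≤ excess ε c μ y w vs v :=
  sub_nonneg.2 (hmin v)

/-- The reason for the exponential: the gradient only controls `min s 1`, but multiplication by `exp
(t * s)` restores control of the whole Lyapunov function. -/
lemma exists_exp_mul_gradH_ge (hvs : ∑ j, vs j = 0) {t : ℝ} (ht1 : t ≤ 1) :
    ∃ κ > 0, ∀ v : EuclideanSpace ℝ (Fin J), ∑ j, v j = 0 →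
      κ * (Real.exp (t * excess ε c μ y w vs v) - 1) ≤
        Real.exp (t * excess ε c μ y w vs v) * ‖gradH ε c μ y w v‖ ^ 2 := by
  obtain ⟨κ, hκ, hle⟩ := D.exists_lojasiewicz hmin
  refine ⟨κ, hκ, fun v hv => ?_⟩
  have hu : ∑ j, (v - vs) j = 0 := by
    simp [Finset.sum_sub_distrib, hv, hvs]
  have h1 := (hle (v - vs) hu).2
  rw [add_sub_cancel] at h1
  change κ * min (excess ε c μ y w vs v) 1 ≤ _ at h1
  have hs0 := excess_nonneg hmin v
  set s := excess ε c μ y w vs v with hs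
  have h2 : Real.exp (t * s) - 1 ≤ Real.exp (t * s) * min s 1 := by
    rcases le_total s 1 with h | h
    · rw [min_eq_left h]
      -- Here `t ≤ 1` enters, through `1 - s ≤ 1 - t * s`.
      have h3 : 1 - s ≤ Real.exp (-(t * s)) := by
        nlinarith [Real.add_one_le_exp (-(t * s))]
      have h4 := mul_le_mul_of_nonneg_left h3 (Real.exp_pos (t * s)).le
      rw [← Real.exp_add, add_neg_cancel, Real.exp_zero] at h4
      linarith
    · rw [min_eq_right h]; linarith
  have h5 := mul_le_mul_of_nonneg_left h1 (Real.exp_pos (t * s)).le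
  nlinarith [mul_le_mul_of_nonneg_left h2 hκ.le]

/-- The quantity `exp (t * s) - 1` dominates both `s` and `s ^ 2`: the former matches the quadratic
growth of the excess near `vs`, the latter its linear growth far away. -/
lemma exists_norm_sq_le_exp (hvs : ∑ j, vs j = 0) {t : ℝ} (ht : 0 < t) :
    ∃ C > 0, ∀ v : EuclideanSpace ℝ (Fin J), ∑ j, v j = 0 →
      ‖v - vs‖ ^ 2 ≤ C * (Real.exp (t * excess ε c μ y w vs v) - 1) := by
  obtain ⟨κ, hκ, hle⟩ := D.exists_lojasiewicz hmin
  refine ⟨2 / (κ * t) + 8 / (κ * t) ^ 2, by positivity, fun v hv => ?_⟩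
  have hu : ∑ j, (v - vs) j = 0 := by
    simp [Finset.sum_sub_distrib, hv, hvs]
  have h1 := (hle (v - vs) hu).1
  rw [add_sub_cancel] at h1
  change _ ≤ excess ε c μ y w vs v at h1
  have hs0 := excess_nonneg hmin v
  set s := excess ε c μ y w vs v with hs
  set r := ‖v - vs‖ with hr
  have hr0 : 0 ≤ r := norm_nonneg _
  have hts : 0 ≤ t * s := by positivity
  have e1 := Real.add_one_le_exp (t * s)
  have e2 := Real.quadratic_le_exp_of_nonneg hts
  have hκt : 0 < κ * t := by positivity
  have h2 : κ * t * (r ^ 2 / (1 + r)) ≤ t * s := by nlinarith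
  rcases le_total r 1 with h | h
  · have h3 : r ^ 2 / 2 ≤ r ^ 2 / (1 + r) :=
      div_le_div_of_nonneg_left (by positivity) (by positivity) (by linarith)
    have h4 : κ * t * r ^ 2 ≤ 2 * (t * s) := by nlinarith
    have h5 : r ^ 2 ≤ 2 / (κ * t) * (Real.exp (t * s) - 1) := by
      rw [div_mul_eq_mul_div, le_div_iff₀ hκt]; linarith
    have h6 : 0 ≤ 8 / (κ * t) ^ 2 * (Real.exp (t * s) - 1) :=
      mul_nonneg (by positivity) (by linarith)
    linarith
  · have h3 : r / 2 ≤ r ^ 2 / (1 + r) := by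
      rw [div_le_div_iff₀ (by norm_num) (by positivity)]; nlinarith
    have h4 : κ * t * r ≤ 2 * (t * s) := by nlinarith
    have h4' : (κ * t * r) ^ 2 ≤ (2 * (t * s)) ^ 2 := pow_le_pow_left₀ (by positivity) h4 2
    have h5 : r ^ 2 ≤ 8 / (κ * t) ^ 2 * (Real.exp (t * s) - 1) := by
      rw [div_mul_eq_mul_div, le_div_iff₀ (by positivity)]; nlinarith
    have h6 : 0 ≤ 2 / (κ * t) * (Real.exp (t * s) - 1) :=
      mul_nonneg (by positivity) (by linarith)
    linarith

end Lyapunov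

end IsSemiDual

/-! ### One step of the algorithm -/

section Direction

variable {X Y : Type*} {J : ℕ} {ε : ℝ} {c : X → Y → ℝ} {y : Fin J → Y} {w : Fin J → ℝ}
  {α β γ : ℝ} {v₀ : EuclideanSpace ℝ (Fin J)} {x : ℕ → X}

lemma dot_direction [NeZero J] {u : Fin J → ℝ} (hu : ∑ j, u j = 0) (n : ℕ) (g : Fin J → ℝ) :
    u ⬝ᵥ direction ε c y w α β γ v₀ x n g = u ⬝ᵥ ((Smat ε c y w α β γ v₀ x n)⁻¹ *ᵥ g) :=
  dot_PJ_mulVec hu _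

/-- By symmetry of `S_n` the preconditioner can be moved from the new sample gradient to a vector
known from the past, which prepares the conditioning. -/
lemma dot_direction_comm [NeZero J] {u g : Fin J → ℝ} (hu : ∑ j, u j = 0) (hg : ∑ j, g j = 0)
    (n : ℕ) : u ⬝ᵥ direction ε c y w α β γ v₀ x n g =
      direction ε c y w α β γ v₀ x n u ⬝ᵥ g := by
  rw [dot_direction hu, dotProduct_comm _ g, dot_direction hg, Matrix.dotProduct_mulVec,
    ← Matrix.mulVec_transpose, Matrix.transpose_nonsing_inv, transpose_Smat, dotProduct_comm]

end Direction

namespace IsSemiDual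

variable {Ω X Y : Type*} [MeasurableSpace Ω] [MeasurableSpace X] {J : ℕ} {ε : ℝ} {c : X → Y → ℝ}
  {μ : Measure X} [IsProbabilityMeasure μ] {y : Fin J → Y} {w : Fin J → ℝ}
  (D : IsSemiDual ε c μ y w) {vs : EuclideanSpace ℝ (Fin J)}
  {P : Measure Ω} [IsProbabilityMeasure P] {x : ℕ → Ω → X} {V₀ : Ω → EuclideanSpace ℝ (Fin J)}
  (A : IsSampling P μ x V₀) {α β γ : ℝ}

local notation "V⟦" n ", " ω "⟧" => Vhat ε c y w α β γ (V₀ ω) (fun k => x k ω) n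
local notation "dir⟦" n ", " ω "⟧" => direction ε c y w α β γ (V₀ ω) (fun k => x k ω) n

include D A

omit [IsProbabilityMeasure μ] [IsProbabilityMeasure P] in
lemma measurable_Vhat (n : ℕ) : Measurable fun ω => V⟦n, ω⟧ :=
  (D.measurable_sgn A.meas_init n fun k _ => A.meas k).1

omit [IsProbabilityMeasure μ] [MeasurableSpace Ω] A in
lemma measurable_past_Vhat {k n : ℕ} (hk : k ≤ n) : Measurable[past x V₀ n] fun ω => V⟦k, ω⟧ :=
  (D.measurable_sgn (measurable_past_init x V₀ n) k
    fun _ hi => measurable_past_sample x V₀ (hi.trans_le hk)).1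

omit A [MeasurableSpace Ω] in
lemma measurable_past_direction_gradH (n : ℕ) (j : Fin J) :
    Measurable[past x V₀ n] fun ω => dir⟦n, ω⟧ (gradH ε c μ y w V⟦n, ω⟧).ofLp j := by
  have hV := D.measurable_past_Vhat (x := x) (V₀ := V₀) (α := α) (β := β) (γ := γ) (le_refl n)
  have hS := (D.measurable_sgn (α := α) (β := β) (γ := γ) (measurable_past_init x V₀ n) n
    fun _ hi => measurable_past_sample x V₀ hi).2
  have hg : ∀ k, Measurable[past x V₀ n] fun ω => gradH ε c μ y w V⟦n, ω⟧ k := fun k =>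
    Measurable.comp (g := fun v => gradH ε c μ y w v k) (D.measurable_gradH k) hV
  exact measurable_mulVec (S := fun _ => PJ J)
    (g := fun ω => (Smat ε c y w α β γ (V₀ ω) (fun k => x k ω) n)⁻¹ *ᵥ
      (gradH ε c μ y w V⟦n, ω⟧).ofLp) (fun _ _ => measurable_const)
    (measurable_mulVec (measurable_inv_apply hS) hg) j

omit [IsProbabilityMeasure P] in
lemma measurable_exp_excess (t : ℝ) (n : ℕ) :
    Measurable fun ω => Real.exp (t * excess ε c μ y w vs V⟦n, ω⟧) :=
  (Measurable.const_mul (Measurable.comp D.measurable_excess (D.measurable_Vhat A n)) t).exp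

/-- Expand the Lyapunov function along the step and integrate out the new observation: the linear
term becomes a preconditioned squared gradient of `H`, at least of order `1 / n`. The bound `q` on
the squared step is left free because it is chosen differently in the two passes. -/
lemma lyapunov_step (hα : 0 < α) (hβ : 0 < β) (hαβ : α + β ≤ 1) (hγ : 0 < γ)
    (hmin : ∀ v, H ε c μ y w vs ≤ H ε c μ y w v) (hvs : ∑ j, vs j = 0)
    {t : ℝ} (ht : 0 < t) (ht1 : t ≤ 1) {Q : ℝ} (hQ : 0 < Q)
    (hdir : ∀ v₀ x, ∀ n : ℕ, 1 ≤ n → ∀ g : Fin J → ℝ, ∑ j, g j = 0 → g ⬝ᵥ g ≤ 4 →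
      direction ε c y w α β γ v₀ x n g ⬝ᵥ direction ε c y w α β γ v₀ x n g ≤
        Q * (n : ℝ) ^ (2 * β - 2)) :
    ∃ κ > 0, ∃ C > 0, ∀ n : ℕ, 1 ≤ n →
      Integrable (fun ω => Real.exp (t * excess ε c μ y w vs V⟦n, ω⟧)) P →
      ∀ q : Ω → ℝ, Measurable q → (∀ ω, (n : ℝ) ^ (2 * α) *
        (dir⟦n, ω⟧ (gradh ε c y w (x n ω) V⟦n, ω⟧).ofLp ⬝ᵥ
          dir⟦n, ω⟧ (gradh ε c y w (x n ω) V⟦n, ω⟧).ofLp) ≤ q ω) →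
      (∀ ω, q ω ≤ Q * (n : ℝ) ^ (2 * α + 2 * β - 2)) →
      Integrable (fun ω => Real.exp (t * excess ε c μ y w vs V⟦n + 1, ω⟧)) P ∧
      ∫ ω, Real.exp (t * excess ε c μ y w vs V⟦n + 1, ω⟧) ∂P - 1 ≤
        (1 - κ * (n : ℝ) ^ (α - 1) + C * (n : ℝ) ^ (2 * α + 2 * β - 2)) *
          (∫ ω, Real.exp (t * excess ε c μ y w vs V⟦n, ω⟧) ∂P - 1) + C * ∫ ω, q ω ∂P := by
  have := D.neZero
  obtain ⟨κ, hκ, hκle⟩ := D.exists_exp_mul_gradH_ge hmin hvs ht1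
  -- The squared step is at most `Q`, so its norm is at most `Q + 1`.
  obtain ⟨C, hC, hCle⟩ := D.exists_exp_excess_add_le vs ht (B := Q + 1) (by linarith)
  refine ⟨t * (κ / (3 + γ)), by positivity, C * (Q + 1), by positivity,
    fun n hn hint q hqm hqle hqQ => ?_⟩
  have hn0 : (0 : ℝ) < n := by exact_mod_cast hn
  have hn1 : (1 : ℝ) ≤ n := by exact_mod_cast hn
  set e : Ω → ℝ := fun ω => Real.exp (t * excess ε c μ y w vs V⟦n, ω⟧) with he
  set e' : Ω → ℝ := fun ω => Real.exp (t * excess ε c μ y w vs V⟦n + 1, ω⟧) with he'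
  set r := (n : ℝ) ^ (2 * α + 2 * β - 2) with hr
  have hr0 : 0 < r := by positivity
  have hr1 : r ≤ 1 := Real.rpow_le_one_of_one_le_of_nonpos hn1 (by linarith)
  have he0 : ∀ ω, 0 < e ω := fun ω => Real.exp_pos _
  have he1 : ∀ ω, 1 ≤ e ω := fun ω =>
    Real.one_le_exp (mul_nonneg ht.le (excess_nonneg hmin _))
  have hem : Measurable e := D.measurable_exp_excess A t n
  have he'm : Measurable e' := D.measurable_exp_excess A t (n + 1)
  have hq0 : ∀ ω, 0 ≤ q ω := fun ω =>
    (mul_nonneg (by positivity) (dot_self_nonneg _)).trans (hqle ω)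
  have hqQ' : ∀ ω, q ω ≤ Q := fun ω => (hqQ ω).trans (by nlinarith)
  have hV0 : ∀ ω, ∑ j, V⟦n, ω⟧ j = 0 := fun ω => sum_Vhat ε c y w α β γ _ _ hn
  let d : Ω → EuclideanSpace ℝ (Fin J) := fun ω =>
    WithLp.toLp 2 (-((n : ℝ) ^ α • dir⟦n, ω⟧ (gradh ε c y w (x n ω) V⟦n, ω⟧).ofLp))
  have hVd : ∀ ω, V⟦n + 1, ω⟧ = V⟦n, ω⟧ + d ω := fun ω =>
    Vhat_succ ε c y w α β γ _ _ (hV0 ω)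
  have hdsq : ∀ ω, ‖d ω‖ ^ 2 ≤ q ω := fun ω => by
    refine le_trans (le_of_eq ?_) (hqle ω)
    have h1 : (n : ℝ) ^ (2 * α) = (n : ℝ) ^ α * (n : ℝ) ^ α := by
      rw [← Real.rpow_add hn0]; ring_nf
    rw [norm_sq_eq_dot, h1]
    simp only [d, neg_dotProduct, dotProduct_neg, smul_dotProduct, dotProduct_smul,
      smul_eq_mul]
    ring
  have hdB : ∀ ω, ‖d ω‖ ≤ Q + 1 := fun ω => by
    have := (hdsq ω).trans (hqQ' ω)
    nlinarith [norm_nonneg (d ω)]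
  -- The factor of the `j`-th coordinate of the new sample gradient; it is measurable with respect
  -- to the past.
  let a : Fin J → Ω → ℝ := fun j ω => e ω * dir⟦n, ω⟧ (gradH ε c μ y w V⟦n, ω⟧).ofLp j
  have ham : ∀ j, Measurable[past x V₀ n] (a j) := fun j =>
    Measurable.mul (Measurable.exp (Measurable.const_mul
      (Measurable.comp D.measurable_excess (D.measurable_past_Vhat le_rfl)) t))
      (D.measurable_past_direction_gradH n j)
  have hVm := D.measurable_Vhat (α := α) (β := β) (γ := γ) A n
  have hsumH := fun ω => D.sum_gradH V⟦n, ω⟧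
  have hsumg := fun ω => sum_gradh (c := c) (y := y) D.weight_pos D.weight_sum D.eps_pos
    (x n ω) V⟦n, ω⟧
  have hHH : ∀ ω, (gradH ε c μ y w V⟦n, ω⟧).ofLp ⬝ᵥ (gradH ε c μ y w V⟦n, ω⟧).ofLp ≤ 4 := by
    intro ω
    rw [← norm_sq_eq_dot]
    nlinarith [D.norm_gradH_le V⟦n, ω⟧, norm_nonneg (gradH ε c μ y w V⟦n, ω⟧)]
  have ha_le : ∀ j ω, |a j ω| ≤ (Q + 1) * e ω := by
    intro j ω
    have h1 := hdir (V₀ ω) (fun k => x k ω) n hn _ (hsumH ω) (hHH ω)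
    have h2 : dir⟦n, ω⟧ (gradH ε c μ y w V⟦n, ω⟧).ofLp j ^ 2 ≤ Q := by
      have h3 : (n : ℝ) ^ (2 * β - 2) ≤ 1 :=
        Real.rpow_le_one_of_one_le_of_nonpos hn1 (by linarith)
      have h4 := Finset.single_le_sum
        (f := fun j => dir⟦n, ω⟧ (gradH ε c μ y w V⟦n, ω⟧).ofLp j *
          dir⟦n, ω⟧ (gradH ε c μ y w V⟦n, ω⟧).ofLp j)
        (fun j _ => mul_self_nonneg _) (Finset.mem_univ j)
      rw [sq]
      exact h4.trans (h1.trans (by nlinarith))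
    have h3 : |dir⟦n, ω⟧ (gradH ε c μ y w V⟦n, ω⟧).ofLp j| ≤ Q + 1 :=
      abs_le_of_sq_le_sq (by nlinarith) (by linarith)
    simp only [a]
    rw [abs_mul, abs_of_pos (he0 ω), mul_comm]
    exact mul_le_mul_of_nonneg_right h3 (he0 ω).le
  have hag_int : ∀ j, Integrable (fun ω => a j ω * gradh ε c y w (x n ω) V⟦n, ω⟧ j) P := fun j => by
    refine (hint.const_mul (Q + 1)).mono'
      (((ham j).mono (A.past_le n) le_rfl).mul
        (D.measurable_gradh_comp (A.meas n) hVm j)).aestronglyMeasurable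
      (Filter.Eventually.of_forall fun ω => ?_)
    rw [Real.norm_eq_abs, abs_mul]
    have h1 := abs_gradh_apply_le (c := c) (y := y) D.weight_pos D.weight_sum D.eps_pos
      (x n ω) V⟦n, ω⟧ j
    calc _ ≤ |a j ω| * 1 := mul_le_mul_of_nonneg_left h1 (abs_nonneg _)
      _ ≤ _ := by rw [mul_one]; exact ha_le j ω
  have haH_int : ∀ j, Integrable (fun ω => a j ω * gradH ε c μ y w V⟦n, ω⟧ j) P := fun j => by
    refine ((hint.const_mul (Q + 1)).mul_const 2).mono'
      (((ham j).mono (A.past_le n) le_rfl).mul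
        (Measurable.comp (D.measurable_gradH j) hVm)).aestronglyMeasurable
      (Filter.Eventually.of_forall fun ω => ?_)
    rw [Real.norm_eq_abs, abs_mul]
    exact mul_le_mul (ha_le j ω) ((abs_apply_le_norm _ j).trans (D.norm_gradH_le _))
      (abs_nonneg _) (mul_nonneg (by linarith) (he0 ω).le)
  have heq_int : Integrable (fun ω => e ω * q ω) P := by
    refine (hint.mul_const Q).mono' (hem.mul hqm).aestronglyMeasurable
      (Filter.Eventually.of_forall fun ω => ?_)
    rw [Real.norm_of_nonneg (mul_nonneg (he0 ω).le (hq0 ω))]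
    exact mul_le_mul_of_nonneg_left (hqQ' ω) (he0 ω).le
  have hq_int : Integrable q P :=
    Integrable.of_bound hqm.aestronglyMeasurable Q (Filter.Eventually.of_forall fun ω => by
      rw [Real.norm_of_nonneg (hq0 ω)]; exact hqQ' ω)
  have hint' : Integrable e' P := by
    refine (hint.mul_const (Real.exp (t * (2 * (Q + 1))))).mono' he'm.aestronglyMeasurable
      (Filter.Eventually.of_forall fun ω => ?_)
    simp only [he', he]
    rw [Real.norm_of_nonneg (Real.exp_pos _).le, ← Real.exp_add, ← mul_add, hVd]
    refine Real.exp_le_exp.2 (mul_le_mul_of_nonneg_left ?_ ht.le)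
    have h1 := D.excess_add_le (vs := vs) V⟦n, ω⟧ (d ω)
    linarith [hdB ω]
  refine ⟨hint', ?_⟩
  have hpt : ∀ ω, e' ω ≤ e ω + C * (e ω * q ω) -
      t * (n : ℝ) ^ α * ∑ j, a j ω * gradh ε c y w (x n ω) V⟦n, ω⟧ j := by
    intro ω
    have h1 := hCle V⟦n, ω⟧ (d ω) (hdB ω)
    rw [← hVd] at h1
    have h2 : ∑ j, gradH ε c μ y w V⟦n, ω⟧ j * d ω j = -((n : ℝ) ^ α *
        (dir⟦n, ω⟧ (gradH ε c μ y w V⟦n, ω⟧).ofLp ⬝ᵥ (gradh ε c y w (x n ω) V⟦n, ω⟧).ofLp)) := by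
      rw [← dot_direction_comm (hsumH ω) (hsumg ω)]
      change (gradH ε c μ y w V⟦n, ω⟧).ofLp ⬝ᵥ (d ω).ofLp = _
      simp only [d, dotProduct_neg, dotProduct_smul, smul_eq_mul]
    have h3 : ∑ j, a j ω * gradh ε c y w (x n ω) V⟦n, ω⟧ j = e ω *
        (dir⟦n, ω⟧ (gradH ε c μ y w V⟦n, ω⟧).ofLp ⬝ᵥ (gradh ε c y w (x n ω) V⟦n, ω⟧).ofLp) := by
      rw [dotProduct, Finset.mul_sum]
      exact Finset.sum_congr rfl fun j _ => by simp only [a]; ring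
    rw [h2] at h1
    rw [h3]
    have h4 : e ω * (C * ‖d ω‖ ^ 2) ≤ e ω * (C * q ω) :=
      mul_le_mul_of_nonneg_left (mul_le_mul_of_nonneg_left (hdsq ω) hC.le) (he0 ω).le
    refine h1.trans ?_
    change e ω * _ ≤ _
    linarith
  have hsum_int : Integrable (fun ω => ∑ j, a j ω * gradh ε c y w (x n ω) V⟦n, ω⟧ j) P :=
    integrable_finsetSum _ fun j _ => hag_int j
  have hmain_int : Integrable (fun ω => e ω + C * (e ω * q ω)) P :=
    hint.add (heq_int.const_mul C)
  have hmono := integral_mono hint' (hmain_int.sub (hsum_int.const_mul (t * (n : ℝ) ^ α))) hpt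
  rw [integral_sub' hmain_int (hsum_int.const_mul _), integral_const_mul,
    integral_add hint (heq_int.const_mul C), integral_const_mul,
    integral_finsetSum _ fun j _ => hag_int j] at hmono
  have hswap : ∀ j, ∫ ω, a j ω * gradh ε c y w (x n ω) V⟦n, ω⟧ j ∂P =
      ∫ ω, a j ω * gradH ε c μ y w V⟦n, ω⟧ j ∂P := fun j =>
    A.integral_mul_eq (ham j) (D.measurable_past_Vhat le_rfl)
      (f := fun z v => gradh ε c y w z v j) (D.measurable_gradh j) (hag_int j)
  simp_rw [hswap] at hmono
  rw [← integral_finsetSum _ fun j _ => haH_int j] at hmono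
  have he_int : Integrable (fun ω => e ω - 1) P := hint.sub (integrable_const _)
  have hlow : κ / ((3 + γ) * n) * (∫ ω, e ω ∂P - 1) ≤
      ∫ ω, ∑ j, a j ω * gradH ε c μ y w V⟦n, ω⟧ j ∂P := by
    have h1 : κ / ((3 + γ) * n) * (∫ ω, e ω ∂P - 1) =
        ∫ ω, κ / ((3 + γ) * n) * (e ω - 1) ∂P := by
      rw [integral_const_mul, integral_sub hint (integrable_const _)]
      simp
    rw [h1]
    refine integral_mono (he_int.const_mul _)
      (integrable_finsetSum _ fun j _ => haH_int j) fun ω => ?_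
    have h2 : ∑ j, a j ω * gradH ε c μ y w V⟦n, ω⟧ j = e ω *
        ((gradH ε c μ y w V⟦n, ω⟧).ofLp ⬝ᵥ dir⟦n, ω⟧ (gradH ε c μ y w V⟦n, ω⟧).ofLp) := by
      rw [dotProduct, Finset.mul_sum]
      exact Finset.sum_congr rfl fun j _ => by simp only [a]; ring
    have h3 := D.dot_inv_Smat_ge (α := α) hβ hγ (V₀ ω) (fun k => x k ω) hn
      (gradH ε c μ y w V⟦n, ω⟧).ofLp
    rw [← dot_direction (hsumH ω), ← norm_sq_eq_dot] at h3
    have h4 := hκle V⟦n, ω⟧ (hV0 ω)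
    simp only
    rw [h2]
    refine le_trans ?_ (mul_le_mul_of_nonneg_left h3 (he0 ω).le)
    have hpos : 0 < (3 + γ) * n := by positivity
    rw [div_mul_eq_mul_div, mul_div_assoc']
    exact div_le_div_of_nonneg_right h4 hpos.le
  -- Writing `e = (e - 1) + 1`, the deterministic bound on `q` is spent on `e - 1`, a small multiple
  -- of the Lyapunov function, and only the mean of `q` enters as noise.
  have heq_le : ∫ ω, e ω * q ω ∂P ≤ Q * r * (∫ ω, e ω ∂P - 1) + ∫ ω, q ω ∂P := by
    have h1 : Q * r * (∫ ω, e ω ∂P - 1) + ∫ ω, q ω ∂P = ∫ ω, (Q * r * (e ω - 1) + q ω) ∂P := by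
      rw [integral_add (he_int.const_mul _) hq_int, integral_const_mul,
        integral_sub hint (integrable_const _)]
      simp
    rw [h1]
    refine integral_mono heq_int ((he_int.const_mul _).add hq_int)
      fun ω => ?_
    have := mul_le_mul_of_nonneg_right (hqQ ω) (sub_nonneg.2 (he1 ω))
    simp only
    linarith
  have hF0 : 0 ≤ ∫ ω, e ω ∂P - 1 := by
    have h1 : ∫ ω, e ω ∂P - 1 = ∫ ω, (e ω - 1) ∂P := by
      rw [integral_sub hint (integrable_const _)]; simp
    rw [h1]
    exact integral_nonneg fun ω => sub_nonneg.2 (he1 ω)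
  set F := ∫ ω, e ω ∂P - 1 with hF
  have hqI0 : 0 ≤ ∫ ω, q ω ∂P := integral_nonneg hq0
  have hα1 : t * (n : ℝ) ^ α * (κ / ((3 + γ) * n)) = t * (κ / (3 + γ)) * (n : ℝ) ^ (α - 1) := by
    rw [Real.rpow_sub_one hn0.ne']
    field_simp
  have k1 := mul_le_mul_of_nonneg_left hlow (by positivity : 0 ≤ t * (n : ℝ) ^ α)
  rw [← mul_assoc, hα1] at k1
  have k2 := mul_le_mul_of_nonneg_left heq_le hC.le
  have k3 : 0 ≤ C * r * F := by positivity
  have k4 : 0 ≤ C * Q * ∫ ω, q ω ∂P := by positivity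
  nlinarith

end IsSemiDual

/-! ### Rates of convergence -/

/-- The index `0` carries no decay, only the bound `M`. Passing from `k` to `k + 1` costs a factor
two and treats all indices alike. -/
lemma average_le {a : ℕ → ℝ} {M s : ℝ} (hM : 0 ≤ M) (hs0 : 0 ≤ s) (hs1 : s < 1) (h0 : a 0 ≤ M)
    (ha : ∀ k : ℕ, 1 ≤ k → a k ≤ M * (k : ℝ) ^ (-s)) {n : ℕ} (hn : 1 ≤ n) :
    (n : ℝ)⁻¹ * ∑ k ∈ Finset.range n, a k ≤ 2 * M / (1 - s) * (n : ℝ) ^ (-s) := by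
  have hn0 : (0 : ℝ) < n := by exact_mod_cast hn
  have h1s : 0 < 1 - s := by linarith
  have hterm : ∀ k ∈ Finset.range n, a k ≤ 2 * M * ((k : ℝ) + 1) ^ (-s) := by
    intro k _
    rcases Nat.eq_zero_or_pos k with rfl | hk
    · simp only [Nat.cast_zero, zero_add, Real.one_rpow]
      linarith
    · have hk1 : (1 : ℝ) ≤ k := by exact_mod_cast hk
      have h1 : (k : ℝ) ^ (-s) ≤ 2 * ((k : ℝ) + 1) ^ (-s) := by
        have h2 : (k : ℝ) ^ (-s) ≤ (((k : ℝ) + 1) / 2) ^ (-s) :=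
          Real.rpow_le_rpow_of_nonpos (by positivity) (by linarith) (by linarith)
        rw [Real.div_rpow (by positivity) (by norm_num), Real.rpow_neg (by norm_num : (0 : ℝ) ≤ 2),
          div_inv_eq_mul, mul_comm] at h2
        have h3 : (2 : ℝ) ^ s ≤ 2 := by
          calc (2 : ℝ) ^ s ≤ 2 ^ (1 : ℝ) :=
                Real.rpow_le_rpow_of_exponent_le (by norm_num) hs1.le
            _ = 2 := Real.rpow_one 2
        exact h2.trans (mul_le_mul_of_nonneg_right h3 (by positivity))
      have := mul_le_mul_of_nonneg_left h1 hM
      linarith [ha k hk]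
  have h1 := Finset.sum_le_sum hterm
  rw [← Finset.mul_sum] at h1
  have h2 := mul_le_mul_of_nonneg_left (sum_rpow_neg_le hs0 hs1 n) (by linarith : 0 ≤ 2 * M)
  rw [inv_mul_le_iff₀ hn0]
  refine (h1.trans h2).trans (le_of_eq ?_)
  rw [sub_eq_add_neg 1 s, Real.rpow_add hn0, Real.rpow_one]
  ring

namespace IsSemiDual

variable {Ω X Y : Type*} [MeasurableSpace Ω] [MeasurableSpace X] {J : ℕ} {ε : ℝ} {c : X → Y → ℝ}
  {μ : Measure X} [IsProbabilityMeasure μ] {y : Fin J → Y} {w : Fin J → ℝ}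
  (D : IsSemiDual ε c μ y w) {vs : EuclideanSpace ℝ (Fin J)}
  {P : Measure Ω} [IsProbabilityMeasure P] {x : ℕ → Ω → X} {V₀ : Ω → EuclideanSpace ℝ (Fin J)}
  (A : IsSampling P μ x V₀) {α β γ : ℝ}

local notation "V⟦" n ", " ω "⟧" => Vhat ε c y w α β γ (V₀ ω) (fun k => x k ω) n
local notation "M⟦" n ", " ω "⟧" => gramSum ε c y w α β γ (V₀ ω) (fun k => x k ω) n
local notation "dir⟦" n ", " ω "⟧" => direction ε c y w α β γ (V₀ ω) (fun k => x k ω) n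

include D A

omit [IsProbabilityMeasure P] in
-- `H` is 2-Lipschitz and the first iterate is a projection of `V₀`, so an exponential moment of
-- `‖V₀‖` passes to the excess with half the exponent.
lemma integrable_exp_excess_one (hα : 0 < α) {t₀ t : ℝ} (ht : 0 < t) (htt : 2 * t ≤ t₀)
    (hexp : Integrable (fun ω => Real.exp (t₀ * ‖V₀ ω‖)) P) :
    Integrable (fun ω => Real.exp (t * excess ε c μ y w vs V⟦1, ω⟧)) P := by
  have := D.neZero
  refine (hexp.const_mul (Real.exp (2 * t * ‖vs‖))).mono'
    (D.measurable_exp_excess A t 1).aestronglyMeasurable (Filter.Eventually.of_forall fun ω => ?_)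
  rw [Real.norm_of_nonneg (Real.exp_pos _).le, ← Real.exp_add]
  refine Real.exp_le_exp.2 ?_
  have h1 := D.excess_le (vs := vs) V⟦1, ω⟧
  have h2 := norm_sub_le V⟦1, ω⟧ vs
  have h3 : ‖V⟦1, ω⟧‖ ≤ ‖V₀ ω‖ := by
    refine le_of_sq_le_sq ?_ (norm_nonneg _)
    rw [norm_sq_eq_dot, norm_sq_eq_dot, Vhat_one _ _ _ _ _ _ _ _ _ hα]
    exact dot_PJ_mulVec_self_le _
  have h4 : t * excess ε c μ y w vs V⟦1, ω⟧ ≤ t * (2 * (‖V₀ ω‖ + ‖vs‖)) :=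
    mul_le_mul_of_nonneg_left (by linarith) ht.le
  have h5 := mul_le_mul_of_nonneg_right htt (norm_nonneg (V₀ ω))
  linarith

lemma exists_lyapunov_rate (hα : 0 < α) (hβ : 0 < β) (hαβ : α + 2 * β < 1) (hγ : 0 < γ)
    (hmin : ∀ v, H ε c μ y w vs ≤ H ε c μ y w v) (hvs : ∑ j, vs j = 0)
    {t : ℝ} (ht : 0 < t) (ht1 : t ≤ 1) {Q : ℝ} (hQ : 0 < Q)
    (hdir : ∀ v₀ x, ∀ n : ℕ, 1 ≤ n → ∀ g : Fin J → ℝ, ∑ j, g j = 0 → g ⬝ᵥ g ≤ 4 →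
      direction ε c y w α β γ v₀ x n g ⬝ᵥ direction ε c y w α β γ v₀ x n g ≤
        Q * (n : ℝ) ^ (2 * β - 2))
    (hinit : Integrable (fun ω => Real.exp (t * excess ε c μ y w vs V⟦1, ω⟧)) P)
    {δ K₀ : ℝ} (hδ : 0 < δ) (hK₀ : 0 < K₀) {q : ℕ → Ω → ℝ} (hqm : ∀ n, Measurable (q n))
    (hqle : ∀ n : ℕ, 1 ≤ n → ∀ ω, (n : ℝ) ^ (2 * α) *
        (dir⟦n, ω⟧ (gradh ε c y w (x n ω) V⟦n, ω⟧).ofLp ⬝ᵥ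
          dir⟦n, ω⟧ (gradh ε c y w (x n ω) V⟦n, ω⟧).ofLp) ≤ q n ω)
    (hqQ : ∀ n : ℕ, 1 ≤ n → ∀ ω, q n ω ≤ Q * (n : ℝ) ^ (2 * α + 2 * β - 2))
    (hqI : ∀ n : ℕ, 1 ≤ n → ∫ ω, q n ω ∂P ≤ K₀ * (n : ℝ) ^ (α - 1 - δ)) :
    ∃ K > 0, ∀ n : ℕ, 1 ≤ n →
      Integrable (fun ω => Real.exp (t * excess ε c μ y w vs V⟦n, ω⟧)) P ∧
      ∫ ω, Real.exp (t * excess ε c μ y w vs V⟦n, ω⟧) ∂P - 1 ≤ K * (n : ℝ) ^ (-δ) := by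
  obtain ⟨κ, hκ, C, hC, hstep⟩ := D.lyapunov_step A hα hβ (by linarith) hγ hmin hvs ht ht1 hQ hdir
  have hint : ∀ n : ℕ, 1 ≤ n →
      Integrable (fun ω => Real.exp (t * excess ε c μ y w vs V⟦n, ω⟧)) P := by
    intro n hn
    induction n, hn using Nat.le_induction with
    | base => exact hinit
    | succ n hn ih => exact (hstep n hn ih (q n) (hqm n) (hqle n hn) (hqQ n hn)).1
  have hF0 : ∀ n : ℕ, 1 ≤ n →
      0 ≤ ∫ ω, Real.exp (t * excess ε c μ y w vs V⟦n, ω⟧) ∂P - 1 := by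
    intro n hn
    have h1 : ∫ ω, Real.exp (t * excess ε c μ y w vs V⟦n, ω⟧) ∂P - 1 =
        ∫ ω, (Real.exp (t * excess ε c μ y w vs V⟦n, ω⟧) - 1) ∂P := by
      rw [integral_sub (hint n hn) (integrable_const _)]; simp
    rw [h1]
    exact integral_nonneg fun ω => sub_nonneg.2
      (Real.one_le_exp (mul_nonneg ht.le (excess_nonneg hmin _)))
  -- The gain `1 - α - 2 * β` is the one for which `α - 1` minus it equals the exponent `2 * α + 2 *
  -- β - 2` of the perturbation.
  obtain ⟨K, hK, hle⟩ := exists_le_rpow_of_recursion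
    (x := fun n => ∫ ω, Real.exp (t * excess ε c μ y w vs V⟦n, ω⟧) ∂P - 1) hF0 hκ
    (by positivity : 0 ≤ C * (K₀ + 1)) hα (by linarith : α < 1)
    (by linarith : 0 < 1 - α - 2 * β) hδ (fun n hn => by
      have h1 := (hstep n hn (hint n hn) (q n) (hqm n) (hqle n hn) (hqQ n hn)).2
      have hn0 : (0 : ℝ) < n := by exact_mod_cast hn
      have h2 : α - 1 - (1 - α - 2 * β) = 2 * α + 2 * β - 2 := by ring
      simp only [h2]
      have h3 := mul_le_mul_of_nonneg_left (hqI n hn) hC.le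
      have h4 : 0 ≤ C * (n : ℝ) ^ (α - 1 - δ) := by positivity
      have h5 : 0 ≤ C * K₀ * (n : ℝ) ^ (2 * α + 2 * β - 2) *
          (∫ ω, Real.exp (t * excess ε c μ y w vs V⟦n, ω⟧) ∂P - 1) :=
        mul_nonneg (by positivity) (hF0 n hn)
      nlinarith)
  exact ⟨K, hK, fun n hn => ⟨hint n hn, hle n hn⟩⟩

omit A [MeasurableSpace Ω] in
lemma abs_G_sub_le (v v' : EuclideanSpace ℝ (Fin J)) (i j : Fin J) :
    |G ε c μ y w v i j - G ε c μ y w v' i j| ≤ 4 / ε * ‖v - v'‖ := by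
  have hint : ∀ v, Integrable (fun z => gradh ε c y w z v i * gradh ε c y w z v j) μ := fun v =>
    (D.integrable_gradh v i).mul_bdd (c := 1) (D.integrable_gradh v j).aestronglyMeasurable
      (Filter.Eventually.of_forall fun z =>
        abs_gradh_apply_le D.weight_pos D.weight_sum D.eps_pos z v j)
  simp only [G, Matrix.of_apply]
  rw [← integral_sub (hint v) (hint v')]
  refine abs_integral_le_integral_abs.trans ?_
  have hpt : ∀ z, |gradh ε c y w z v i * gradh ε c y w z v j -
      gradh ε c y w z v' i * gradh ε c y w z v' j| ≤ 4 / ε * ‖v - v'‖ := by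
    intro z
    have hL : ∀ k, |gradh ε c y w z v k - gradh ε c y w z v' k| ≤ 2 * (‖v - v'‖ / ε) := by
      intro k
      have := abs_gibbs_add_sub_le (c := c) (y := y) D.weight_pos D.weight_sum D.eps_pos z v'
        (v - v') k
      rw [add_sub_cancel] at this
      rw [gradh_apply D.weight_pos D.weight_sum D.eps_pos,
        gradh_apply D.weight_pos D.weight_sum D.eps_pos, sub_sub_sub_cancel_right]
      exact this
    have hb := fun v k => abs_gradh_apply_le (c := c) (y := y) D.weight_pos D.weight_sum
      D.eps_pos z v k
    have h1 : gradh ε c y w z v i * gradh ε c y w z v j -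
        gradh ε c y w z v' i * gradh ε c y w z v' j =
        (gradh ε c y w z v i - gradh ε c y w z v' i) * gradh ε c y w z v j +
        gradh ε c y w z v' i * (gradh ε c y w z v j - gradh ε c y w z v' j) := by ring
    rw [h1]
    refine (abs_add_le _ _).trans ?_
    rw [abs_mul, abs_mul]
    have h2 := mul_le_mul (hL i) (hb v j) (abs_nonneg _) (by have := D.eps_pos; positivity)
    have h3 := mul_le_mul (hb v' i) (hL j) (abs_nonneg _) zero_le_one
    calc _ ≤ 2 * (‖v - v'‖ / ε) * 1 + 1 * (2 * (‖v - v'‖ / ε)) := add_le_add h2 h3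
      _ = _ := by ring
  calc _ ≤ ∫ _, 4 / ε * ‖v - v'‖ ∂μ :=
        integral_mono ((hint v).sub (hint v')).abs (integrable_const _) hpt
    _ = _ := by simp

omit A [MeasurableSpace Ω] in
lemma abs_G_le_one (v : EuclideanSpace ℝ (Fin J)) (i j : Fin J) : |G ε c μ y w v i j| ≤ 1 := by
  simp only [G, Matrix.of_apply]
  have := norm_integral_le_of_norm_le_const (μ := μ) (C := 1)
    (f := fun z => gradh ε c y w z v i * gradh ε c y w z v j)
    (Filter.Eventually.of_forall fun z => by
      rw [norm_mul]
      exact mul_le_one₀ (abs_gradh_apply_le D.weight_pos D.weight_sum D.eps_pos z v i)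
        (norm_nonneg _) (abs_gradh_apply_le D.weight_pos D.weight_sum D.eps_pos z v j))
  simpa using this

omit A [MeasurableSpace Ω] in
lemma measurable_G (i j : Fin J) : Measurable fun v => G ε c μ y w v i j := by
  have h1 : Measurable fun q : EuclideanSpace ℝ (Fin J) × X =>
      gradh ε c y w q.2 q.1 i * gradh ε c y w q.2 q.1 j :=
    (D.measurable_gradh_comp measurable_snd measurable_fst i).mul
      (D.measurable_gradh_comp measurable_snd measurable_fst j)
  exact (h1.stronglyMeasurable.integral_prod_right' (ν := μ)).measurable

omit [IsProbabilityMeasure μ] [IsProbabilityMeasure P] in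
lemma measurable_gramSum (n : ℕ) (i j : Fin J) : Measurable fun ω => M⟦n, ω⟧ i j := by
  simp only [gramSum, Matrix.sum_apply, Matrix.vecMulVec_apply]
  exact Finset.measurable_sum _ fun k _ =>
    (D.measurable_gradh_comp (A.meas k) (D.measurable_Vhat A k) i).mul
      (D.measurable_gradh_comp (A.meas k) (D.measurable_Vhat A k) j)

lemma integrable_frobSq_gram (n : ℕ) :
    Integrable (fun ω => frobSq ((n : ℝ)⁻¹ • M⟦n, ω⟧ - G ε c μ y w vs)) P := by
  simp only [frobSq, Matrix.sub_apply, Matrix.smul_apply, smul_eq_mul]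
  refine integrable_finsetSum _ fun i _ => integrable_finsetSum _ fun j _ => ?_
  refine Integrable.of_bound ((((D.measurable_gramSum A n i j).const_mul _).sub_const
    _).pow_const 2).aestronglyMeasurable (((n : ℝ)⁻¹ * n + 1) ^ 2)
    (Filter.Eventually.of_forall fun ω => ?_)
  rw [norm_pow]
  refine pow_le_pow_left₀ (norm_nonneg _) ((norm_sub_le _ _).trans (add_le_add ?_
    (D.abs_G_le_one vs i j))) 2
  rw [norm_mul, Real.norm_of_nonneg (inv_nonneg.2 (Nat.cast_nonneg n))]
  refine mul_le_mul_of_nonneg_left ?_ (inv_nonneg.2 (Nat.cast_nonneg n))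
  simp only [gramSum, Matrix.sum_apply, Matrix.vecMulVec_apply]
  refine (norm_sum_le _ _).trans ?_
  have h1 : ∀ k ∈ Finset.range n, ‖gradh ε c y w (x k ω) V⟦k, ω⟧ i *
      gradh ε c y w (x k ω) V⟦k, ω⟧ j‖ ≤ 1 := fun k _ => by
    rw [norm_mul]
    exact mul_le_one₀ (abs_gradh_apply_le D.weight_pos D.weight_sum D.eps_pos _ _ i)
      (norm_nonneg _) (abs_gradh_apply_le D.weight_pos D.weight_sum D.eps_pos _ _ j)
  simpa using Finset.sum_le_sum h1

/-- Mean square convergence of the empirical Gram matrix, from a rate for the iterates. -/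
lemma exists_gram_rate {s L : ℝ} (hs0 : 0 < s) (hs1 : s < 1) (hL : 0 < L)
    (hV : ∀ n : ℕ, 1 ≤ n → Integrable (fun ω => ‖V⟦n, ω⟧ - vs‖ ^ 2) P ∧
      ∫ ω, ‖V⟦n, ω⟧ - vs‖ ^ 2 ∂P ≤ L * (n : ℝ) ^ (-s)) :
    ∃ K > 0, ∀ n : ℕ, 1 ≤ n →
      ∫ ω, frobSq ((n : ℝ)⁻¹ • M⟦n, ω⟧ - G ε c μ y w vs) ∂P ≤ K * (n : ℝ) ^ (-s) := by
  have hε := D.eps_pos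
  have hJ0 := D.neZero
  have hJ : (0 : ℝ) < J := by exact_mod_cast NeZero.pos J
  set N := 4 + 16 / ε ^ 2 * L with hN
  have hN0 : 0 < N := by positivity
  have h1s : 0 < 1 - s := by linarith
  set K := 8 + 2 * (2 * N / (1 - s)) with hK
  have hK0 : 0 < K := by positivity
  refine ⟨J * (J * K), by positivity, fun n hn => ?_⟩
  have hn0 : (0 : ℝ) < n := by exact_mod_cast hn
  have hn1 : (1 : ℝ) ≤ n := by exact_mod_cast hn
  have hentry : ∀ i j, Integrable (fun ω => ((n : ℝ)⁻¹ * M⟦n, ω⟧ i j - G ε c μ y w vs i j) ^ 2) P ∧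
      ∫ ω, ((n : ℝ)⁻¹ * M⟦n, ω⟧ i j - G ε c μ y w vs i j) ^ 2 ∂P ≤ K * (n : ℝ) ^ (-s) := by
    intro i j
    -- The error splits into an average of centered increments `f`, whose mean square is of order `1
    -- / n` by orthogonality, and the average of `G V_k - G vs`, controlled by Cauchy–Schwarz, the
    -- Lipschitz bound on `G` and the rate for the iterates.
    let f : X → EuclideanSpace ℝ (Fin J) → ℝ := fun z v =>
      gradh ε c y w z v i * gradh ε c y w z v j - G ε c μ y w v i j
    have hfm : Measurable fun q : X × EuclideanSpace ℝ (Fin J) => f q.1 q.2 :=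
      ((D.measurable_gradh i).mul (D.measurable_gradh j)).sub
        (Measurable.comp (g := fun v => G ε c μ y w v i j) (D.measurable_G i j) measurable_snd)
    have hgg : ∀ z v, |gradh ε c y w z v i * gradh ε c y w z v j| ≤ 1 := fun z v => by
      rw [abs_mul]
      exact mul_le_one₀ (abs_gradh_apply_le D.weight_pos D.weight_sum D.eps_pos z v i)
        (abs_nonneg _) (abs_gradh_apply_le D.weight_pos D.weight_sum D.eps_pos z v j)
    have hfb : ∀ z v, |f z v| ≤ 2 := fun z v => by
      refine (abs_sub _ _).trans ?_
      linarith [hgg z v, D.abs_G_le_one v i j]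
    have hcenter : ∀ v, ∫ z, f z v ∂μ = 0 := fun v => by
      have h1 : Integrable (fun z => gradh ε c y w z v i * gradh ε c y w z v j) μ :=
        Integrable.of_bound ((D.integrable_gradh v i).aestronglyMeasurable.mul
          (D.integrable_gradh v j).aestronglyMeasurable) 1
          (Filter.Eventually.of_forall fun z => hgg z v)
      simp only [f]
      rw [integral_sub h1 (integrable_const _)]
      simp [G]
    have hL2 : ∀ k, MemLp (fun ω => f (x k ω) V⟦k, ω⟧) 2 P := fun k =>
      MemLp.of_bound (Measurable.comp (g := fun q : X × EuclideanSpace ℝ (Fin J) => f q.1 q.2)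
        (f := fun ω => (x k ω, V⟦k, ω⟧)) hfm
        ((A.meas k).prodMk (D.measurable_Vhat A k))).aestronglyMeasurable 2
        (Filter.Eventually.of_forall fun ω => hfb _ _)
    obtain ⟨hTmem, hTeq⟩ := A.integral_sum_sq_le (V := fun k ω => V⟦k, ω⟧)
      (fun n k hk => D.measurable_past_Vhat hk) hfm hcenter hL2 n
    have hT : ∫ ω, (∑ k ∈ Finset.range n, f (x k ω) V⟦k, ω⟧) ^ 2 ∂P ≤ 4 * n := by
      rw [hTeq]
      have h1 : ∀ k ∈ Finset.range n, ∫ ω, f (x k ω) V⟦k, ω⟧ ^ 2 ∂P ≤ 4 := fun k _ => by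
        calc ∫ ω, f (x k ω) V⟦k, ω⟧ ^ 2 ∂P ≤ ∫ _, 4 ∂P :=
              integral_mono (hL2 k).integrable_sq (integrable_const _) fun ω => by
                have := hfb (x k ω) V⟦k, ω⟧
                simp only
                rw [← sq_abs]
                nlinarith [abs_nonneg (f (x k ω) V⟦k, ω⟧)]
          _ = 4 := by simp
      have := Finset.sum_le_sum h1
      simpa [mul_comm] using this
    let b : ℕ → Ω → ℝ := fun k ω => (G ε c μ y w V⟦k, ω⟧ i j - G ε c μ y w vs i j) ^ 2
    have hb4 : ∀ k ω, b k ω ≤ 4 := fun k ω => by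
      have h1 := (abs_sub _ _).trans (add_le_add (D.abs_G_le_one V⟦k, ω⟧ i j)
        (D.abs_G_le_one vs i j))
      simp only [b]
      rw [← sq_abs]
      nlinarith [abs_nonneg (G ε c μ y w V⟦k, ω⟧ i j - G ε c μ y w vs i j)]
    have hbint : ∀ k, Integrable (b k) P := fun k =>
      Integrable.of_bound (((Measurable.comp
        (g := fun v => G ε c μ y w v i j) (D.measurable_G i j)
        (D.measurable_Vhat A k)).sub_const _).pow_const 2).aestronglyMeasurable 4
        (Filter.Eventually.of_forall fun ω => by
          rw [Real.norm_of_nonneg (sq_nonneg _)]; exact hb4 k ω)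
    have hbavg : (n : ℝ)⁻¹ * ∑ k ∈ Finset.range n, ∫ ω, b k ω ∂P ≤
        2 * N / (1 - s) * (n : ℝ) ^ (-s) := by
      refine average_le hN0.le hs0.le hs1 ?_ (fun k hk => ?_) hn
      · calc ∫ ω, b 0 ω ∂P ≤ ∫ _, 4 ∂P := integral_mono (hbint 0) (integrable_const _) (hb4 0)
          _ = 4 := by simp
          _ ≤ N := by rw [hN]; linarith [(by positivity : 0 ≤ 16 / ε ^ 2 * L)]
      · obtain ⟨hVi, hVle⟩ := hV k hk
        calc ∫ ω, b k ω ∂P ≤ ∫ ω, 16 / ε ^ 2 * ‖V⟦k, ω⟧ - vs‖ ^ 2 ∂P :=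
              integral_mono (hbint k) (hVi.const_mul _) fun ω => by
                have h1 := D.abs_G_sub_le V⟦k, ω⟧ vs i j
                have h2 := pow_le_pow_left₀ (abs_nonneg _) h1 2
                rw [sq_abs, mul_pow, div_pow] at h2
                simp only [b]
                linarith
          _ = 16 / ε ^ 2 * ∫ ω, ‖V⟦k, ω⟧ - vs‖ ^ 2 ∂P := integral_const_mul _ _
          _ ≤ 16 / ε ^ 2 * (L * (k : ℝ) ^ (-s)) :=
              mul_le_mul_of_nonneg_left hVle (by positivity)
          _ ≤ N * (k : ℝ) ^ (-s) := by
              rw [← mul_assoc]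
              exact mul_le_mul_of_nonneg_right (by rw [hN]; linarith) (by positivity)
    have hpt : ∀ ω, ((n : ℝ)⁻¹ * M⟦n, ω⟧ i j - G ε c μ y w vs i j) ^ 2 ≤
        2 * ((n : ℝ)⁻¹ ^ 2 * (∑ k ∈ Finset.range n, f (x k ω) V⟦k, ω⟧) ^ 2) +
          2 * ((n : ℝ)⁻¹ * ∑ k ∈ Finset.range n, b k ω) := by
      intro ω
      set T := ∑ k ∈ Finset.range n, f (x k ω) V⟦k, ω⟧ with hTdef
      set U := ∑ k ∈ Finset.range n, (G ε c μ y w V⟦k, ω⟧ i j - G ε c μ y w vs i j) with hU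
      have h1 : (n : ℝ)⁻¹ * M⟦n, ω⟧ i j - G ε c μ y w vs i j = (n : ℝ)⁻¹ * T + (n : ℝ)⁻¹ * U := by
        have h2 : M⟦n, ω⟧ i j = T + U + n * G ε c μ y w vs i j := by
          rw [hTdef, hU, ← Finset.sum_add_distrib]
          simp only [f, gramSum, Matrix.sum_apply, Matrix.vecMulVec_apply,
            sub_add_sub_cancel, Finset.sum_sub_distrib]
          simp
        rw [h2]
        field_simp
        ring
      have h3 : U ^ 2 ≤ n * ∑ k ∈ Finset.range n, b k ω := by
        have := sq_sum_le_card_mul_sum_sq (s := Finset.range n)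
          (f := fun k => G ε c μ y w V⟦k, ω⟧ i j - G ε c μ y w vs i j)
        rwa [Finset.card_range] at this
      have h4 : ((n : ℝ)⁻¹ * U) ^ 2 ≤ (n : ℝ)⁻¹ * ∑ k ∈ Finset.range n, b k ω := by
        rw [mul_pow]
        calc (n : ℝ)⁻¹ ^ 2 * U ^ 2 ≤ (n : ℝ)⁻¹ ^ 2 * (n * ∑ k ∈ Finset.range n, b k ω) :=
              mul_le_mul_of_nonneg_left h3 (by positivity)
          _ = _ := by field_simp
      rw [h1, ← mul_pow]
      nlinarith [sq_nonneg ((n : ℝ)⁻¹ * T - (n : ℝ)⁻¹ * U)]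
    have hR1 := (hTmem.integrable_sq.const_mul ((n : ℝ)⁻¹ ^ 2)).const_mul 2
    have hbs : Integrable (fun ω => ∑ k ∈ Finset.range n, b k ω) P :=
      integrable_finsetSum _ fun k _ => hbint k
    have hR2 := (hbs.const_mul (n : ℝ)⁻¹).const_mul 2
    have hLm : Measurable fun ω => ((n : ℝ)⁻¹ * M⟦n, ω⟧ i j - G ε c μ y w vs i j) ^ 2 :=
      (((D.measurable_gramSum A n i j).const_mul _).sub_const _).pow_const 2
    have hLi : Integrable (fun ω => ((n : ℝ)⁻¹ * M⟦n, ω⟧ i j - G ε c μ y w vs i j) ^ 2) P :=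
      (hR1.add hR2).mono' hLm.aestronglyMeasurable (Filter.Eventually.of_forall fun ω => by
        rw [Real.norm_of_nonneg (sq_nonneg _)]; exact hpt ω)
    refine ⟨hLi, (integral_mono hLi (hR1.add hR2) hpt).trans ?_⟩
    rw [integral_add' hR1 hR2, integral_const_mul, integral_const_mul, integral_const_mul,
      integral_const_mul, integral_finsetSum _ fun k _ => hbint k]
    have h1 : (n : ℝ)⁻¹ ≤ (n : ℝ) ^ (-s) := by
      rw [← Real.rpow_neg_one]
      exact Real.rpow_le_rpow_of_exponent_le hn1 (by linarith)
    have h2 : (n : ℝ)⁻¹ ^ 2 * ∫ ω, (∑ k ∈ Finset.range n, f (x k ω) V⟦k, ω⟧) ^ 2 ∂P ≤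
        4 * (n : ℝ)⁻¹ := by
      calc _ ≤ (n : ℝ)⁻¹ ^ 2 * (4 * n) := mul_le_mul_of_nonneg_left hT (by positivity)
        _ = _ := by field_simp
    rw [hK, add_mul]
    linarith
  simp only [frobSq, Matrix.sub_apply, Matrix.smul_apply, smul_eq_mul]
  rw [integral_finsetSum _ fun i _ => integrable_finsetSum _ fun j _ => (hentry i j).1]
  calc _ ≤ ∑ _i : Fin J, ∑ _j : Fin J, K * (n : ℝ) ^ (-s) := by
        refine Finset.sum_le_sum fun i _ => ?_
        rw [integral_finsetSum _ fun j _ => (hentry i j).1]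
        exact Finset.sum_le_sum fun j _ => (hentry i j).2
    _ = _ := by simp; ring

end IsSemiDual

/-! ### The two passes and the cost estimator. -/

namespace IsSemiDual

variable {Ω X Y : Type*} [MeasurableSpace Ω] [MeasurableSpace X] {J : ℕ} {ε : ℝ} {c : X → Y → ℝ}
  {μ : Measure X} [IsProbabilityMeasure μ] {y : Fin J → Y} {w : Fin J → ℝ}
  (D : IsSemiDual ε c μ y w) {vs : EuclideanSpace ℝ (Fin J)}
  {P : Measure Ω} [IsProbabilityMeasure P] {x : ℕ → Ω → X} {V₀ : Ω → EuclideanSpace ℝ (Fin J)}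
  (A : IsSampling P μ x V₀) {α β γ : ℝ}

local notation "V⟦" n ", " ω "⟧" => Vhat ε c y w α β γ (V₀ ω) (fun k => x k ω) n
local notation "M⟦" n ", " ω "⟧" => gramSum ε c y w α β γ (V₀ ω) (fun k => x k ω) n
local notation "dir⟦" n ", " ω "⟧" => direction ε c y w α β γ (V₀ ω) (fun k => x k ω) n

include D A

omit [IsProbabilityMeasure P] in
lemma integrable_excess {n : ℕ} {t : ℝ} (ht : 0 < t)
    (hmin : ∀ v, H ε c μ y w vs ≤ H ε c μ y w v)
    (hE : Integrable (fun ω => Real.exp (t * excess ε c μ y w vs V⟦n, ω⟧)) P) :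
    Integrable (fun ω => excess ε c μ y w vs V⟦n, ω⟧) P := by
  refine (hE.const_mul t⁻¹).mono' (Measurable.comp (g := fun v => excess ε c μ y w vs v)
    D.measurable_excess (D.measurable_Vhat A n)).aestronglyMeasurable
    (Filter.Eventually.of_forall fun ω => ?_)
  rw [Real.norm_of_nonneg (excess_nonneg hmin _), le_inv_mul_iff₀ ht]
  linarith [Real.add_one_le_exp (t * excess ε c μ y w vs V⟦n, ω⟧)]

lemma integral_excess_le {n : ℕ} {t b : ℝ} (ht : 0 < t)
    (hmin : ∀ v, H ε c μ y w vs ≤ H ε c μ y w v)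
    (hE : Integrable (fun ω => Real.exp (t * excess ε c μ y w vs V⟦n, ω⟧)) P)
    (hb : ∫ ω, Real.exp (t * excess ε c μ y w vs V⟦n, ω⟧) ∂P - 1 ≤ b) :
    ∫ ω, excess ε c μ y w vs V⟦n, ω⟧ ∂P ≤ b / t := by
  have hi := D.integrable_excess A ht hmin hE
  have h1 : ∫ ω, (t * excess ε c μ y w vs V⟦n, ω⟧ + 1) ∂P ≤
      ∫ ω, Real.exp (t * excess ε c μ y w vs V⟦n, ω⟧) ∂P :=
    integral_mono ((hi.const_mul t).add (integrable_const 1)) hE fun ω => Real.add_one_le_exp _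
  rw [integral_add (hi.const_mul t) (integrable_const 1), integral_const_mul] at h1
  simp only [integral_const, probReal_univ, smul_eq_mul, mul_one] at h1
  rw [le_div_iff₀ ht]
  linarith

lemma exists_norm_sq_rate (hmin : ∀ v, H ε c μ y w vs ≤ H ε c μ y w v) (hvs : ∑ j, vs j = 0)
    {t s K : ℝ} (ht : 0 < t) (hK : 0 < K)
    (hE : ∀ n : ℕ, 1 ≤ n →
      Integrable (fun ω => Real.exp (t * excess ε c μ y w vs V⟦n, ω⟧)) P ∧
      ∫ ω, Real.exp (t * excess ε c μ y w vs V⟦n, ω⟧) ∂P - 1 ≤ K * (n : ℝ) ^ (-s)) :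
    ∃ L > 0, ∀ n : ℕ, 1 ≤ n → Integrable (fun ω => ‖V⟦n, ω⟧ - vs‖ ^ 2) P ∧
      ∫ ω, ‖V⟦n, ω⟧ - vs‖ ^ 2 ∂P ≤ L * (n : ℝ) ^ (-s) := by
  have := D.neZero
  obtain ⟨C, hC, hle⟩ := D.exists_norm_sq_le_exp hmin hvs ht
  refine ⟨C * K, by positivity, fun n hn => ?_⟩
  obtain ⟨hi, hb⟩ := hE n hn
  have hpt : ∀ ω, ‖V⟦n, ω⟧ - vs‖ ^ 2 ≤
      C * (Real.exp (t * excess ε c μ y w vs V⟦n, ω⟧) - 1) := fun ω =>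
    hle _ (sum_Vhat (hn := hn) ..)
  have hR := (hi.sub (integrable_const 1)).const_mul C
  have hint : Integrable (fun ω => ‖V⟦n, ω⟧ - vs‖ ^ 2) P :=
    hR.mono' (((D.measurable_Vhat A n).sub_const vs).norm.pow_const 2).aestronglyMeasurable
      (Filter.Eventually.of_forall fun ω => by
        rw [Real.norm_of_nonneg (sq_nonneg _)]; exact hpt ω)
  refine ⟨hint, (integral_mono hint hR hpt).trans ?_⟩
  simp only [Pi.sub_apply]
  rw [integral_const_mul, integral_sub hi (integrable_const 1)]
  simp only [integral_const, probReal_univ, smul_eq_mul, mul_one]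
  rw [mul_assoc]
  exact mul_le_mul_of_nonneg_left hb hC.le

/-- The exponential moments of the excess risk converge at the optimal rate, and the empirical
Gram matrix converges at a polynomial rate. -/
lemma exists_rates (hα : 0 < α) (hβ : 0 < β) (hαβ : 4 * β < 1 - 2 * α) (hγ : 0 < γ)
    (hmin : ∀ v, H ε c μ y w vs ≤ H ε c μ y w v) (hvs : ∑ j, vs j = 0)
    (hG : ∃ lam > 0, ∀ u ∈ vJPerp J, lam * ‖u‖ ^ 2 ≤ u.ofLp ⬝ᵥ (G ε c μ y w vs *ᵥ u.ofLp))
    (hexp : ∃ t > 0, Integrable (fun ω => Real.exp (t * ‖V₀ ω‖)) P) :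
    ∃ t > 0, ∃ K > 0, ∀ n : ℕ, 1 ≤ n →
      (Integrable (fun ω => Real.exp (t * excess ε c μ y w vs V⟦n, ω⟧)) P ∧
        ∫ ω, Real.exp (t * excess ε c μ y w vs V⟦n, ω⟧) ∂P - 1 ≤ K * (n : ℝ) ^ (-(1 - α))) ∧
      ∫ ω, frobSq ((n : ℝ)⁻¹ • M⟦n, ω⟧ - G ε c μ y w vs) ∂P ≤ K * (n : ℝ) ^ (-(2 * β)) := by
  obtain ⟨t₀, ht₀, hexp⟩ := hexp
  -- `t ≤ 1` is needed for the Lyapunov contraction and `2 * t ≤ t₀` for integrability at the first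
  -- iterate.
  set t := min 1 (t₀ / 2) with htdef
  have ht : 0 < t := lt_min one_pos (by linarith)
  have ht1 : t ≤ 1 := min_le_left _ _
  have htt : 2 * t ≤ t₀ := by linarith [min_le_right 1 (t₀ / 2)]
  have hinit := D.integrable_exp_excess_one A (vs := vs) (β := β) (γ := γ) hα ht htt hexp
  obtain ⟨Q, hQ, hdir⟩ := D.exists_direction_le (α := α) hβ hγ
  obtain ⟨C₂, hC₂, hdir₂⟩ := D.exists_direction_le_of_gram (α := α) hβ hγ hG
  have hs0 : 0 < 1 - α - 2 * β := by linarith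
  have hs1 : 1 - α - 2 * β < 1 := by linarith
  have hqle : ∀ n : ℕ, 1 ≤ n → ∀ ω, (n : ℝ) ^ (2 * α) *
        (dir⟦n, ω⟧ (gradh ε c y w (x n ω) V⟦n, ω⟧).ofLp ⬝ᵥ
          dir⟦n, ω⟧ (gradh ε c y w (x n ω) V⟦n, ω⟧).ofLp) ≤
        Q * (n : ℝ) ^ (2 * α + 2 * β - 2) := fun n hn ω => by
    have hn0 : (0 : ℝ) < n := by exact_mod_cast hn
    have h1 := hdir (V₀ ω) (fun k => x k ω) n hn _
      (sum_gradh D.weight_pos D.weight_sum D.eps_pos (x n ω) V⟦n, ω⟧)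
      ((D.gradh_dot_self_le (x n ω) V⟦n, ω⟧).trans (by norm_num))
    refine (mul_le_mul_of_nonneg_left h1 (by positivity)).trans (le_of_eq ?_)
    rw [mul_left_comm, ← Real.rpow_add hn0]
    ring_nf
  -- First pass: `q` is the deterministic worst-case bound, which gives the rate `1 - α - 2 * β`.
  obtain ⟨K₁, hK₁, hE₁⟩ := D.exists_lyapunov_rate A hα hβ (by linarith) hγ hmin hvs ht ht1 hQ hdir
    hinit hs0 hQ (q := fun n _ => Q * (n : ℝ) ^ (2 * α + 2 * β - 2)) (fun n => measurable_const)
    hqle (fun n hn ω => le_rfl) (fun n hn => by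
      have : α - 1 - (1 - α - 2 * β) = 2 * α + 2 * β - 2 := by ring
      rw [this]; simp)
  obtain ⟨L, hL, hV⟩ := D.exists_norm_sq_rate A hmin hvs ht hK₁ hE₁
  obtain ⟨K₂, hK₂, hM⟩ := D.exists_gram_rate A hs0 hs1 hL hV
  -- The first-pass rate is at least `2 * β` because `4 * β < 1 - 2 * α`; no more is needed for the
  -- second pass.
  have hM' : ∀ n : ℕ, 1 ≤ n → ∫ ω, frobSq ((n : ℝ)⁻¹ • M⟦n, ω⟧ - G ε c μ y w vs) ∂P ≤
      K₂ * (n : ℝ) ^ (-(2 * β)) := fun n hn =>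
    (hM n hn).trans (mul_le_mul_of_nonneg_left
      (Real.rpow_le_rpow_of_exponent_le (by exact_mod_cast hn) (by linarith)) hK₂.le)
  have hFm : ∀ n : ℕ, Measurable fun ω => frobSq ((n : ℝ)⁻¹ • M⟦n, ω⟧ - G ε c μ y w vs) := by
    intro n
    simp only [frobSq, Matrix.sub_apply, Matrix.smul_apply, smul_eq_mul]
    exact Finset.measurable_sum _ fun i _ => Finset.measurable_sum _ fun j _ =>
      (((D.measurable_gramSum A n i j).const_mul _).sub_const _).pow_const 2
  let r : ℕ → Ω → ℝ := fun n ω => (n : ℝ) ^ (2 * α) * (C₂ * ((n : ℝ) ^ (-2 : ℝ) +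
    (n : ℝ) ^ (2 * β - 2) * frobSq ((n : ℝ)⁻¹ • M⟦n, ω⟧ - G ε c μ y w vs)))
  have hrm : ∀ n, Measurable (r n) := fun n =>
    ((((hFm n).const_mul _).const_add _).const_mul _).const_mul _
  have hri : ∀ n, Integrable (r n) P := fun n =>
    (((integrable_const _).add
      ((D.integrable_frobSq_gram A n).const_mul _)).const_mul _).const_mul _
  have hr0 : ∀ n ω, 0 ≤ r n ω := fun n ω => by
    have := frobSq_nonneg ((n : ℝ)⁻¹ • M⟦n, ω⟧ - G ε c μ y w vs)
    positivity
  -- Second pass: in the minimum, the deterministic bound keeps `q` uniformly controlled while the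
  -- Gram bound `r` makes its mean small.
  obtain ⟨K₃, hK₃, hE₂⟩ := D.exists_lyapunov_rate A hα hβ (by linarith) hγ hmin hvs ht ht1 hQ hdir
    hinit (δ := 1 - α) (by linarith) (K₀ := C₂ * (1 + K₂)) (by positivity)
    (q := fun n ω => min (Q * (n : ℝ) ^ (2 * α + 2 * β - 2)) (r n ω))
    (fun n => measurable_const.min (hrm n))
    (fun n hn ω => le_min (hqle n hn ω) (mul_le_mul_of_nonneg_left
      (hdir₂ (V₀ ω) (fun k => x k ω) n hn (x n ω) V⟦n, ω⟧) (by positivity)))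
    (fun n hn ω => min_le_left _ _) (fun n hn => by
      have hn0 : (0 : ℝ) < n := by exact_mod_cast hn
      calc ∫ ω, min (Q * (n : ℝ) ^ (2 * α + 2 * β - 2)) (r n ω) ∂P ≤ ∫ ω, r n ω ∂P :=
            integral_mono_of_nonneg (Filter.Eventually.of_forall fun ω =>
              le_min (by positivity) (hr0 n ω)) (hri n)
              (Filter.Eventually.of_forall fun ω => min_le_right _ _)
        _ = (n : ℝ) ^ (2 * α) * (C₂ * ((n : ℝ) ^ (-2 : ℝ) + (n : ℝ) ^ (2 * β - 2) *
              ∫ ω, frobSq ((n : ℝ)⁻¹ • M⟦n, ω⟧ - G ε c μ y w vs) ∂P)) := by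
            simp only [r]
            rw [integral_const_mul, integral_const_mul, integral_add (integrable_const _)
              ((D.integrable_frobSq_gram A n).const_mul _), integral_const_mul]
            simp
        _ ≤ (n : ℝ) ^ (2 * α) * (C₂ * ((n : ℝ) ^ (-2 : ℝ) + (n : ℝ) ^ (2 * β - 2) *
              (K₂ * (n : ℝ) ^ (-(2 * β))))) := by
            have := hM' n hn
            gcongr
        _ = C₂ * (1 + K₂) * (n : ℝ) ^ (α - 1 - (1 - α)) := by
            -- The loss `n ^ (2 * β)` of the worst-case step is exactly compensated by the rate of
            -- the Gram matrix.
            have h1 : (n : ℝ) ^ (2 * β - 2) * (K₂ * (n : ℝ) ^ (-(2 * β))) =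
                K₂ * (n : ℝ) ^ (-2 : ℝ) := by
              rw [mul_left_comm, ← Real.rpow_add hn0]; ring_nf
            have h2 : (n : ℝ) ^ (α - 1 - (1 - α)) = (n : ℝ) ^ (2 * α) * (n : ℝ) ^ (-2 : ℝ) := by
              rw [← Real.rpow_add hn0]; ring_nf
            rw [h1, h2]
            ring)
  refine ⟨t, ht, K₃ + K₂, by positivity, fun n hn => ⟨⟨(hE₂ n hn).1, (hE₂ n hn).2.trans ?_⟩,
    (hM' n hn).trans ?_⟩⟩ <;>
  exact mul_le_mul_of_nonneg_right (by linarith) (by positivity)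

lemma exists_frobSq_Sbar_rate (hβ : 0 < β) (hβ1 : β < 1) (hγ : 0 < γ) {K : ℝ} (hK : 0 < K)
    (hM : ∀ n : ℕ, 1 ≤ n →
      ∫ ω, frobSq ((n : ℝ)⁻¹ • M⟦n, ω⟧ - G ε c μ y w vs) ∂P ≤ K * (n : ℝ) ^ (-(2 * β))) :
    ∃ L > 0, ∀ n : ℕ, 1 ≤ n →
      Integrable (fun ω => frobSq (Sbar ε c y w α β γ (V₀ ω) (fun k => x k ω) n -
        G ε c μ y w vs)) P ∧
      ∫ ω, frobSq (Sbar ε c y w α β γ (V₀ ω) (fun k => x k ω) n - G ε c μ y w vs) ∂P ≤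
        L * (n : ℝ) ^ (-(2 * β)) := by
  have := D.neZero
  obtain ⟨C, hC, hreg⟩ := exists_frobSq_regSum_le D.weight_pos D.weight_sum hβ hβ1 hγ
  refine ⟨2 * K + 2 * C, by positivity, fun n hn => ?_⟩
  have heq : ∀ ω, Sbar ε c y w α β γ (V₀ ω) (fun k => x k ω) n - G ε c μ y w vs =
      ((n : ℝ)⁻¹ • M⟦n, ω⟧ - G ε c μ y w vs) + (n : ℝ)⁻¹ • regSum w β γ n := fun ω => by
    have h1 := Smat_eq ε c y w α β γ (V₀ ω) (fun k => x k ω) n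
    rw [Smat] at h1
    rw [Sbar, h1, smul_add]
    abel
  simp_rw [heq]
  have hpt : ∀ ω, frobSq (((n : ℝ)⁻¹ • M⟦n, ω⟧ - G ε c μ y w vs) + (n : ℝ)⁻¹ • regSum w β γ n) ≤
      2 * frobSq ((n : ℝ)⁻¹ • M⟦n, ω⟧ - G ε c μ y w vs) +
        2 * frobSq ((n : ℝ)⁻¹ • regSum w β γ n) := fun ω => frobSq_add_le _ _
  have hR := ((D.integrable_frobSq_gram A (vs := vs) (α := α) (β := β) (γ := γ) n).const_mul 2).add
    (integrable_const (2 * frobSq ((n : ℝ)⁻¹ • regSum w β γ n)))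
  have hm : Measurable fun ω =>
      frobSq (((n : ℝ)⁻¹ • M⟦n, ω⟧ - G ε c μ y w vs) + (n : ℝ)⁻¹ • regSum w β γ n) := by
    simp only [frobSq, Matrix.add_apply, Matrix.sub_apply, Matrix.smul_apply, smul_eq_mul]
    exact Finset.measurable_sum _ fun i _ => Finset.measurable_sum _ fun j _ =>
      ((((D.measurable_gramSum A n i j).const_mul _).sub_const _).add_const _).pow_const 2
  have hint := hR.mono' hm.aestronglyMeasurable (Filter.Eventually.of_forall fun ω => by
    rw [Real.norm_of_nonneg (frobSq_nonneg _)]; exact hpt ω)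
  refine ⟨hint, (integral_mono hint hR hpt).trans ?_⟩
  rw [integral_add' ((D.integrable_frobSq_gram A n).const_mul 2) (integrable_const _),
    integral_const_mul]
  simp only [integral_const, probReal_univ, smul_eq_mul, one_mul]
  linarith [hM n hn, hreg n hn]

omit D [IsProbabilityMeasure μ] in
lemma _root_.SemiDiscreteOT.IsSampling.integrable_norm_sub_sq_init
    (hexp : ∃ t > 0, Integrable (fun ω => Real.exp (t * ‖V₀ ω‖)) P) :
    Integrable (fun ω => ‖V₀ ω - vs‖ ^ 2) P := by
  obtain ⟨t, ht, hexp⟩ := hexp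
  refine ((hexp.const_mul (4 / t ^ 2)).add (integrable_const (2 * ‖vs‖ ^ 2))).mono'
    ((A.meas_init.sub_const vs).norm.pow_const 2).aestronglyMeasurable
    (Filter.Eventually.of_forall fun ω => ?_)
  rw [Real.norm_of_nonneg (sq_nonneg _)]
  have h1 := Real.quadratic_le_exp_of_nonneg (mul_nonneg ht.le (norm_nonneg (V₀ ω)))
  have h2 : ‖V₀ ω‖ ^ 2 ≤ 2 / t ^ 2 * Real.exp (t * ‖V₀ ω‖) := by
    rw [div_mul_eq_mul_div, le_div_iff₀ (by positivity)]
    have := mul_nonneg ht.le (norm_nonneg (V₀ ω))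
    nlinarith
  have h3 := pow_le_pow_left₀ (norm_nonneg _) (norm_sub_le (V₀ ω) vs) 2
  have h4 : 4 / t ^ 2 * Real.exp (t * ‖V₀ ω‖) = 2 * (2 / t ^ 2 * Real.exp (t * ‖V₀ ω‖)) := by ring
  simp only [Pi.add_apply]
  rw [h4]
  nlinarith [sq_nonneg (‖V₀ ω‖ - ‖vs‖)]

omit [IsProbabilityMeasure μ] in
lemma integrable_h_Vhat {n : ℕ} (hV : Integrable (fun ω => ‖V⟦n, ω⟧ - vs‖ ^ 2) P) :
    Integrable (fun ω => h ε c y w (x n ω) V⟦n, ω⟧) P := by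
  have hc : ∀ j, Integrable (fun ω => c (x n ω) (y j)) P := fun j => by
    have h1 := D.cost_int j
    rw [← A.law n] at h1
    exact h1.comp_measurable (A.meas n)
  refine Integrable.mono' (g := fun ω => ε + ∑ j, w j * c (x n ω) (y j) +
      2 * (‖vs‖ + (1 + ‖V⟦n, ω⟧ - vs‖ ^ 2))) ?_
    (Measurable.comp (g := fun q : X × EuclideanSpace ℝ (Fin J) => h ε c y w q.1 q.2)
      (f := fun ω => (x n ω, V⟦n, ω⟧)) D.measurable_h
      ((A.meas n).prodMk (D.measurable_Vhat A n))).aestronglyMeasurable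
    (Filter.Eventually.of_forall fun ω => ?_)
  · exact ((integrable_const _).add (integrable_finsetSum _ fun j _ => (hc j).const_mul _)).add
      (((integrable_const _).add ((integrable_const _).add hV)).const_mul 2)
  · have h1 := D.abs_h_le (x n ω) V⟦n, ω⟧
    have h2 := norm_sub_norm_le V⟦n, ω⟧ vs
    rw [Real.norm_eq_abs]
    nlinarith [sq_nonneg (‖V⟦n, ω⟧ - vs‖ - 1)]

lemma integrable_H_Vhat {n : ℕ} (hV : Integrable (fun ω => ‖V⟦n, ω⟧ - vs‖ ^ 2) P) :
    Integrable (fun ω => H ε c μ y w V⟦n, ω⟧) P := by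
  refine ((integrable_const (|H ε c μ y w vs| + 1)).add hV).mono'
    (Measurable.comp (g := fun v => H ε c μ y w v) D.measurable_H
      (D.measurable_Vhat A n)).aestronglyMeasurable (Filter.Eventually.of_forall fun ω => ?_)
  have h1 := D.abs_H_sub_le V⟦n, ω⟧ vs
  have h2 := abs_sub_abs_le_abs_sub (H ε c μ y w V⟦n, ω⟧) (H ε c μ y w vs)
  simp only [Pi.add_apply]
  rw [Real.norm_eq_abs]
  nlinarith [sq_nonneg (‖V⟦n, ω⟧ - vs‖ - 1)]

omit [IsProbabilityMeasure μ] in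
lemma integral_h_Vhat {n : ℕ} (hV : Integrable (fun ω => ‖V⟦n, ω⟧ - vs‖ ^ 2) P) :
    ∫ ω, h ε c y w (x n ω) V⟦n, ω⟧ ∂P = ∫ ω, H ε c μ y w V⟦n, ω⟧ ∂P := by
  have := A.integral_mul_eq (n := n) (a := fun _ => 1) (V := fun ω => V⟦n, ω⟧) measurable_const
    (D.measurable_past_Vhat le_rfl) D.measurable_h (by simpa using D.integrable_h_Vhat A hV)
  simpa [H] using this

omit [IsProbabilityMeasure μ] in
lemma integrable_What (hV : ∀ n, Integrable (fun ω => ‖V⟦n, ω⟧ - vs‖ ^ 2) P) (n : ℕ) :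
    Integrable (fun ω => What ε c y w α β γ (V₀ ω) (fun k => x k ω) n) P :=
  ((integrable_finsetSum _ fun k _ => D.integrable_h_Vhat A (hV k)).const_mul _).neg

/-- Each iterate is independent of the next observation, so every summand has the mean of `H` at the
iterate, and the bias is an average of expected excesses. -/
lemma integral_What_add (hV : ∀ n, Integrable (fun ω => ‖V⟦n, ω⟧ - vs‖ ^ 2) P) {n : ℕ}
    (hn : 1 ≤ n) :
    ∫ ω, What ε c y w α β γ (V₀ ω) (fun k => x k ω) n ∂P + H ε c μ y w vs =
      -((n : ℝ)⁻¹ * ∑ k ∈ Finset.range n, ∫ ω, excess ε c μ y w vs V⟦k, ω⟧ ∂P) := by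
  have hn0 : (n : ℝ) ≠ 0 := by positivity
  simp only [What]
  rw [integral_neg, integral_const_mul,
    integral_finsetSum _ fun k _ => D.integrable_h_Vhat A (hV k)]
  have h1 : ∀ k ∈ Finset.range n, ∫ ω, excess ε c μ y w vs V⟦k, ω⟧ ∂P =
      ∫ ω, h ε c y w (x k ω) V⟦k, ω⟧ ∂P - H ε c μ y w vs := fun k _ => by
    simp only [excess]
    rw [integral_sub (D.integrable_H_Vhat A (hV k)) (integrable_const _),
      D.integral_h_Vhat A (hV k)]
    simp
  rw [Finset.sum_congr rfl h1, Finset.sum_sub_distrib]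
  simp only [Finset.sum_const, Finset.card_range, nsmul_eq_mul]
  field_simp
  ring

/-- Rate of convergence in `L¹` of the cost estimator, for a square integrable cost. -/
lemma exists_abs_What_rate (hc2 : ∀ j, Integrable (fun z => c z (y j) ^ 2) μ)
    (hmin : ∀ v, H ε c μ y w vs ≤ H ε c μ y w v)
    {L : ℝ} (hV : ∀ n, Integrable (fun ω => ‖V⟦n, ω⟧ - vs‖ ^ 2) P ∧
      ∫ ω, ‖V⟦n, ω⟧ - vs‖ ^ 2 ∂P ≤ L)
    {K : ℝ} (hE : ∀ n : ℕ, 1 ≤ n → (n : ℝ)⁻¹ * ∑ k ∈ Finset.range n,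
      ∫ ω, excess ε c μ y w vs V⟦k, ω⟧ ∂P ≤ K * (n : ℝ) ^ (-(1 / 2) : ℝ)) :
    ∃ C > 0, ∀ n : ℕ, 1 ≤ n →
      ∫ ω, |What ε c y w α β γ (V₀ ω) (fun k => x k ω) n + H ε c μ y w vs| ∂P ≤
        C / Real.sqrt n := by
  let f : X → EuclideanSpace ℝ (Fin J) → ℝ := fun z v => h ε c y w z v - H ε c μ y w v
  have hfm : Measurable fun q : X × EuclideanSpace ℝ (Fin J) => f q.1 q.2 :=
    D.measurable_h.sub (Measurable.comp (g := fun v => H ε c μ y w v) D.measurable_H measurable_snd)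
  have hcenter : ∀ v, ∫ z, f z v ∂μ = 0 := fun v => by
    simp only [f]
    rw [integral_sub (D.integrable_h v) (integrable_const _)]
    simp [H]
  have hfx : ∀ v, Measurable fun z => f z v := fun v =>
    Measurable.comp (f := fun z => (z, v)) hfm (measurable_id.prodMk measurable_const)
  have hhs : MemLp (fun z => f z vs) 2 μ := by
    have h1 : MemLp (fun z => ε + ∑ j, w j * c z (y j) + 2 * ‖vs‖ + |H ε c μ y w vs|) 2 μ := by
      refine (((memLp_const ε).add (memLp_finsetSum _ fun j _ => ?_)).add (memLp_const _)).add
        (memLp_const _)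
      exact ((memLp_two_iff_integrable_sq
        (D.cost_meas j).aestronglyMeasurable).2 (hc2 j)).const_mul _
    refine h1.mono' (hfx vs).aestronglyMeasurable (Filter.Eventually.of_forall fun z => ?_)
    rw [Real.norm_eq_abs]
    exact (abs_sub _ _).trans (by linarith [D.abs_h_le z vs])
  set B := ∫ z, f z vs ^ 2 ∂μ with hB
  have hB0 : 0 ≤ B := integral_nonneg fun z => sq_nonneg _
  have hL0 : 0 ≤ L := (integral_nonneg fun ω => sq_nonneg _).trans (hV 0).2
  -- `f` is 4-Lipschitz in the dual variable, and `32 = 2 * 4 ^ 2`.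
  have hpt : ∀ k ω, f (x k ω) V⟦k, ω⟧ ^ 2 ≤ 32 * ‖V⟦k, ω⟧ - vs‖ ^ 2 + 2 * f (x k ω) vs ^ 2 := by
    intro k ω
    have h1 := D.abs_h_sub_le (x k ω) V⟦k, ω⟧ vs
    have h2 := D.abs_H_sub_le V⟦k, ω⟧ vs
    have h3 : |f (x k ω) V⟦k, ω⟧ - f (x k ω) vs| ≤ 4 * ‖V⟦k, ω⟧ - vs‖ := by
      simp only [f]
      rw [abs_le] at h1 h2 ⊢
      constructor <;> linarith [h1.1, h1.2, h2.1, h2.2]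
    have h4 := pow_le_pow_left₀ (abs_nonneg _) h3 2
    rw [sq_abs] at h4
    nlinarith [sq_nonneg (f (x k ω) V⟦k, ω⟧ - 2 * f (x k ω) vs)]
  have hfs : ∀ k, Integrable (fun ω => f (x k ω) vs ^ 2) P ∧ ∫ ω, f (x k ω) vs ^ 2 ∂P = B :=
    fun k => by
      constructor
      · have h1 := hhs.integrable_sq
        rw [← A.law k] at h1
        exact h1.comp_measurable (A.meas k)
      · rw [hB, ← A.law k, integral_map (A.meas k).aemeasurable
          ((hfx vs).pow_const 2).aestronglyMeasurable]
  have hR : ∀ k, Integrable (fun ω => 32 * ‖V⟦k, ω⟧ - vs‖ ^ 2 + 2 * f (x k ω) vs ^ 2) P :=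
    fun k => ((hV k).1.const_mul _).add ((hfs k).1.const_mul _)
  have hfVm : ∀ k, Measurable fun ω => f (x k ω) V⟦k, ω⟧ := fun k =>
    Measurable.comp (g := fun q : X × EuclideanSpace ℝ (Fin J) => f q.1 q.2)
      (f := fun ω => (x k ω, V⟦k, ω⟧)) hfm ((A.meas k).prodMk (D.measurable_Vhat A k))
  have hL2 : ∀ k, MemLp (fun ω => f (x k ω) V⟦k, ω⟧) 2 P := fun k =>
    (memLp_two_iff_integrable_sq (hfVm k).aestronglyMeasurable).2
      ((hR k).mono' ((hfVm k).pow_const 2).aestronglyMeasurable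
        (Filter.Eventually.of_forall fun ω => by
          rw [Real.norm_of_nonneg (sq_nonneg _)]; exact hpt k ω))
  have hexc : ∀ k, Integrable (fun ω => excess ε c μ y w vs V⟦k, ω⟧) P := fun k =>
    (D.integrable_H_Vhat A (hV k).1).sub (integrable_const _)
  refine ⟨(32 * L + 2 * B + 1) / 2 + |K|, by positivity, fun n hn => ?_⟩
  have hn0 : (0 : ℝ) < n := by exact_mod_cast hn
  have hsq : 0 < Real.sqrt n := Real.sqrt_pos.2 hn0
  obtain ⟨hTmem, hTeq⟩ := A.integral_sum_sq_le (V := fun k ω => V⟦k, ω⟧)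
    (fun n k hk => D.measurable_past_Vhat hk) hfm hcenter hL2 n
  have hT : ∫ ω, (∑ k ∈ Finset.range n, f (x k ω) V⟦k, ω⟧) ^ 2 ∂P ≤ n * (32 * L + 2 * B) := by
    rw [hTeq]
    have h1 : ∀ k ∈ Finset.range n, ∫ ω, f (x k ω) V⟦k, ω⟧ ^ 2 ∂P ≤ 32 * L + 2 * B := fun k _ => by
      refine (integral_mono (hL2 k).integrable_sq (hR k) (hpt k)).trans ?_
      rw [integral_add ((hV k).1.const_mul _) ((hfs k).1.const_mul _), integral_const_mul,
        integral_const_mul, (hfs k).2]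
      linarith [(hV k).2]
    have := Finset.sum_le_sum h1
    rwa [Finset.sum_const, Finset.card_range, nsmul_eq_mul] at this
  have hdec : ∀ ω, |What ε c y w α β γ (V₀ ω) (fun k => x k ω) n + H ε c μ y w vs| ≤
      ((∑ k ∈ Finset.range n, f (x k ω) V⟦k, ω⟧) ^ 2 / (n * Real.sqrt n) + 1 / Real.sqrt n) / 2 +
        (n : ℝ)⁻¹ * ∑ k ∈ Finset.range n, excess ε c μ y w vs V⟦k, ω⟧ := by
    intro ω
    set T := ∑ k ∈ Finset.range n, f (x k ω) V⟦k, ω⟧ with hTdef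
    set E := (n : ℝ)⁻¹ * ∑ k ∈ Finset.range n, excess ε c μ y w vs V⟦k, ω⟧ with hEdef
    have hE0 : 0 ≤ E := mul_nonneg (by positivity)
      (Finset.sum_nonneg fun k _ => excess_nonneg hmin _)
    have h1 : What ε c y w α β γ (V₀ ω) (fun k => x k ω) n + H ε c μ y w vs =
        -((n : ℝ)⁻¹ * T + E) := by
      rw [hEdef, hTdef, ← mul_add, ← Finset.sum_add_distrib, What]
      simp only [f, excess, sub_add_sub_cancel, Finset.sum_sub_distrib, Finset.sum_const,
        Finset.card_range, nsmul_eq_mul]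
      field_simp
      ring
    rw [h1, abs_neg]
    refine (abs_add_le _ _).trans (add_le_add ?_ (abs_of_nonneg hE0).le)
    have h2 : Real.sqrt n * Real.sqrt n = n := Real.mul_self_sqrt hn0.le
    have h3 : |(n : ℝ)⁻¹ * T| = |T| / n := by rw [abs_mul, abs_of_pos (inv_pos.2 hn0)]; ring
    -- The arithmetic-geometric inequality, balanced at `|T| = √n`, passes from the second moment of
    -- `T` to its first.
    have h4 : (T ^ 2 / (n * Real.sqrt n) + 1 / Real.sqrt n) / 2 - |T| / n =
        (|T| - Real.sqrt n) ^ 2 / (2 * n * Real.sqrt n) := by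
      rw [sub_sq, sq_abs, sq (Real.sqrt n), h2]
      field_simp
      ring
    have h5 : 0 ≤ (|T| - Real.sqrt n) ^ 2 / (2 * n * Real.sqrt n) := by positivity
    rw [h3]
    linarith
  have hI1 : Integrable (fun ω => ((∑ k ∈ Finset.range n, f (x k ω) V⟦k, ω⟧) ^ 2 /
      (n * Real.sqrt n) + 1 / Real.sqrt n) / 2) P :=
    ((hTmem.integrable_sq.div_const _).add (integrable_const _)).div_const _
  have hI2 : Integrable (fun ω =>
      (n : ℝ)⁻¹ * ∑ k ∈ Finset.range n, excess ε c μ y w vs V⟦k, ω⟧) P :=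
    (integrable_finsetSum _ fun k _ => hexc k).const_mul _
  refine (integral_mono ((D.integrable_What A (fun k => (hV k).1) n).add
    (integrable_const _)).abs (hI1.add hI2) hdec).trans ?_
  rw [integral_add' hI1 hI2, integral_div, integral_add (hTmem.integrable_sq.div_const _)
    (integrable_const _), integral_div, integral_const_mul, integral_finsetSum _ fun k _ => hexc k]
  simp only [integral_const, probReal_univ, smul_eq_mul, one_mul]
  have h1 : (∫ ω, (∑ k ∈ Finset.range n, f (x k ω) V⟦k, ω⟧) ^ 2 ∂P) / (n * Real.sqrt n) ≤
      (32 * L + 2 * B) / Real.sqrt n := by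
    rw [div_le_div_iff₀ (by positivity) hsq]
    calc _ ≤ n * (32 * L + 2 * B) * Real.sqrt n := mul_le_mul_of_nonneg_right hT hsq.le
      _ = _ := by ring
  have h2 : K * (n : ℝ) ^ (-(1 / 2) : ℝ) ≤ |K| / Real.sqrt n := by
    rw [Real.rpow_neg hn0.le, ← Real.sqrt_eq_rpow, div_eq_mul_inv]
    exact mul_le_mul_of_nonneg_right (le_abs_self K) (by positivity)
  have h3 := hE n hn
  have h4 : ((32 * L + 2 * B + 1) / 2 + |K|) / Real.sqrt n =
      ((32 * L + 2 * B) / Real.sqrt n + 1 / Real.sqrt n) / 2 + |K| / Real.sqrt n := by ring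
  rw [h4]
  linarith

end IsSemiDual

end SemiDiscreteOT

end

/-! ### The theorem. -/

theorem theorem6
    {𝒳 𝒴 Ω : Type*}
    [MetricSpace 𝒳] [MeasurableSpace 𝒳] [BorelSpace 𝒳]
    [MetricSpace 𝒴] [MeasurableSpace 𝒴] [BorelSpace 𝒴]
    [MeasurableSpace Ω] (P : Measure Ω) [IsProbabilityMeasure P]
    -- the source measure
    (μ : Measure 𝒳) [IsProbabilityMeasure μ]
    -- the target measure, with support `{y_1, …, y_J}` and weights `w_1, …, w_J`
    {J : ℕ} (y : Fin J → 𝒴) (hy : Function.Injective y)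
    (w : Fin J → ℝ) (hw : ∀ j, 0 < w j) (hw_sum : ∑ j, w j = 1)
    -- the cost function
    (c : 𝒳 → 𝒴 → ℝ) (hc : LowerSemicontinuous fun z : 𝒳 × 𝒴 => c z.1 z.2)
    (c𝒳 : 𝒳 → ℝ) (c𝒴 : 𝒴 → ℝ) (hc𝒳 : Integrable c𝒳 μ)
    (hc𝒴 : Integrable c𝒴 (SemiDiscreteOT.discreteMeasure y w))
    (hc_bound : ∀ x z, 0 ≤ c x z ∧ c x z ≤ c𝒳 x + c𝒴 z)
    -- the regularization parameter: `ε ≤ min(ν) / (max(ν) - min(ν))`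
    (ε : ℝ) (hε : 0 < ε) (hε_le : ε * ((⨆ j, w j) - ⨅ j, w j) ≤ ⨅ j, w j)
    -- the minimizer of `H_ε` in the orthogonal complement of `v_J`
    (vstar : EuclideanSpace ℝ (Fin J)) (hvstar : vstar ∈ SemiDiscreteOT.vJPerp J)
    (hvstar_min : ∀ v, SemiDiscreteOT.H ε c μ y w vstar ≤ SemiDiscreteOT.H ε c μ y w v)
    -- the invertibility assumption
    (hG : ∃ lam > 0, ∀ u ∈ SemiDiscreteOT.vJPerp J,
      lam * ‖u‖ ^ 2 ≤ u.ofLp ⬝ᵥ (SemiDiscreteOT.G ε c μ y w vstar *ᵥ u.ofLp))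
    -- the independent sample (`X n` is the observation of index `n + 1`) and the initial value
    (X : ℕ → Ω → 𝒳) (hX : ∀ n, Measurable (X n)) (hX_law : ∀ n, P.map (X n) = μ)
    (hX_indep : iIndepFun X P)
    (V₀ : Ω → EuclideanSpace ℝ (Fin J)) (hV₀ : Measurable V₀)
    (hV₀_perp : ∀ᵐ ω ∂P, V₀ ω ∈ SemiDiscreteOT.vJPerp J)
    (hV₀_indep : IndepFun V₀ (fun ω n => X n ω) P)
    (hV₀_exp : ∃ t > 0, Integrable (fun ω => Real.exp (t * ‖V₀ ω‖)) P)
    -- the parameters of the algorithm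
    (α β γ : ℝ) (hα : 0 < α) (hα' : α < 1 / 2) (hβ : 0 < β) (hαβ : 4 * β < 1 - 2 * α)
    (hγ : 0 < γ) :
    let V : ℕ → Ω → EuclideanSpace ℝ (Fin J) := fun n ω =>
      SemiDiscreteOT.Vhat ε c y w α β γ (V₀ ω) (fun k => X k ω) n
    let S : ℕ → Ω → Matrix (Fin J) (Fin J) ℝ := fun n ω =>
      SemiDiscreteOT.Sbar ε c y w α β γ (V₀ ω) (fun k => X k ω) n
    let W : ℕ → Ω → ℝ := fun n ω =>
      SemiDiscreteOT.What ε c y w α β γ (V₀ ω) (fun k => X k ω) n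
    let Wε : ℝ := SemiDiscreteOT.regularizedCost ε c μ (SemiDiscreteOT.discreteMeasure y w)
    ∃ C : ℝ, 0 < C ∧
      (∀ n : ℕ, 1 ≤ n →
        (Integrable (fun ω => ‖V n ω - vstar‖ ^ 2) P ∧
          ∫ ω, ‖V n ω - vstar‖ ^ 2 ∂P ≤ C / (n : ℝ) ^ (1 - α)) ∧
        (Integrable (fun ω =>
            SemiDiscreteOT.frobSq (S n ω - SemiDiscreteOT.G ε c μ y w vstar)) P ∧
          ∫ ω, SemiDiscreteOT.frobSq (S n ω - SemiDiscreteOT.G ε c μ y w vstar) ∂P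
            ≤ C / (n : ℝ) ^ (2 * β)) ∧
        (Integrable (W n) P ∧
          |∫ ω, W n ω ∂P - Wε| ≤ C / (n : ℝ) ^ (1 - α))) ∧
      ((∀ j, Integrable (fun x => c x (y j) ^ 2) μ) →
        ∀ n : ℕ, 1 ≤ n → ∫ ω, |W n ω - Wε| ∂P ≤ C / Real.sqrt n) := by
  intro V S W Wε
  have D : SemiDiscreteOT.IsSemiDual ε c μ y w :=
    { eps_pos := hε
      weight_pos := hw
      weight_sum := hw_sum
      cost_nonneg := fun x j => (hc_bound x (y j)).1
      cost_meas := fun j => (hc.comp (by fun_prop : Continuous fun x : 𝒳 => (x, y j))).measurable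
      cost_int := fun j => (hc𝒳.add (integrable_const (c𝒴 (y j)))).mono'
        (hc.comp (by fun_prop : Continuous fun x : 𝒳 => (x, y j))).measurable.aestronglyMeasurable
        (Filter.Eventually.of_forall fun x => by
          rw [Real.norm_of_nonneg (hc_bound x (y j)).1]; exact (hc_bound x (y j)).2) }
  have A : SemiDiscreteOT.IsSampling P μ X V₀ :=
    { meas := hX
      law := hX_law
      indep := hX_indep
      meas_init := hV₀
      indep_init := hV₀_indep }
  have := D.neZero
  have hvs : ∑ j, vstar j = 0 := (SemiDiscreteOT.mem_vJPerp vstar).1 hvstar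
  have hWε : Wε = -SemiDiscreteOT.H ε c μ y w vstar := D.regularizedCost_eq hy hvstar_min
  have h1α : 0 < 1 - α := by linarith
  obtain ⟨t, ht, K, hK, hrate⟩ := D.exists_rates A hα hβ hαβ hγ hvstar_min hvs hG hV₀_exp
  obtain ⟨L, hL, hLV⟩ := D.exists_norm_sq_rate A hvstar_min hvs ht hK fun n hn => (hrate n hn).1
  obtain ⟨L', hL', hLS⟩ := D.exists_frobSq_Sbar_rate A hβ (by linarith) hγ hK
    fun n hn => (hrate n hn).2
  have hV0 : Integrable (fun ω => ‖V 0 ω - vstar‖ ^ 2) P :=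
    A.integrable_norm_sub_sq_init hV₀_exp
  have hVint : ∀ n, Integrable (fun ω => ‖V n ω - vstar‖ ^ 2) P := fun n => by
    rcases Nat.eq_zero_or_pos n with rfl | hn
    · exact hV0
    · exact (hLV n hn).1
  -- The initial value enters the average without any rate; its contribution is absorbed in the
  -- constant.
  set B := ∫ ω, SemiDiscreteOT.excess ε c μ y w vstar (V 0 ω) ∂P with hB
  have havg : ∀ n : ℕ, 1 ≤ n → (n : ℝ)⁻¹ * ∑ k ∈ Finset.range n,
      ∫ ω, SemiDiscreteOT.excess ε c μ y w vstar (V k ω) ∂P ≤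
        2 * (|B| + K / t) / (1 - (1 - α)) * (n : ℝ) ^ (-(1 - α)) := fun n hn =>
    SemiDiscreteOT.average_le (by positivity) h1α.le (by linarith)
      ((le_abs_self B).trans (le_add_of_nonneg_right (by positivity)))
      (fun k hk => by
        obtain ⟨hi, hb⟩ := (hrate k hk).1
        have h1 := D.integral_excess_le A ht hvstar_min hi hb
        have h2 : 0 ≤ |B| * (k : ℝ) ^ (-(1 - α)) := by positivity
        calc _ ≤ K * (k : ℝ) ^ (-(1 - α)) / t := h1
          _ ≤ |B| * (k : ℝ) ^ (-(1 - α)) + K * (k : ℝ) ^ (-(1 - α)) / t :=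
              le_add_of_nonneg_left h2
          _ = _ := by ring) hn
  set K' := 2 * (|B| + K / t) / (1 - (1 - α)) with hK'
  have hK'0 : 0 ≤ K' := by
    have : 0 < 1 - (1 - α) := by linarith
    positivity
  -- The excess is nonnegative, so the absolute bias is exactly its averaged expectation.
  have hEW : ∀ n : ℕ, 1 ≤ n → |∫ ω, W n ω ∂P - Wε| ≤ K' * (n : ℝ) ^ (-(1 - α)) := fun n hn => by
    rw [hWε, sub_neg_eq_add, D.integral_What_add A hVint hn, abs_neg, abs_of_nonneg]
    · exact havg n hn
    · exact mul_nonneg (by positivity) (Finset.sum_nonneg fun k _ =>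
        integral_nonneg fun ω => SemiDiscreteOT.IsSemiDual.excess_nonneg hvstar_min _)
  have hconv : ∀ {a b s : ℝ} {n : ℕ}, a ≤ b → a * (n : ℝ) ^ (-s) ≤ b / (n : ℝ) ^ s :=
    fun {a b s n} hab => by
      rw [Real.rpow_neg (Nat.cast_nonneg n), div_eq_mul_inv]
      exact mul_le_mul_of_nonneg_right hab (by positivity)
  have hL1 : ∃ C > 0, (∀ j, Integrable (fun x => c x (y j) ^ 2) μ) →
      ∀ n : ℕ, 1 ≤ n → ∫ ω, |W n ω - Wε| ∂P ≤ C / Real.sqrt n := by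
    -- The final constant is chosen before square integrability is assumed, hence the case
    -- distinction; `α < 1 / 2` gives `n ^ (-(1 - α)) ≤ n ^ (-1/2)`.
    by_cases hc2 : ∀ j, Integrable (fun x => c x (y j) ^ 2) μ
    · obtain ⟨C, hC, hCle⟩ := D.exists_abs_What_rate A hc2 hvstar_min
        (L := L + ∫ ω, ‖V 0 ω - vstar‖ ^ 2 ∂P) (fun n => ⟨hVint n, by
          have h0 : 0 ≤ ∫ ω, ‖V 0 ω - vstar‖ ^ 2 ∂P := integral_nonneg fun ω => sq_nonneg _
          rcases Nat.eq_zero_or_pos n with rfl | hn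
          · exact le_add_of_nonneg_left hL.le
          · have h1 : L * (n : ℝ) ^ (-(1 - α)) ≤ L :=
              mul_le_of_le_one_right hL.le (Real.rpow_le_one_of_one_le_of_nonpos
                (by exact_mod_cast hn) (by linarith))
            linarith [(hLV n hn).2]⟩)
        (K := K') (fun n hn => (havg n hn).trans (mul_le_mul_of_nonneg_left
          (Real.rpow_le_rpow_of_exponent_le (by exact_mod_cast hn) (by linarith)) hK'0))
      refine ⟨C, hC, fun _ n hn => ?_⟩
      rw [hWε]
      simpa only [sub_neg_eq_add] using hCle n hn
    · exact ⟨1, one_pos, fun h => absurd h hc2⟩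
  obtain ⟨C, hC, hCle⟩ := hL1
  refine ⟨L + L' + K' + C, by positivity, fun n hn => ⟨⟨hVint n, ?_⟩, ⟨(hLS n hn).1, ?_⟩,
    ⟨D.integrable_What A hVint n, ?_⟩⟩, fun hc2 n hn => ?_⟩
  · exact (hLV n hn).2.trans (hconv (by linarith))
  · exact (hLS n hn).2.trans (hconv (by linarith))
  · exact (hEW n hn).trans (hconv (by linarith))
  · exact (hCle hc2 n hn).trans (div_le_div_of_nonneg_right (by linarith) (Real.sqrt_nonneg _))
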